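/- **Setting.** A *universe of vertex separations* on a set $V$ is a set $U$ of pairs $(A,B)$ of subsets of $V$ with $A\cup B=V$ that is closed under $(A,B)\wedge(C,D)=(A\cap C,B\cup D)$, $(A,B)\vee(C,D)=(A\cup C,B\cap D)$ and $(A,B)^*=(B,A)$. Its elements are called separations; they are ordered by $(A,B)\le(C,D)$ iff $A\subseteq C$ and $D\subseteq B$. The *order* of $(A,B)$ is $|A\cap B|$ ($\infty$ if infinite), and $S_m$ denotes the set of separations of order less than $m$. The universe is *limit-closed* if for every integer $m\ge 0$ every non-empty chain $(A_i,B_i)_i$ of separations of order at most $m$ has a supremum in $U$, and this supremum has order at most $m$ and is of the form $(\bigcup_iA_i\cup Y,\bigcap_iB_i)$ with $Y\subseteq V$. An *$m$-tangle* is a set $T\subseteq S_m$ such that: for every $s\in S_m$ exactly one element of $\{s,s^*\}$ lies in $T$; if $r,s\in T$ and $r^*\le s$ then $\{r,r^*\}=\{s,s^*\}$; and $A_1\cup A_2\cup A_3\ne V$ for all $(A_1,B_1),(A_2,B_2),(A_3,B_3)\in T$. Let $I$ be a (linearly) cyclically ordered set with at least two elements. In a cyclically ordered set, $]a,b[$ is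 the set of $c$ with $(a,c,b)$ in the cyclic order, and $[a,b]={]a,b[}\cup\{a,b\}$. A subset $J$ is an interval if for all $s,t\in J$ one of $[s,t]$, $[t,s]$ is contained in $J$. The *cycle completion* $C(I)$ is the cyclically ordered set $C\supseteq I$, unique up to isomorphism, that induces the order of $I$ and in which every interval $J$ of $I$ with $\emptyset\neq J\neq I$ is $[v,w]\cap I$ for exactly one pair $v,w\in C\setminus I$. The elements of $C(I)\setminus I$ are called *cutpoints*. Every $i\in I$ has a predecessor $p(i)$ and a successor $s(i)$ in $C(I)$. Given a family $(P_z)_{z\in C(I)}$ of subsets of $V$, let $X=V\setminus\bigcup_zP_z$, and for cutpoints $v,w$ let $V(v,w)=X\cup\bigcup_{z\in[v,w]}P_z$ and $S(v,w)=(V(v,w),V(w,v))$. The family is a *$k$-pseudoflower* if * $2|P_v|+|X|=k$ for every cutpoint $v$; * for all distinct cutpoints $v,w$, $S(v,w)\in U$ has order at most $k$ and $V(v,w)\cap V(w,v)=P_v\cup P_w\cup X$; * $P_{p(i)}\cup P_{s(i)}\subseteq P_i$ for every $i\in I$; * for all $i,i'\in I$, if $2|P_i|+|X|=k$ and $P_i=P_{i'}$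 then $i=i'$. A $k$-pseudoflower $\Phi'$ on $I'$ *extends* a $k$-pseudoflower $\Phi$ on $I$, written $\Phi\le\Phi'$, if $X=X'$ and there is a surjection $F:C(I')\to C(I)$ with $F(I')=I$ that is monotone (if $F(b)\in{]F(a),F(c)[}$ then $b\in{]a,c[}$) such that $V(v,w)=X\cup\bigcup_{z\in F^{-1}([v,w])}P'_z$ for all cutpoints $v,w$ of $\Phi$. A $k$-pseudoflower $\Psi$ is *$\le$-maximal* if $\Psi\le\Psi'$ implies $\Psi'\le\Psi$. A $k$-pseudoflower *distinguishes* tangles $T,T'$ if $S(v,w)\in T$ and $S(w,v)\in T'$ for some distinct cutpoints $v,w$. **Theorem.** Let $k\ge 0$ be an integer, let $U$ be a limit-closed universe of vertex separations and let $\Phi$ be a $k$-pseudoflower of $U$. Suppose that there are three $(k+1)$-tangles that contain the same separations of order less than $k$ (that is, they induce the same $k$-tangle) and that are pairwise distinguished by $\Phi$. Then there is a $\le$-maximal $k$-pseudoflower $\Psi$ with $\Phi\le\Psi$. -/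

import Mathlib

universe u

open Set

namespace PseudoFlower

/-! ### Universes of vertex separations -/

section Separations

variable {V : Type u}

/-- The inverse `(B, A)` of a pair `(A, B)`. -/
def sepInv (s : Set V × Set V) : Set V × Set V := (s.2, s.1)

/-- `(A, B) ∧ (C, D) = (A ∩ C, B ∪ D)`. -/
def sepInf (s t : Set V × Set V) : Set V × Set V := (s.1 ∩ t.1, s.2 ∪ t.2)

/-- `(A, B) ∨ (C, D) = (A ∪ C, B ∩ D)`. -/
def sepSup (s t : Set V × Set V) : Set V × Set V := (s.1 ∪ t.1, s.2 ∩ t.2)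

/-- `(A, B) ≤ (C, D)` if `A ⊆ C` and `D ⊆ B`. This is not the product order. -/
def SepLE (s t : Set V × Set V) : Prop := s.1 ⊆ t.1 ∧ t.2 ⊆ s.2

/-- The order of `(A, B)`: the size of `A ∩ B`, or `⊤` if `A ∩ B` is infinite. -/
noncomputable def sepOrder (s : Set V × Set V) : ℕ∞ := (s.1 ∩ s.2).encard

variable (V) in
/-- A universe of vertex separations on the ground set `V`. -/
structure SepUniverse where
  seps : Set (Set V × Set V)
  union_eq : ∀ s ∈ seps, s.1 ∪ s.2 = univ
  inf_mem : ∀ s ∈ seps, ∀ t ∈ seps, sepInf s t ∈ seps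
  sup_mem : ∀ s ∈ seps, ∀ t ∈ seps, sepSup s t ∈ seps
  inv_mem : ∀ s ∈ seps, sepInv s ∈ seps

/-- For every `m : ℕ`, every non-empty chain of separations of order at most `m` has a supremum
in the universe; this supremum has order at most `m` and is of the form `(A ∪ Y, B)`, where `A` is
the union of the left sides and `B` is the intersection of the right sides of the chain. -/
def SepUniverse.LimitClosed (U : SepUniverse V) : Prop :=
  ∀ (m : ℕ) (c : Set (Set V × Set V)), c ⊆ U.seps → c.Nonempty → IsChain SepLE c →
    (∀ s ∈ c, sepOrder s ≤ m) →
    ∃ Y : Set V,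
      ((⋃ s ∈ c, s.1) ∪ Y, ⋂ s ∈ c, s.2) ∈ U.seps ∧
      sepOrder ((⋃ s ∈ c, s.1) ∪ Y, ⋂ s ∈ c, s.2) ≤ m ∧
      (∀ s ∈ c, SepLE s ((⋃ s ∈ c, s.1) ∪ Y, ⋂ s ∈ c, s.2)) ∧
      ∀ t ∈ U.seps, (∀ s ∈ c, SepLE s t) → SepLE ((⋃ s ∈ c, s.1) ∪ Y, ⋂ s ∈ c, s.2) t

/-- `S_m`: the separations of order less than `m`. -/
def SepUniverse.sepsLT (U : SepUniverse V) (m : ℕ) : Set (Set V × Set V) :=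
  {s | s ∈ U.seps ∧ sepOrder s < m}

/-- A consistent orientation of `S_m`. -/
structure SepUniverse.IsConsistentOrientation (U : SepUniverse V) (m : ℕ)
    (O : Set (Set V × Set V)) : Prop where
  subset : O ⊆ U.sepsLT m
  mem_or : ∀ s ∈ U.sepsLT m, s ∈ O ∨ sepInv s ∈ O
  eq_of_mem : ∀ s, s ∈ O → sepInv s ∈ O → s = sepInv s
  consistent : ∀ r ∈ O, ∀ s ∈ O, SepLE (sepInv r) s →
    ({r, sepInv r} : Set (Set V × Set V)) = {s, sepInv s}

/-- An `m`-tangle of the universe: a consistent orientation of the separations of order less than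
`m` such that no three left sides cover the ground set. -/
structure SepUniverse.IsTangle (U : SepUniverse V) (m : ℕ) (T : Set (Set V × Set V)) : Prop
    extends U.IsConsistentOrientation m T where
  not_cover : ∀ r ∈ T, ∀ s ∈ T, ∀ t ∈ T, r.1 ∪ s.1 ∪ t.1 ≠ univ

end Separations

/-! ### Cyclic orders and cycle completions

A (linear) cyclic order is a `CircularOrder`; `sbtw a b c` is the strict ternary relation. -/

section Cyclic

variable {C : Type u} [CircularOrder C]

/-- The closed interval `[a, b] = ]a, b[ + a + b`. In particular `[a, a] = {a}`, unlike for
`Set.cIcc`. -/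
def cycIcc (a b : C) : Set C := insert a (insert b (Set.cIoo a b))

/-- `s` is the successor of `a`. -/
def IsCycSucc (a s : C) : Prop := s ≠ a ∧ ∀ b, ¬ sbtw a b s

/-- `J` is an interval of `I`, with the cyclic order that `I` inherits from `C`. -/
def IsIntervalOf (I J : Set C) : Prop :=
  J ⊆ I ∧ ∀ s ∈ J, ∀ t ∈ J, cycIcc s t ∩ I ⊆ J ∨ cycIcc t s ∩ I ⊆ J

/-- `C` is a cycle completion of its subset `I`: each non-trivial interval of `I` is `[v, w] ∩ I`
for exactly one pair of elements `v, w` of `C \ I`. -/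
def IsCycleCompletion (I : Set C) : Prop :=
  ∀ J : Set C, IsIntervalOf I J → J ≠ ∅ → J ≠ I →
    ∃! p : C × C, p.1 ∉ I ∧ p.2 ∉ I ∧ J = cycIcc p.1 p.2 ∩ I

/-- A monotone map between cyclic orders. -/
def CycMonotone {C' : Type u} [CircularOrder C'] (F : C' → C) : Prop :=
  ∀ a b c, sbtw (F a) (F b) (F c) → sbtw a b c

end Cyclic

/-! ### `k`-pseudoflowers -/

section Families

variable {V C : Type u}

/-- `X`: the vertices in no set of the family. -/
def center (P : C → Set V) : Set V := (⋃ z, P z)ᶜ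

/-- `V(v, w)`. -/
def intervalSet [CircularOrder C] (P : C → Set V) (v w : C) : Set V :=
  (⋃ z ∈ cycIcc v w, P z) ∪ center P

/-- `S(v, w) = (V(v, w), V(w, v))`. -/
def intervalSep [CircularOrder C] (P : C → Set V) (v w : C) : Set V × Set V :=
  (intervalSet P v w, intervalSet P w v)

end Families

/-- A `k`-pseudoflower. Its index set `I` has at least two elements, `C` is the cycle completion
of `I`, and the elements of `C \ I` are the cutpoints. That a set `P z` has exactly `(k - |X|) / 2`
elements is written as `2 * |P z| + |X| = k` in `ℕ∞`. -/
structure Pseudoflower {V : Type u} (U : SepUniverse V) (k : ℕ) where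
  C : Type u
  [circularOrder : CircularOrder C]
  I : Set C
  nontrivial : I.Nontrivial
  completion : IsCycleCompletion I
  P : C → Set V
  card_cut : ∀ v ∉ I, 2 * (P v).encard + (center P).encard = k
  sep_mem : ∀ v ∉ I, ∀ w ∉ I, v ≠ w → intervalSep P v w ∈ U.seps
  sep_order : ∀ v ∉ I, ∀ w ∉ I, v ≠ w → sepOrder (intervalSep P v w) ≤ k
  separator_eq : ∀ v ∉ I, ∀ w ∉ I, v ≠ w →
    intervalSet P v w ∩ intervalSet P w v = P v ∪ P w ∪ center P
  pred_subset : ∀ i ∈ I, ∀ p, IsCycSucc p i → P p ⊆ P i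
  succ_subset : ∀ i ∈ I, ∀ s, IsCycSucc i s → P s ⊆ P i
  star : ∀ i ∈ I, ∀ j ∈ I, 2 * (P i).encard + (center P).encard = k → P i = P j → i = j

attribute [instance] Pseudoflower.circularOrder

section Flowers

variable {V : Type u} {U : SepUniverse V} {k : ℕ}

/-- `Φ ≤ Φ'`, that is, `Φ'` extends `Φ`. -/
def Pseudoflower.Extends (Φ Φ' : Pseudoflower U k) : Prop :=
  center Φ.P = center Φ'.P ∧
    ∃ F : Φ'.C → Φ.C, Function.Surjective F ∧ CycMonotone F ∧ F '' Φ'.I = Φ.I ∧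
      ∀ v ∉ Φ.I, ∀ w ∉ Φ.I,
        intervalSet Φ.P v w = center Φ.P ∪ ⋃ z ∈ F ⁻¹' cycIcc v w, Φ'.P z

/-- `Φ` is `≤`-maximal for the pre-order `≤`. -/
def Pseudoflower.IsLeMaximal (Φ : Pseudoflower U k) : Prop :=
  ∀ Φ' : Pseudoflower U k, Φ.Extends Φ' → Φ'.Extends Φ

/-- Some interval separation of `Φ` is oriented differently by `T` and `T'`. (With `S(v, w)` also
its inverse `S(w, v)` is an interval separation.) -/
def Pseudoflower.Distinguishes (Φ : Pseudoflower U k) (T T' : Set (Set V × Set V)) : Prop :=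
  ∃ v ∉ Φ.I, ∃ w ∉ Φ.I, v ≠ w ∧ intervalSep Φ.P v w ∈ T ∧ sepInv (intervalSep Φ.P v w) ∈ T'

end Flowers

end PseudoFlower

namespace PseudoFlower

/-! ### Cutting a cyclic order open -/

section Cut

/-! The tangles supply rigidity. Each tangle points into one of the arcs between cutpoints, and
three pairwise distinguished tangles give cutpoints u₁, u₂, u₃ whose three arcs each have one tangle
pointing into them (`exists_rigid_bases`). A separation s between S(u₃, u₁) and S(u₃, u₂) of order
less than k would have to be oriented differently by two of the tangles, although they agree below
k. So s has order at least k (`IsTangle.le_order`), and likewise for the other two arcs. In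
particular the sets at the uᵢ are pairwise disjoint.

For a petal in the arc from u₁ to u₂, with neighbouring cutpoints p and s, take a maximal chain of
separations of order at most k between S(u₃, p) and S(u₃, s). By rigidity all its members have order
exactly k, and limit-closedness makes the chain complete, with the right side of a supremum and the
left side of an infimum given by intersections (`exists_sepChain`). Hence every vertex changes sides
at a definite place: in a separator of the chain or at a jump from one member to the next. The petal
is replaced by this chain. Members become cutpoints, carrying their separator without the vertices
of the base u₃ and of X, and jumps become petals.

Two cutpoints of a cycle completion need a petal between them. If the separators are constant on a
stretch of the chain, then the stretch contains a jump (`exists_jump_of_const`). A stretch without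
jumps therefore has changing separators, and there a trivial petal, equal to its two neighbours, is
inserted. The last pseudoflower axiom allows each set to occur only once as a trivial petal, so one
place is selected for every set that occurs as such a separator (`exists_isSelective`).

That S(c, d) lies in U is known at first only if one of c, d is the base of the other, or if both
are old. The remaining S(c, d) are infima of known ones, and disjointness of the three base sets
makes these infima correct (`isGoodPair_of_three_bases`).

For maximality, suppose that an extension has a new cutpoint inside a petal. Its separation from the
base lies between the two separations bounding the petal, so by maximality of the chain it equals
one of them. This forces a trivial petal in the extension whose set already occurs as a trivial
petal, and uniqueness of trivial petals leaves no room for the petals on both sides of the new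
cutpoint (`isLeMaximal_of_saturated`). -/

theorem sbtw_or_sbtw {C : Type u} [CircularOrder C] {a b c : C} (hab : a ≠ b) (hbc : b ≠ c)
    (hca : c ≠ a) : sbtw a b c ∨ sbtw c b a := by
  rw [sbtw_iff_not_btw, sbtw_iff_not_btw, ← not_and_or]
  rintro ⟨h, h'⟩
  rcases btw_antisymm h h' with e | e | e
  · exact hbc e.symm
  · exact hab e.symm
  · exact hca e.symm

/-- The linear order with least element `o` that is obtained by cutting a cyclic order at `o`. -/
noncomputable abbrev cutOrder {C : Type u} [CircularOrder C] (o : C) : LinearOrder C where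
  le x y := x = o ∨ x = y ∨ sbtw o x y
  le_refl x := Or.inr (Or.inl rfl)
  le_trans x y z := by
    rintro (h | rfl | h) (h' | rfl | h')
    · exact Or.inl h
    · exact Or.inl h
    · exact Or.inl h
    · exact Or.inl h'
    · exact Or.inr (Or.inl rfl)
    · exact Or.inr (Or.inr h')
    · subst h'; exact absurd h sbtw_irrefl_left_right
    · exact Or.inr (Or.inr h)
    · exact Or.inr (Or.inr (h.trans_right h'))
  le_antisymm x y := by
    rintro (h | h | h) (h' | h' | h')
    · rw [h, h']
    · exact h'.symm
    · subst h; exact absurd h' sbtw_irrefl_left_right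
    · exact h
    · exact h
    · exact h
    · subst h'; exact absurd h sbtw_irrefl_left_right
    · exact h'.symm
    · exact absurd h.cyclic_left h'.not_sbtw
  le_total x y := by
    by_cases hx : x = o
    · exact Or.inl (Or.inl hx)
    by_cases hy : y = o
    · exact Or.inr (Or.inl hy)
    by_cases hxy : x = y
    · exact Or.inl (Or.inr (Or.inl hxy))
    rcases sbtw_or_sbtw (Ne.symm hx) hxy hy with h | h
    · exact Or.inl (Or.inr (Or.inr h))
    · exact Or.inr (Or.inr (Or.inr h.cyclic_right))
  toDecidableLE := Classical.decRel _

/-- The linear order of `C` is the cyclic order of `C`, cut open at `o`. -/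
structure IsCutAt {C : Type u} [CircularOrder C] [LinearOrder C] (o : C) : Prop where
  bot_le : ∀ x, o ≤ x
  sbtw_iff : ∀ a b c : C, sbtw a b c ↔ (a < b ∧ b < c) ∨ (b < c ∧ c < a) ∨ (c < a ∧ a < b)

/-- No linear order is fixed as an instance, so each argument can cut at the point that suits it.
Statements about cyclic positions then become order arithmetic. -/
theorem exists_isCutAt {C : Type u} [CircularOrder C] (o : C) :
    ∃ _ : LinearOrder C, IsCutAt o := by
  let _ := cutOrder o
  have hlt : ∀ {x y : C}, x < y → y ≠ o ∧ (x = o ∨ sbtw o x y) := by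
    intro x y h
    have h1 : x = o ∨ x = y ∨ sbtw o x y := h.le
    refine ⟨fun e => h.not_ge (Or.inl e), ?_⟩
    rcases h1 with h1 | h1 | h1
    · exact Or.inl h1
    · exact absurd h1 h.ne
    · exact Or.inr h1
  have key : ∀ {a b c : C}, a < b → b < c → sbtw a b c := by
    intro a b c hab hbc
    obtain ⟨hb, ha⟩ := hlt hab
    obtain ⟨hc, hb'⟩ := hlt hbc
    have hb' := hb'.resolve_left hb
    rcases ha with rfl | ha
    · exact hb'
    · exact (hb'.cyclic_left.trans_right ha.cyclic_right).cyclic_right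
  refine ⟨inferInstance, fun x => Or.inl rfl, fun a b c => ⟨fun h => ?_, ?_⟩⟩
  · have h1 : a ≠ b := by rintro rfl; exact sbtw_irrefl_left h
    have h2 : b ≠ c := by rintro rfl; exact sbtw_irrefl_right h
    have h3 : c ≠ a := by rintro rfl; exact sbtw_irrefl_left_right h
    rcases lt_or_gt_of_ne h1 with h1 | h1 <;> rcases lt_or_gt_of_ne h2 with h2 | h2 <;>
      rcases lt_or_gt_of_ne h3 with h3 | h3
    · exact Or.inr (Or.inl ⟨h2, h3⟩)
    · exact Or.inl ⟨h1, h2⟩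
    · exact Or.inr (Or.inr ⟨h3, h1⟩)
    · exact absurd (key h3 h2).cyclic_left h.not_sbtw
    · exact Or.inr (Or.inl ⟨h2, h3⟩)
    · exact absurd (key h1 h3).cyclic_right h.not_sbtw
    · exact absurd (key h2 h1) h.not_sbtw
    · exact absurd (key h2 h1) h.not_sbtw
  · rintro (⟨h, h'⟩ | ⟨h, h'⟩ | ⟨h, h'⟩)
    · exact key h h'
    · exact (key h h').cyclic_right
    · exact (key h h').cyclic_left

end Cut

/-! ### Cycle completions seen in a cut-open linear order -/

section LinearCompletion

variable {C : Type u} [CircularOrder C]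

theorem mem_cycIcc {a b x : C} : x ∈ cycIcc a b ↔ x = a ∨ x = b ∨ sbtw a x b := Iff.rfl

theorem IsCutAt.mem_cycIcc [LinearOrder C] {o : C} (h : IsCutAt o) {a b x : C} :
    x ∈ cycIcc a b ↔
      x = a ∨ x = b ∨ (a < x ∧ x < b) ∨ (x < b ∧ b < a) ∨ (b < a ∧ a < x) := by
  rw [PseudoFlower.mem_cycIcc, h.sbtw_iff]

/-- Cycle completions, described in the linear order that is obtained by cutting at `o`. -/
structure IsLinCompletion [LinearOrder C] (o : C) (I : Set C) : Prop where
  bot_notMem : o ∉ I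
  sep : ∀ c ∉ I, ∀ d ∉ I, c ≠ d → ∃ i ∈ I, sbtw c i d
  cut : ∀ L ⊆ I, (∀ i ∈ L, ∀ j ∈ I, j ≤ i → j ∈ L) → L.Nonempty → L ≠ I →
    ∃ c ∉ I, ∀ i ∈ I, (i ∈ L ↔ i < c)

/-- If `I` missed the arc from `c` to `d`, then an initial segment of the remaining arc, ending at a
cutpoint b, would be the trace of both [c, b] and [d, b], against uniqueness. Two elements of `I`
are needed for a proper non-empty initial segment. -/
theorem IsCycleCompletion.sep {I : Set C} (hI : IsCycleCompletion I) (hn : I.Nontrivial)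
    {c d : C} (hc : c ∉ I) (hd : d ∉ I) (hcd : c ≠ d) : ∃ i ∈ I, sbtw c i d := by
  by_contra hcon
  push Not at hcon
  obtain ⟨_, h⟩ := exists_isCutAt d
  have hdc : d < c := lt_of_le_of_ne (h.bot_le c) hcd.symm
  have hlt : ∀ x ∈ I, d < x ∧ x < c := by
    intro x hx
    have h1 := hcon x hx
    rw [h.sbtw_iff] at h1
    have h2 : x ≠ c := fun e => hc (e ▸ hx)
    have h3 : d < x := lt_of_le_of_ne (h.bot_le x) (fun e => hd (e ▸ hx))
    grind
  obtain ⟨i, hi, j, hj, hij⟩ : ∃ i ∈ I, ∃ j ∈ I, i < j := by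
    obtain ⟨i, hi, j, hj, hij⟩ := hn
    rcases lt_or_gt_of_ne hij with h | h
    · exact ⟨i, hi, j, hj, h⟩
    · exact ⟨j, hj, i, hi, h⟩
  obtain ⟨⟨a, b⟩, ⟨ha, hb, hJ⟩, huniq⟩ := hI {x | x ∈ I ∧ x ≤ i}
    ⟨fun x hx => hx.1, fun s hs t ht => by
      rcases le_total s t with hst | hst
      · left
        rintro x ⟨hx, hxI⟩
        refine ⟨hxI, ?_⟩
        rw [h.mem_cycIcc] at hx
        have := hs.2; have := ht.2
        grind
      · right
        rintro x ⟨hx, hxI⟩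
        refine ⟨hxI, ?_⟩
        rw [h.mem_cycIcc] at hx
        have := hs.2; have := ht.2
        grind⟩
    (by intro e; have : i ∈ {x | x ∈ I ∧ x ≤ i} := ⟨hi, le_rfl⟩; rw [e] at this; exact this)
    (by intro e; rw [← e] at hj; exact hij.not_ge hj.2)
  simp only at ha hb hJ
  have hmem : ∀ x, (x ∈ I ∧ x ≤ i) ↔ (x ∈ cycIcc a b ∧ x ∈ I) := fun x => by
    have := Set.ext_iff.1 hJ x
    exact this
  have hi' := (hmem i).1 ⟨hi, le_rfl⟩ |>.1
  have hj' : j ∉ cycIcc a b := fun hj' => hij.not_ge ((hmem j).2 ⟨hj', hj⟩).2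
  rw [h.mem_cycIcc] at hi' hj'
  have hai : a ≠ i := fun e => ha (e ▸ hi)
  have hbi : b ≠ i := fun e => hb (e ▸ hi)
  have hli := hlt i hi
  have hlj := hlt j hj
  -- Whether or not [a, b] wraps around the cut, its right end falls between `i` and `j`, because
  -- `i` lies in it and `j` does not.
  have hib : i < b ∧ b < j := by
    have := h.bot_le a; have := h.bot_le b
    by_contra hx
    have hbj : b ≠ j := fun e => hb (e ▸ hj)
    have h1 := hlt
    by_cases hbi' : b < i
    · grind
    · grind
  have gen : ∀ e, (∀ x ∈ I, (x ∈ cycIcc e b ↔ x < b)) →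
      {x | x ∈ I ∧ x ≤ i} = cycIcc e b ∩ I := by
    intro e he
    ext x
    constructor
    · rintro ⟨hx, hxi⟩
      exact ⟨(he x hx).2 (hxi.trans_lt hib.1), hx⟩
    · rintro ⟨hx, hxI⟩
      have hxb := (he x hxI).1 hx
      refine ⟨hxI, ?_⟩
      by_contra hxi
      have := (hmem x).2 ⟨?_, hxI⟩
      · exact hxi this.2
      · rw [h.mem_cycIcc]
        grind
  have e1 := huniq (c, b) ⟨hc, hb, gen c fun x hx => by
    rw [h.mem_cycIcc]; have := hlt x hx; have : x ≠ b := fun e => hb (e ▸ hx); grind⟩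
  have e2 := huniq (d, b) ⟨hd, hb, gen d fun x hx => by
    rw [h.mem_cycIcc]; have := hlt x hx; have : x ≠ b := fun e => hb (e ▸ hx)
    have := h.bot_le b; grind⟩
  exact hcd (congrArg Prod.fst (e1.trans e2.symm))

theorem IsCycleCompletion.isLinCompletion [LinearOrder C] {o : C} (h : IsCutAt o) {I : Set C}
    (hI : IsCycleCompletion I) (hn : I.Nontrivial) (ho : o ∉ I) : IsLinCompletion o I where
  bot_notMem := ho
  sep c hc d hd hcd := hI.sep hn hc hd hcd
  cut L hL hlow hne hneI := by
    obtain ⟨⟨a, b⟩, ⟨ha, hb, hJ⟩, -⟩ := hI L ⟨hL, fun s hs t ht => by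
      rcases le_total s t with hst | hst
      · left
        rintro x ⟨hx, hxI⟩
        rw [h.mem_cycIcc] at hx
        exact hlow t ht x hxI (by grind)
      · right
        rintro x ⟨hx, hxI⟩
        rw [h.mem_cycIcc] at hx
        exact hlow s hs x hxI (by grind)⟩ hne.ne_empty hneI
    refine ⟨b, hb, fun i hi => ?_⟩
    simp only at ha hb hJ
    have hmem : ∀ x, x ∈ L ↔ (x ∈ cycIcc a b ∧ x ∈ I) := fun x => by rw [hJ]; rfl
    obtain ⟨l, hl⟩ := hne
    obtain ⟨j, hj, hjL⟩ : ∃ j ∈ I, j ∉ L := by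
      by_contra hx
      push Not at hx
      exact hneI (hL.antisymm hx)
    have hlj : l < j := by
      by_contra hx
      exact hjL (hlow l hl j hj (not_lt.1 hx))
    have n1 : ∀ x ∈ I, x ≠ a := fun x hx e => ha (e ▸ hx)
    have n2 : ∀ x ∈ I, x ≠ b := fun x hx e => hb (e ▸ hx)
    have hl' := ((hmem l).1 hl).1
    have hj' : j ∉ cycIcc a b := fun hx => hjL ((hmem j).2 ⟨hx, hj⟩)
    have hlI := hL hl
    have hi' := hmem i
    rw [h.mem_cycIcc] at hl' hj' hi'
    have := n1 l hlI; have := n2 l hlI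
    have := n1 j hj; have := n2 j hj
    have := n1 i hi; have := n2 i hi
    constructor
    · intro hiL
      have hij : i < j := by
        by_contra hx
        exact hjL (hlow i hiL j hj (not_lt.1 hx))
      have := hi'.1 hiL
      grind
    · intro hib
      by_cases hil : i ≤ l
      · exact hlow l hl i hi hil
      · rw [hi']
        refine ⟨?_, hi⟩
        grind

/-- After cutting at `o`, a cyclic interval is convex or has a convex complement, and the ends of a
convex set are found as cuts of initial segments. The ends are unique because any two distinct
cutpoints have an element of `I` between them, which tells the candidate intervals apart. -/
theorem IsLinCompletion.isCycleCompletion [LinearOrder C] {o : C} (h : IsCutAt o) {I : Set C}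
    (hI : IsLinCompletion o I) : IsCycleCompletion I := by
  have ho := hI.bot_notMem
  -- The point `o` serves at both extremes. As the least element it cuts off the empty segment, and
  -- cyclically it also closes off all of `I`. The latter is a separate alternative because no
  -- element is below `o`.
  have hcut : ∀ L ⊆ I, (∀ i ∈ L, ∀ j ∈ I, j ≤ i → j ∈ L) →
      ∃ c ∉ I, (∀ i ∈ I, (i ∈ L ↔ i < c)) ∨ (c = o ∧ L = I) := by
    intro L hL hlow
    by_cases hne : L.Nonempty
    · by_cases hLI : L = I
      · exact ⟨o, ho, Or.inr ⟨rfl, hLI⟩⟩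
      · obtain ⟨c, hc, h'⟩ := hI.cut L hL hlow hne hLI
        exact ⟨c, hc, Or.inl h'⟩
    · refine ⟨o, ho, Or.inl fun i _ => ⟨fun hi => absurd ⟨i, hi⟩ hne, fun hi => ?_⟩⟩
      exact absurd hi (h.bot_le i).not_gt
  have hconv : ∀ J ⊆ I, (∀ s ∈ J, ∀ t ∈ J, ∀ x ∈ I, s < x → x < t → x ∈ J) → J ≠ ∅ → J ≠ I →
      ∃ p : C × C, p.1 ∉ I ∧ p.2 ∉ I ∧ ∀ x ∈ I, (x ∈ J ↔ x ∈ cycIcc p.1 p.2) := by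
    intro J hJ hc hne hneI
    obtain ⟨a, ha, ha'⟩ := hcut {i | i ∈ I ∧ ∀ j ∈ J, i < j} (fun i hi => hi.1)
      (fun i hi j hj hji => ⟨hj, fun j' hj' => hji.trans_lt (hi.2 j' hj')⟩)
    obtain ⟨b, hb, hb'⟩ := hcut {i | i ∈ I ∧ ∃ j ∈ J, i ≤ j} (fun i hi => hi.1)
      (fun i hi j hj hji => ⟨hj, by obtain ⟨t, ht, hit⟩ := hi.2; exact ⟨t, ht, hji.trans hit⟩⟩)
    obtain ⟨j0, hj0⟩ := Set.nonempty_iff_ne_empty.2 hne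
    have ha1 : ∀ i ∈ I, ((∀ j ∈ J, i < j) ↔ i < a) := by
      rcases ha' with ha' | ⟨-, ha'⟩
      · intro i hi
        rw [← ha' i hi]
        exact ⟨fun hx => ⟨hi, hx⟩, fun hx => hx.2⟩
      · have : j0 ∈ {i | i ∈ I ∧ ∀ j ∈ J, i < j} := by rw [ha']; exact hJ hj0
        exact absurd (this.2 j0 hj0) (lt_irrefl _)
    refine ⟨(a, b), ha, hb, fun x hx => ?_⟩
    rw [h.mem_cycIcc]
    have hJx : x ∈ J ↔ ¬ x < a ∧ ∃ j ∈ J, x ≤ j := by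
      rw [← ha1 x hx]
      constructor
      · intro hxJ
        exact ⟨fun hcon => lt_irrefl _ (hcon x hxJ), x, hxJ, le_rfl⟩
      · rintro ⟨h1, j, hj, hxj⟩
        push Not at h1
        obtain ⟨j', hj', h2⟩ := h1
        rcases eq_or_lt_of_le h2 with e | h2
        · exact e ▸ hj'
        rcases eq_or_lt_of_le hxj with e | h3
        · exact e ▸ hj
        exact hc j' hj' j hj x hx h2 h3
    have hxa : x ≠ a := fun e => ha (e ▸ hx)
    have hxb : x ≠ b := fun e => hb (e ▸ hx)
    rcases hb' with hb' | ⟨rfl, hb'⟩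
    · have hb1 : (∃ j ∈ J, x ≤ j) ↔ x < b := by
        rw [← hb' x hx]
        exact ⟨fun h1 => ⟨hx, h1⟩, fun h1 => h1.2⟩
      have hj0a : ¬ j0 < a := fun hcon => lt_irrefl _ ((ha1 j0 (hJ hj0)).2 hcon j0 hj0)
      have hj0b : j0 < b := (hb' j0 (hJ hj0)).1 ⟨hJ hj0, j0, hj0, le_rfl⟩
      rw [hJx, hb1]
      grind
    · have hb1 : ∃ j ∈ J, x ≤ j := by
        have : x ∈ {i | i ∈ I ∧ ∃ j ∈ J, i ≤ j} := by rw [hb']; exact hx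
        exact this.2
      have hao : a ≠ b := by
        rintro rfl
        refine hneI (hJ.antisymm fun y hy => ?_)
        have hy1 : ∃ j ∈ J, y ≤ j := by
          have : y ∈ {i | i ∈ I ∧ ∃ j ∈ J, i ≤ j} := by rw [hb']; exact hy
          exact this.2
        have hy2 : ¬ y < a := (h.bot_le y).not_gt
        rw [← ha1 y hy] at hy2
        push Not at hy2
        obtain ⟨j', hj', h2⟩ := hy2
        obtain ⟨j, hj, h3⟩ := hy1
        rcases eq_or_lt_of_le h2 with e | h2
        · exact e ▸ hj'
        rcases eq_or_lt_of_le h3 with e | h3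
        · exact e ▸ hj
        exact hc j' hj' j hj y hy h2 h3
      have := h.bot_le a
      have := h.bot_le x
      rw [hJx]
      grind
  intro J hJ hne hneI
  have hex : ∃ p : C × C, p.1 ∉ I ∧ p.2 ∉ I ∧ J = cycIcc p.1 p.2 ∩ I := by
    by_cases hc : ∀ s ∈ J, ∀ t ∈ J, ∀ x ∈ I, s < x → x < t → x ∈ J
    · obtain ⟨p, h1, h2, h3⟩ := hconv J hJ.1 hc hne hneI
      refine ⟨p, h1, h2, ?_⟩
      ext x
      exact ⟨fun hx => ⟨(h3 x (hJ.1 hx)).1 hx, hJ.1 hx⟩, fun hx => (h3 x hx.2).2 hx.1⟩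
    · push Not at hc
      obtain ⟨s, hs, t, ht, x, hx, hsx, hxt, hxJ⟩ := hc
      -- Here `J` wraps around `o`, so its complement is convex. The ends of the complement,
      -- exchanged, are the ends of `J`.
      obtain ⟨p, h1, h2, h3⟩ := hconv (I \ J) (fun y hy => hy.1) (by
        intro a ha b hb y hy hay hyb
        refine ⟨hy, fun hyJ => ?_⟩
        have out : ∀ z ∈ I \ J, s < z ∧ z < t := by
          intro z hz
          have n1 : z ≠ s := fun e => hz.2 (e ▸ hs)
          have n2 : z ≠ t := fun e => hz.2 (e ▸ ht)
          rcases hJ.2 s hs t ht with h' | h'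
          · exact absurd (h' ⟨h.mem_cycIcc.2 (by grind), hx⟩) hxJ
          · by_contra hcon
            exact hz.2 (h' ⟨h.mem_cycIcc.2 (by grind), hz.1⟩)
        have h1 := out a ha
        have h2 := out b hb
        rcases hJ.2 s hs y hyJ with h' | h'
        · exact ha.2 (h' ⟨h.mem_cycIcc.2 (by grind), ha.1⟩)
        · exact hb.2 (h' ⟨h.mem_cycIcc.2 (by grind), hb.1⟩))
        (Set.nonempty_iff_ne_empty.1 ⟨x, hx, hxJ⟩)
        (fun e => by rw [← e] at hx; have := e ▸ hJ.1 hs; exact this.2 hs)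
      refine ⟨(p.2, p.1), h2, h1, ?_⟩
      ext y
      by_cases hy : y ∈ I
      · have h4 := h3 y hy
        have n1 : y ≠ p.1 := fun e => h1 (e ▸ hy)
        have n2 : y ≠ p.2 := fun e => h2 (e ▸ hy)
        have h12 : p.1 ≠ p.2 := by
          intro e
          have := (h3 x hx).1 ⟨hx, hxJ⟩
          rw [h.mem_cycIcc] at this
          have n1 : x ≠ p.1 := fun e => h1 (e ▸ hx)
          have n2 : x ≠ p.2 := fun e => h2 (e ▸ hx)
          grind
        have h5 : y ∈ cycIcc p.2 p.1 ↔ ¬ y ∈ cycIcc p.1 p.2 := by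
          rw [h.mem_cycIcc, h.mem_cycIcc]
          grind
        simp only [mem_inter_iff, hy, and_true]
        rw [h5, ← h4]
        simp [hy]
      · exact ⟨fun hyJ => absurd (hJ.1 hyJ) hy, fun hyJ => absurd hyJ.2 hy⟩
  obtain ⟨p, hp⟩ := hex
  refine ⟨p, hp, fun q hq => ?_⟩
  obtain ⟨v, w⟩ := p
  obtain ⟨v', w'⟩ := q
  simp only at hp hq
  obtain ⟨hv, hw, rfl⟩ := hp
  obtain ⟨hv', hw', he⟩ := hq
  have hmem : ∀ x ∈ I, (x ∈ cycIcc v w ↔ x ∈ cycIcc v' w') := fun x hx => by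
    have := Set.ext_iff.1 he x
    simpa [hx] using this
  have hvw : v ≠ w := by
    rintro rfl
    refine hne (Set.eq_empty_of_forall_notMem fun x hx => ?_)
    have := h.mem_cycIcc.1 hx.1
    have n1 : x ≠ v := fun e => hv (e ▸ hx.2)
    grind
  have hvw' : v' ≠ w' := by
    rintro rfl
    refine hne (Set.eq_empty_of_forall_notMem fun x hx => ?_)
    have := h.mem_cycIcc.1 ((hmem x hx.2).1 hx.1)
    have n1 : x ≠ v' := fun e => hv' (e ▸ hx.2)
    grind
  have test : ∀ c ∉ I, ∀ d ∉ I, c ≠ d →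
      ∃ i, i ≠ v ∧ i ≠ w ∧ i ≠ v' ∧ i ≠ w' ∧ (sbtw v i w ↔ sbtw v' i w') ∧ sbtw c i d := by
    intro c hc d hd hcd
    obtain ⟨i, hi, h'⟩ := hI.sep c hc d hd hcd
    have n1 : i ≠ v := fun e => hv (e ▸ hi)
    have n2 : i ≠ w := fun e => hw (e ▸ hi)
    have n3 : i ≠ v' := fun e => hv' (e ▸ hi)
    have n4 : i ≠ w' := fun e => hw' (e ▸ hi)
    refine ⟨i, n1, n2, n3, n4, ?_, h'⟩
    have := hmem i hi
    rwa [mem_cycIcc, mem_cycIcc, or_iff_right n1, or_iff_right n2, or_iff_right n3,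
      or_iff_right n4] at this
  simp only [h.sbtw_iff] at test
  have hvv : v' = v := by
    by_contra hne
    have t1 := test v hv v' hv' (Ne.symm hne)
    have t2 := test v' hv' v hv hne
    by_cases hwv : w = v'
    · grind
    have t3 := test w hw v' hv' hwv
    have t4 := test v' hv' w hw (Ne.symm hwv)
    grind
  subst hvv
  have hww : w' = w := by
    by_contra hne
    have t1 := test w hw w' hw' (Ne.symm hne)
    have t2 := test w' hw' w hw hne
    grind
  rw [hww]

end LinearCompletion

/-! ### Predecessors and successors of petals -/

section Neighbours

variable {C : Type u} [CircularOrder C]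

theorem IsCycSucc.pred_unique {p q i : C} (hp : IsCycSucc p i) (hq : IsCycSucc q i) : p = q := by
  by_contra hne
  rcases sbtw_or_sbtw hne hq.1.symm hp.1 with h | h
  · exact hp.2 _ h
  · exact hq.2 _ h.cyclic_left

theorem IsCycSucc.succ_unique {i s t : C} (hs : IsCycSucc i s) (ht : IsCycSucc i t) : s = t := by
  by_contra hne
  rcases sbtw_or_sbtw hs.1.symm hne ht.1 with h | h
  · exact ht.2 _ h
  · exact hs.2 _ h.cyclic_right

variable [LinearOrder C] {o : C} {I : Set C}

/-- The predecessor is the cut between the elements before `i` and the rest, or `o` if there are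
none. No other point fits in between: a cutpoint there would be separated from this one by an
element of `I`. -/
theorem IsLinCompletion.exists_pred (h : IsCutAt o) (hI : IsLinCompletion o I) {i : C}
    (hi : i ∈ I) : ∃ p ∉ I, IsCycSucc p i := by
  have hoi : o ≠ i := fun e => hI.bot_notMem (e ▸ hi)
  have key : ∀ p ∉ I, (∀ j ∈ I, ¬ sbtw p j i) → ∃ p ∉ I, IsCycSucc p i := by
    intro p hp hpi
    refine ⟨p, hp, fun e => hp (e ▸ hi), fun b hb => ?_⟩
    by_cases hbI : b ∈ I
    · exact hpi b hbI hb
    · have hpb : p ≠ b := by rintro rfl; exact sbtw_irrefl_left hb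
      obtain ⟨j, hj, hjb⟩ := hI.sep p hp b hbI hpb
      exact hpi j hj (hjb.trans_right hb)
  by_cases hne : ({j | j ∈ I ∧ j < i} : Set C).Nonempty
  · obtain ⟨c, hc, hci⟩ := hI.cut {j | j ∈ I ∧ j < i} (fun j hj => hj.1)
      (fun j hj j' hj' h' => ⟨hj', h'.trans_lt hj.2⟩) hne
      (fun e => by rw [← e] at hi; exact lt_irrefl _ hi.2)
    refine key c hc fun j hj hcj => ?_
    have h1 := hci i hi
    have h2 := hci j hj
    have : c ≠ i := fun e => hc (e ▸ hi)
    simp only [mem_ofPred, hi, hj, true_and, h.sbtw_iff] at h1 h2 hcj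
    grind
  · refine key o hI.bot_notMem fun j hj hoj => hne ⟨j, hj, ?_⟩
    have := h.bot_le i
    have := h.bot_le j
    rw [h.sbtw_iff] at hoj
    grind

theorem IsLinCompletion.exists_succ (h : IsCutAt o) (hI : IsLinCompletion o I) {i : C}
    (hi : i ∈ I) : ∃ s ∉ I, IsCycSucc i s := by
  have hoi : o ≠ i := fun e => hI.bot_notMem (e ▸ hi)
  have key : ∀ s ∉ I, (∀ j ∈ I, ¬ sbtw i j s) → ∃ s ∉ I, IsCycSucc i s := by
    intro s hs hsi
    refine ⟨s, hs, fun e => hs (e ▸ hi), fun b hb => ?_⟩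
    by_cases hbI : b ∈ I
    · exact hsi b hbI hb
    · have hpb : b ≠ s := by rintro rfl; exact sbtw_irrefl_right hb
      obtain ⟨j, hj, hjb⟩ := hI.sep b hbI s hs hpb
      exact hsi j hj (hb.trans_left hjb)
  by_cases hne : ({j | j ∈ I ∧ j ≤ i} : Set C) = I
  · refine key o hI.bot_notMem fun j hj hoj => ?_
    have h1 : j ∈ ({j | j ∈ I ∧ j ≤ i} : Set C) := by rw [hne]; exact hj
    have h2 := h1.2
    have := h.bot_le i
    have := h.bot_le j
    rw [h.sbtw_iff] at hoj
    grind
  · obtain ⟨c, hc, hci⟩ := hI.cut {j | j ∈ I ∧ j ≤ i} (fun j hj => hj.1)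
      (fun j hj j' hj' h' => ⟨hj', h'.trans hj.2⟩) ⟨i, hi, le_rfl⟩ hne
    refine key c hc fun j hj hcj => ?_
    have h1 := hci i hi
    have h2 := hci j hj
    simp only [mem_ofPred, hi, hj, true_and, h.sbtw_iff] at h1 h2 hcj
    grind

end Neighbours

/-! ### Interval separations as infima, and the three base points -/

section Families

variable {V C : Type u} [CircularOrder C] {P : C → Set V}

theorem notMem_center {C : Type u} {P : C → Set V} {x : V} {z : C} (hx : x ∈ P z) : x ∉ center P :=
  fun h => h (mem_iUnion.2 ⟨z, hx⟩)

theorem mem_or_mem_center {C : Type u} (P : C → Set V) (x : V) : (∃ z, x ∈ P z) ∨ x ∈ center P := by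
  by_cases h : ∃ z, x ∈ P z
  · exact Or.inl h
  · exact Or.inr fun hx => h (mem_iUnion.1 hx)

theorem mem_intervalSet {x : V} {v w : C} :
    x ∈ intervalSet P v w ↔ (∃ z ∈ cycIcc v w, x ∈ P z) ∨ x ∈ center P := by
  simp [intervalSet]

theorem center_subset_intervalSet (v w : C) : center P ⊆ intervalSet P v w :=
  subset_union_right

theorem subset_intervalSet {v w z : C} (hz : z ∈ cycIcc v w) : P z ⊆ intervalSet P v w :=
  fun _ hx => mem_intervalSet.2 (Or.inl ⟨z, hz, hx⟩)

theorem left_mem_cycIcc (a b : C) : a ∈ cycIcc a b := Or.inl rfl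

theorem right_mem_cycIcc (a b : C) : b ∈ cycIcc a b := Or.inr (Or.inl rfl)

theorem intervalSet_mono {v w v' w' : C} (h : cycIcc v w ⊆ cycIcc v' w') :
    intervalSet P v w ⊆ intervalSet P v' w' := by
  intro x hx
  rw [mem_intervalSet] at hx ⊢
  exact hx.imp_left fun ⟨z, hz, hx⟩ => ⟨z, h hz, hx⟩

theorem cycIcc_self (a : C) : cycIcc a a = {a} := by
  ext x
  rw [mem_cycIcc]
  simp [sbtw_irrefl_left_right]

theorem mem_cycIcc_or {v w : C} (hvw : v ≠ w) (z : C) : z ∈ cycIcc v w ∨ z ∈ cycIcc w v := by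
  by_cases h1 : z = v
  · exact Or.inl (Or.inl h1)
  by_cases h2 : z = w
  · exact Or.inl (Or.inr (Or.inl h2))
  rcases sbtw_or_sbtw (Ne.symm h1) h2 hvw.symm with h | h
  · exact Or.inl (Or.inr (Or.inr h))
  · exact Or.inr (Or.inr (Or.inr h))

theorem intervalSet_union {v w : C} (hvw : v ≠ w) :
    intervalSet P v w ∪ intervalSet P w v = univ := by
  refine eq_univ_of_forall fun x => ?_
  rcases mem_or_mem_center P x with ⟨z, hz⟩ | hx
  · exact (mem_cycIcc_or hvw z).imp (fun h => subset_intervalSet h hz)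
      (fun h => subset_intervalSet h hz)
  · exact Or.inl (center_subset_intervalSet _ _ hx)

/-- No vertex lies on both sides of `S(v, w)`, except for those of `P v`, `P w` and `X`. -/
def SeparatesAt (P : C → Set V) (v w : C) : Prop :=
  ∀ x z z', z ∈ cycIcc v w → z' ∈ cycIcc w v → x ∈ P z → x ∈ P z' → x ∈ P v ∨ x ∈ P w

theorem SeparatesAt.symm {v w : C} (h : SeparatesAt P v w) : SeparatesAt P w v :=
  fun x z z' hz hz' hx hx' => (h x z' z hz' hz hx' hx).symm

theorem separatesAt_iff {v w : C} : SeparatesAt P v w ↔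
    intervalSet P v w ∩ intervalSet P w v = P v ∪ P w ∪ center P := by
  constructor
  · intro h
    ext x
    simp only [mem_inter_iff, mem_intervalSet, mem_union]
    constructor
    · rintro ⟨⟨z, hz, hx⟩ | hx, ⟨z', hz', hx'⟩ | hx'⟩
      · exact Or.inl (h x z z' hz hz' hx hx')
      all_goals exact Or.inr ‹_›
    · rintro ((hx | hx) | hx)
      · exact ⟨Or.inl ⟨v, left_mem_cycIcc _ _, hx⟩, Or.inl ⟨v, right_mem_cycIcc _ _, hx⟩⟩
      · exact ⟨Or.inl ⟨w, right_mem_cycIcc _ _, hx⟩, Or.inl ⟨w, left_mem_cycIcc _ _, hx⟩⟩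
      · exact ⟨Or.inr hx, Or.inr hx⟩
  · intro h x z z' hz hz' hx hx'
    have : x ∈ P v ∪ P w ∪ center P := by
      rw [← h]
      exact ⟨subset_intervalSet hz hx, subset_intervalSet hz' hx'⟩
    exact this.resolve_right (notMem_center hx)

/-- `S(v, w)` is a separation of `U` with the right separator. -/
def IsGoodPair (U : SepUniverse V) (P : C → Set V) (v w : C) : Prop :=
  SeparatesAt P v w ∧ intervalSep P v w ∈ U.seps

variable {U : SepUniverse V}

theorem IsGoodPair.symm {v w : C} (h : IsGoodPair U P v w) : IsGoodPair U P w v :=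
  ⟨h.1.symm, U.inv_mem _ h.2⟩

variable [LinearOrder C] {o : C}

/-- For points a, v, w, b in this cyclic order, the arcs [v, b] and [a, w] meet in [v, w]. A vertex
that is in both arcs' sets without coming from [v, w] crosses S(v, b) and S(a, w). It then lies in
`P v` or `P b` and in `P a` or `P w`, and disjointness of `P a` and `P b` puts it in `P v` or `P w`.
-/
theorem intervalSep_eq_inf (h : IsCutAt o) {a v w b : C} (hv : v ∈ cycIcc a w)
    (hw : w ∈ cycIcc v b) (hab : a ∈ cycIcc b v) (hne : a ≠ b) (hvw : v ≠ w)
    (hd : Disjoint (P a) (P b)) (h1 : SeparatesAt P v b) (h2 : SeparatesAt P a w) :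
    intervalSep P v w = sepInf (intervalSep P v b) (intervalSep P a w) := by
  rw [h.mem_cycIcc] at hv hw hab
  refine Prod.ext ?_ ?_
  · ext x
    simp only [intervalSep, sepInf, mem_inter_iff, mem_intervalSet]
    constructor
    · rintro (⟨z, hz, hx⟩ | hx)
      · refine ⟨Or.inl ⟨z, ?_, hx⟩, Or.inl ⟨z, ?_, hx⟩⟩ <;> rw [h.mem_cycIcc] at hz ⊢ <;> grind
      · exact ⟨Or.inr hx, Or.inr hx⟩
    · rintro ⟨⟨z, hz, hx⟩ | hx, ⟨z', hz', hx'⟩ | hx'⟩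
      · by_cases e1 : z ∈ cycIcc v w
        · exact Or.inl ⟨z, e1, hx⟩
        by_cases e2 : z' ∈ cycIcc v w
        · exact Or.inl ⟨z', e2, hx'⟩
        rw [h.mem_cycIcc] at e1 e2
        have t1 := h1 x z z' hz (by rw [h.mem_cycIcc] at hz hz' ⊢; grind) hx hx'
        have t2 := h2 x z' z hz' (by rw [h.mem_cycIcc] at hz hz' ⊢; grind) hx' hx
        rcases t1 with t1 | t1
        · exact Or.inl ⟨v, left_mem_cycIcc _ _, t1⟩
        rcases t2 with t2 | t2
        · exact absurd t1 (disjoint_left.1 hd t2)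
        · exact Or.inl ⟨w, right_mem_cycIcc _ _, t2⟩
      all_goals exact Or.inr ‹_›
  · ext x
    simp only [intervalSep, sepInf, mem_union, mem_intervalSet]
    constructor
    · rintro (⟨z, hz, hx⟩ | hx)
      · have : z ∈ cycIcc b v ∨ z ∈ cycIcc w a := by
          rw [h.mem_cycIcc, h.mem_cycIcc]; rw [h.mem_cycIcc] at hz; grind
        exact this.imp (fun e => Or.inl ⟨z, e, hx⟩) (fun e => Or.inl ⟨z, e, hx⟩)
      · exact Or.inl (Or.inr hx)
    · rintro ((⟨z, hz, hx⟩ | hx) | (⟨z, hz, hx⟩ | hx))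
      · exact Or.inl ⟨z, by rw [h.mem_cycIcc] at hz ⊢; grind, hx⟩
      · exact Or.inr hx
      · exact Or.inl ⟨z, by rw [h.mem_cycIcc] at hz ⊢; grind, hx⟩
      · exact Or.inr hx

theorem isGoodPair_of_inf (h : IsCutAt o) {a v w b : C} (hv : v ∈ cycIcc a w)
    (hw : w ∈ cycIcc v b) (hab : a ∈ cycIcc b v) (hne : a ≠ b) (hvw : v ≠ w)
    (hd : Disjoint (P a) (P b)) (h1 : IsGoodPair U P v b) (h2 : IsGoodPair U P a w)
    (h3 : SeparatesAt P v w) : IsGoodPair U P v w := by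
  refine ⟨h3, ?_⟩
  rw [intervalSep_eq_inf h hv hw hab hne hvw hd h1.1 h2.1]
  exact U.inf_mem _ h1.2 _ h2.2

/-- Good pairs with the third of three base points give good pairs with the other two. -/
theorem isGoodPair_arc (h : IsCutAt o) {a b e c : C} (habe : sbtw a b e) (hc : c ∈ cycIcc a b)
    (hae : Disjoint (P a) (P e)) (hbe : Disjoint (P b) (P e))
    (gab : IsGoodPair U P a b) (gae : IsGoodPair U P a e) (gbe : IsGoodPair U P b e)
    (g : IsGoodPair U P e c) :
    (c ≠ a → IsGoodPair U P a c) ∧ (c ≠ b → IsGoodPair U P c b) := by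
  rw [h.mem_cycIcc] at hc
  rw [h.sbtw_iff] at habe
  have hee : e ∈ cycIcc b a := by rw [h.mem_cycIcc]; grind
  constructor
  · intro hca
    refine isGoodPair_of_inf h (a := e) (v := a) (w := c) (b := b) ?_ ?_ ?_ ?_ hca.symm hbe.symm
      gab g ?_
    · rw [h.mem_cycIcc]; grind
    · rw [h.mem_cycIcc]; grind
    · rw [h.mem_cycIcc]; grind
    · grind
    · intro x z z' hz hz' hx hx'
      rw [h.mem_cycIcc] at hz
      by_cases hxe : x ∈ P e
      · have := gab.1 x z e (by rw [h.mem_cycIcc]; grind) hee hx hxe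
        rcases this with t | t
        · exact Or.inl t
        · exact absurd hxe (disjoint_left.1 hbe t)
      by_cases hz3 : z' ∈ cycIcc c e
      · exact Or.inr ((g.1 x z z' (by rw [h.mem_cycIcc]; grind) hz3 hx hx').resolve_left hxe)
      · rw [h.mem_cycIcc] at hz' hz3
        exact Or.inl ((gae.1 x z z' (by rw [h.mem_cycIcc]; grind)
          (by rw [h.mem_cycIcc]; grind) hx hx').resolve_right hxe)
  · intro hcb
    refine isGoodPair_of_inf h (a := a) (v := c) (w := b) (b := e) ?_ ?_ ?_ ?_ hcb hae
      g.symm gab ?_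
    · rw [h.mem_cycIcc]; grind
    · rw [h.mem_cycIcc]; grind
    · rw [h.mem_cycIcc]; grind
    · grind
    · intro x z z' hz hz' hx hx'
      rw [h.mem_cycIcc] at hz
      by_cases hxe : x ∈ P e
      · have := gab.1 x z e (by rw [h.mem_cycIcc]; grind) hee hx hxe
        rcases this with t | t
        · exact absurd hxe (disjoint_left.1 hae t)
        · exact Or.inr t
      by_cases hz3 : z' ∈ cycIcc e c
      · exact Or.inl ((g.1 x z' z hz3 (by rw [h.mem_cycIcc]; grind) hx' hx).resolve_left hxe)
      · rw [h.mem_cycIcc] at hz' hz3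
        exact Or.inr ((gbe.1 x z' z (by rw [h.mem_cycIcc]; grind)
          (by rw [h.mem_cycIcc]; grind) hx' hx).resolve_right hxe)

omit [LinearOrder C] in
-- Cut at `u`. A vertex outside `P u` and `P c` occurs on one side of `c` only, and similarly for
-- `d`. So a vertex outside all three sets cannot occur both between `c` and `d` and elsewhere.
theorem SeparatesAt.of_base {x : V} {u c d z z' : C}
    (hc : c ≠ u → SeparatesAt P u c) (hd : d ≠ u → SeparatesAt P u d) (hu : x ∉ P u)
    (hz : z ∈ cycIcc c d) (hz' : z' ∈ cycIcc d c) (hx : x ∈ P z) (hx' : x ∈ P z') :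
    x ∈ P c ∨ x ∈ P d := by
  by_contra hcon
  push Not at hcon
  obtain ⟨hxc, hxd⟩ := hcon
  obtain ⟨_, h⟩ := exists_isCutAt u
  have key : ∀ e, x ∉ P e → (e ≠ u → SeparatesAt P u e) →
      ∀ z z', x ∈ P z → x ∈ P z' → z < e → e < z' → False := by
    intro e hxe he z z' h1 h2 h3 h4
    have hue := h.bot_le e
    have huz := h.bot_le z
    refine ((he (by rintro rfl; exact huz.not_gt h3)) x z z' ?_ ?_ h1 h2).elim hu hxe
    · rw [h.mem_cycIcc]; grind
    · rw [h.mem_cycIcc]; grind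
  have n1 : z ≠ c := fun e => hxc (e ▸ hx)
  have n2 : z ≠ d := fun e => hxd (e ▸ hx)
  have n3 : z' ≠ c := fun e => hxc (e ▸ hx')
  have n4 : z' ≠ d := fun e => hxd (e ▸ hx')
  have c1 := key c hxc hc z z' hx hx'
  have c2 := key c hxc hc z' z hx' hx
  have d1 := key d hxd hd z z' hx hx'
  have d2 := key d hxd hd z' z hx' hx
  rw [h.mem_cycIcc] at hz hz'
  clear key hc hd hu hx hx' hxc hxd h
  grind

omit [LinearOrder C] in
-- Each point is assumed good only with the base opposite to its arc. Infima with the separations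
-- between bases make it good with all three bases, and then any S(c, d) is the infimum of S(c, b)
-- and S(a, d) for suitable bases a, b. Three bases suffice for every position of c and d.
theorem isGoodPair_of_three_bases (K : Set C) {u₁ u₂ u₃ : C}
    (h123 : sbtw u₁ u₂ u₃) (hu₁ : u₁ ∈ K) (hu₂ : u₂ ∈ K) (hu₃ : u₃ ∈ K)
    (d12 : Disjoint (P u₁) (P u₂)) (d23 : Disjoint (P u₂) (P u₃)) (d31 : Disjoint (P u₃) (P u₁))
    (g12 : ∀ c ∈ K, c ∈ cycIcc u₁ u₂ → IsGoodPair U P u₃ c)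
    (g23 : ∀ c ∈ K, c ∈ cycIcc u₂ u₃ → IsGoodPair U P u₁ c)
    (g31 : ∀ c ∈ K, c ∈ cycIcc u₃ u₁ → IsGoodPair U P u₂ c) {c d : C} (hc : c ∈ K) (hd : d ∈ K)
    (hcd : c ≠ d) : IsGoodPair U P c d := by
  obtain ⟨_, h⟩ := exists_isCutAt u₁
  have e12 : IsGoodPair U P u₁ u₂ := g23 u₂ hu₂ (left_mem_cycIcc _ _)
  have e23 : IsGoodPair U P u₂ u₃ := g31 u₃ hu₃ (left_mem_cycIcc _ _)
  have e31 : IsGoodPair U P u₃ u₁ := g12 u₁ hu₁ (left_mem_cycIcc _ _)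
  have a12 := fun c hc hc' => isGoodPair_arc h h123 (c := c) hc' d31.symm d23 e12 e31.symm e23
    (g12 c hc hc')
  have a23 := fun c hc hc' => isGoodPair_arc h h123.cyclic_left (c := c) hc' d12.symm d31 e23
    e12.symm e31 (g23 c hc hc')
  have a31 := fun c hc hc' => isGoodPair_arc h h123.cyclic_right (c := c) hc' d23.symm d12 e31
    e23.symm e12 (g31 c hc hc')
  have cover : ∀ c, c ∈ cycIcc u₁ u₂ ∨ c ∈ cycIcc u₂ u₃ ∨ c ∈ cycIcc u₃ u₁ := by
    intro c
    rw [h.mem_cycIcc, h.mem_cycIcc, h.mem_cycIcc]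
    rw [h.sbtw_iff] at h123
    grind
  have all : ∀ c ∈ K, (c ≠ u₁ → IsGoodPair U P u₁ c) ∧ (c ≠ u₂ → IsGoodPair U P u₂ c) ∧
      (c ≠ u₃ → IsGoodPair U P u₃ c) := by
    intro c hc
    rcases cover c with h' | h' | h'
    · exact ⟨(a12 c hc h').1, fun e => ((a12 c hc h').2 e).symm, fun _ => g12 c hc h'⟩
    · exact ⟨fun _ => g23 c hc h', (a23 c hc h').1, fun e => ((a23 c hc h').2 e).symm⟩
    · exact ⟨fun e => ((a31 c hc h').2 e).symm, fun _ => g31 c hc h', (a31 c hc h').1⟩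
  have hsep : ∀ c ∈ K, ∀ d ∈ K, c ≠ d → SeparatesAt P c d := by
    intro c hc d hd hcd x z z' hz hz' hx hx'
    -- `SeparatesAt.of_base` needs a base whose set avoids `x`. A vertex of `P u₁` avoids `P u₂`.
    by_cases hx1 : x ∈ P u₁
    · exact SeparatesAt.of_base (u := u₂) (fun e => ((all c hc).2.1 e).1)
        (fun e => ((all d hd).2.1 e).1) (disjoint_left.1 d12 hx1) hz hz' hx hx'
    · exact SeparatesAt.of_base (u := u₁) (fun e => ((all c hc).1 e).1)
        (fun e => ((all d hd).1 e).1) hx1 hz hz' hx hx'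
  have fin : ∀ a b, a ∈ K → b ∈ K → Disjoint (P a) (P b) → a ≠ b →
      (∀ c ∈ K, c ≠ a → IsGoodPair U P a c) → (∀ c ∈ K, c ≠ b → IsGoodPair U P b c) →
      ∀ v ∈ K, ∀ w ∈ K, v ≠ w → v ∈ cycIcc a w → w ∈ cycIcc v b → a ∈ cycIcc b v →
      IsGoodPair U P v w := by
    intro a b ha hb hab hne ga gb v hv w hw hvw h1 h2 h3
    by_cases hvb : v = b
    · subst hvb
      exact gb w hw hvw.symm
    by_cases hwa : w = a
    · subst hwa
      exact (ga v hv hvw).symm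
    exact isGoodPair_of_inf h h1 h2 h3 hne hvw hab (gb v hv hvb).symm (ga w hw hwa)
      (hsep v hv w hw hvw)
  have A1 := fun c hc => (all c hc).1
  have A2 := fun c hc => (all c hc).2.1
  have A3 := fun c hc => (all c hc).2.2
  have cond := h123
  rw [h.sbtw_iff] at cond
  have h1 := h.bot_le u₂
  have h2 := h.bot_le u₃
  have h12 : u₁ < u₂ := by grind
  have h23 : u₂ < u₃ := by grind
  -- In each case the two bases a, b are chosen such that a, c, d, b follow each other cyclically.
  -- If `c` and `d` lie in the first and the last arc, the pair is reversed and the arc runs through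
  -- `u₁`.
  have main : ∀ c ∈ K, ∀ d ∈ K, c < d → IsGoodPair U P c d := by
    intro c hc d hd hcd
    have := h.bot_le c
    have := h.bot_le d
    rcases le_total d u₂ with k1 | k1
    · exact fin u₁ u₂ hu₁ hu₂ d12 h12.ne A1 A2 c hc d hd hcd.ne (by rw [h.mem_cycIcc]; grind)
        (by rw [h.mem_cycIcc]; grind) (by rw [h.mem_cycIcc]; grind)
    rcases le_total u₃ c with k2 | k2
    · exact fin u₃ u₁ hu₃ hu₁ d31 (h12.trans h23).ne' A3 A1 c hc d hd hcd.ne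
        (by rw [h.mem_cycIcc]; grind) (by rw [h.mem_cycIcc]; grind) (by rw [h.mem_cycIcc]; grind)
    rcases le_total c u₂ with k3 | k3 <;> rcases le_total d u₃ with k4 | k4
    · exact fin u₁ u₃ hu₁ hu₃ d31.symm (h12.trans h23).ne A1 A3 c hc d hd hcd.ne
        (by rw [h.mem_cycIcc]; grind) (by rw [h.mem_cycIcc]; grind) (by rw [h.mem_cycIcc]; grind)
    · exact (fin u₃ u₂ hu₃ hu₂ d23.symm h23.ne' A3 A2 d hd c hc hcd.ne'
        (by rw [h.mem_cycIcc]; grind) (by rw [h.mem_cycIcc]; grind)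
        (by rw [h.mem_cycIcc]; grind)).symm
    · exact fin u₂ u₃ hu₂ hu₃ d23 h23.ne A2 A3 c hc d hd hcd.ne (by rw [h.mem_cycIcc]; grind)
        (by rw [h.mem_cycIcc]; grind) (by rw [h.mem_cycIcc]; grind)
    · exact fin u₂ u₁ hu₂ hu₁ d12.symm h12.ne' A2 A1 c hc d hd hcd.ne
        (by rw [h.mem_cycIcc]; grind) (by rw [h.mem_cycIcc]; grind) (by rw [h.mem_cycIcc]; grind)
  rcases lt_or_gt_of_ne hcd with k | k
  · exact main c hc d hd k
  · exact (main d hd c hc k).symm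

end Families

/-! ### Chains of separations that are closed under limits -/

section LimitChain

variable {V M : Type u} [LinearOrder M]

/-- A chain of separations `(A m, B m)` of order `k` whose separators contain `Z`, and that is
closed under suprema and infima. -/
structure IsLimitChain (A B : M → Set V) (Z : Set V) (k : ℕ) : Prop where
  mono : Monotone A
  anti : Antitone B
  cover : ∀ m, A m ∪ B m = univ
  card : ∀ m, (A m ∩ B m).encard = k
  base : ∀ m, Z ⊆ A m ∩ B m
  inj : ∀ m n, A m = A n → B m = B n → m = n
  sup : ∀ S : Set M, S.Nonempty → ∃ s, IsLUB S s ∧ B s = ⋂ n ∈ S, B n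
  inf : ∀ S : Set M, S.Nonempty → ∃ s, IsGLB S s ∧ A s = ⋂ n ∈ S, A n

/-- The part of the separator outside of `Z`. -/
def innerSep (A B : M → Set V) (Z : Set V) (m : M) : Set V := (A m ∩ B m) \ Z

variable {A B : M → Set V} {Z : Set V} {k : ℕ} (h : IsLimitChain A B Z k)
include h

namespace IsLimitChain

theorem mem_or (m : M) (x : V) : x ∈ A m ∨ x ∈ B m := by
  have : x ∈ A m ∪ B m := by rw [h.cover]; trivial
  exact this

theorem encard_innerSep (m : M) : (innerSep A B Z m).encard + Z.encard = k := by
  rw [innerSep, encard_sdiff_add_encard_of_subset (h.base m), h.card]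

theorem finite_base (m : M) : Z.encard ≠ ⊤ := by
  intro e
  have := h.encard_innerSep m
  rw [e, add_top] at this
  exact ENat.top_ne_natCast k this

theorem finite_innerSep (m : M) : (innerSep A B Z m).Finite := by
  rw [← encard_ne_top_iff]
  intro e
  have := h.encard_innerSep m
  rw [e, top_add] at this
  exact ENat.top_ne_natCast k this

/-- All separators have the same finite order and contain `Z`, so their inner parts have the same
finite size. -/
theorem innerSep_eq_of_subset {m n : M} (hmn : innerSep A B Z m ⊆ innerSep A B Z n) :
    innerSep A B Z m = innerSep A B Z n := by
  refine (h.finite_innerSep n).eq_of_subset_of_encard_le' hmn ?_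
  have h1 := h.encard_innerSep m
  rw [← h.encard_innerSep n] at h1
  exact (WithTop.add_right_cancel (h.finite_base m) h1).ge

theorem innerSep_between {m n q : M} (hm : m ≤ q) (hn : q ≤ n) :
    innerSep A B Z m ∩ innerSep A B Z n ⊆ innerSep A B Z q :=
  fun _ hx => ⟨⟨h.mono hm hx.1.1.1, h.anti hn hx.2.1.2⟩, hx.1.2⟩

/-- The two ends are different separations, so some vertex x changes its membership in a side along
the stretch. This splits the stretch into a lower and an upper part. Completeness provides the last
member of the lower part and the first member of the upper part, and these two form a jump. -/
theorem exists_jump_of_const {m m' : M} (hm : m < m') {Q : Set V}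
    (hQ : ∀ n, m ≤ n → n ≤ m' → innerSep A B Z n = Q) :
    ∃ n n', m ≤ n ∧ n ⋖ n' ∧ n' ≤ m' := by
  have hsub : ∀ n n', m ≤ n → n ≤ m' → m ≤ n' → n' ≤ m' → A n ∩ B n ⊆ A n' ∩ B n' := by
    intro n n' h1 h2 h3 h4 x hx
    by_cases hxZ : x ∈ Z
    · exact h.base n' hxZ
    · have : x ∈ innerSep A B Z n := ⟨hx, hxZ⟩
      rw [hQ n h1 h2, ← hQ n' h3 h4] at this
      exact this.1
  have key : ∀ L R : Set M, (∀ n ∈ L, m ≤ n ∧ n ≤ m') → (∀ n ∈ R, m ≤ n ∧ n ≤ m') →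
      (∀ n, m ≤ n → n ≤ m' → n ∈ L ∨ n ∈ R) →
      (∃ s ∈ L, IsLUB L s) → (∃ t ∈ R, IsGLB R t) → (∀ l ∈ L, ∀ r ∈ R, l < r) →
      ∃ n n', m ≤ n ∧ n ⋖ n' ∧ n' ≤ m' := by
    rintro L R hL hR hLR ⟨s, hs, hs'⟩ ⟨t, ht, ht'⟩ hlr
    refine ⟨s, t, (hL s hs).1, ⟨hlr s hs t ht, fun q hsq hqt => ?_⟩, (hR t ht).2⟩
    rcases hLR q ((hL s hs).1.trans hsq.le) (hqt.le.trans (hR t ht).2) with hq | hq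
    · exact (hs'.1 hq).not_gt hsq
    · exact (ht'.1 hq).not_gt hqt
  have hne : ¬ (A m' ⊆ A m ∧ B m ⊆ B m') := fun e =>
    hm.ne (h.inj m m' ((h.mono hm.le).antisymm e.1) (e.2.antisymm (h.anti hm.le)))
  rw [not_and_or, not_subset, not_subset] at hne
  rcases hne with ⟨x, hx, hx'⟩ | ⟨x, hx, hx'⟩
  · obtain ⟨s, hs, hsB⟩ := h.sup {n | (m ≤ n ∧ n ≤ m') ∧ x ∉ A n} ⟨m, ⟨le_rfl, hm.le⟩, hx'⟩
    obtain ⟨t, ht, htA⟩ := h.inf {n | (m ≤ n ∧ n ≤ m') ∧ x ∈ A n} ⟨m', ⟨hm.le, le_rfl⟩, hx⟩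
    have hs1 : m ≤ s ∧ s ≤ m' := ⟨hs.1 ⟨⟨le_rfl, hm.le⟩, hx'⟩, hs.2 fun n hn => hn.1.2⟩
    have ht1 : m ≤ t ∧ t ≤ m' := ⟨ht.2 fun n hn => hn.1.1, ht.1 ⟨⟨hm.le, le_rfl⟩, hx⟩⟩
    refine key {n | (m ≤ n ∧ n ≤ m') ∧ x ∉ A n} {n | (m ≤ n ∧ n ≤ m') ∧ x ∈ A n}
      (fun n hn => hn.1) (fun n hn => hn.1) (fun n h1 h2 => ?_) ⟨s, ⟨hs1, ?_⟩, hs⟩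
      ⟨t, ⟨ht1, ?_⟩, ht⟩ (fun l hl r hr => ?_)
    · by_cases hxn : x ∈ A n
      · exact Or.inr ⟨⟨h1, h2⟩, hxn⟩
      · exact Or.inl ⟨⟨h1, h2⟩, hxn⟩
    -- The supremum stays in the lower part because of constancy: `x` lies in `B s`, so if it were
    -- also in `A s` it would lie in the common separator and hence in `A m`. Infima need no such
    -- argument, as their left side is an intersection. In the second case the two roles are
    -- exchanged.
    · intro hxs
      have hxB : x ∈ B s := by
        rw [hsB]
        exact mem_iInter₂.2 fun n hn => (h.mem_or n x).resolve_left hn.2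
      exact hx' (hsub s m hs1.1 hs1.2 le_rfl hm.le ⟨hxs, hxB⟩).1
    · rw [htA]
      exact mem_iInter₂.2 fun n hn => hn.2
    · by_contra hlr
      exact hl.2 (h.mono (not_lt.1 hlr) hr.2)
  · obtain ⟨s, hs, hsB⟩ := h.sup {n | (m ≤ n ∧ n ≤ m') ∧ x ∈ B n} ⟨m, ⟨le_rfl, hm.le⟩, hx⟩
    obtain ⟨t, ht, htA⟩ := h.inf {n | (m ≤ n ∧ n ≤ m') ∧ x ∉ B n} ⟨m', ⟨hm.le, le_rfl⟩, hx'⟩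
    have hs1 : m ≤ s ∧ s ≤ m' := ⟨hs.1 ⟨⟨le_rfl, hm.le⟩, hx⟩, hs.2 fun n hn => hn.1.2⟩
    have ht1 : m ≤ t ∧ t ≤ m' := ⟨ht.2 fun n hn => hn.1.1, ht.1 ⟨⟨hm.le, le_rfl⟩, hx'⟩⟩
    refine key {n | (m ≤ n ∧ n ≤ m') ∧ x ∈ B n} {n | (m ≤ n ∧ n ≤ m') ∧ x ∉ B n}
      (fun n hn => hn.1) (fun n hn => hn.1) (fun n h1 h2 => ?_) ⟨s, ⟨hs1, ?_⟩, hs⟩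
      ⟨t, ⟨ht1, ?_⟩, ht⟩ (fun l hl r hr => ?_)
    · by_cases hxn : x ∈ B n
      · exact Or.inl ⟨⟨h1, h2⟩, hxn⟩
      · exact Or.inr ⟨⟨h1, h2⟩, hxn⟩
    · rw [hsB]
      exact mem_iInter₂.2 fun n hn => hn.2
    · intro hxt
      have hxA : x ∈ A t := by
        rw [htA]
        exact mem_iInter₂.2 fun n hn => (h.mem_or n x).resolve_right hn.2
      exact hx' (hsub t m' ht1.1 ht1.2 hm.le le_rfl ⟨hxA, hxt⟩).2
    · by_contra hlr
      exact hr.2 (h.anti (not_lt.1 hlr) hl.2)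

/-- Let t be the first member with `x` on its left side; it exists because left sides of infima are
intersections. If `x` is still on the right side of t, it lies in that separator. Otherwise the last
member without `x` on its left side is strictly below t, and the two form a jump. -/
theorem mem_innerSep_or_jump_left {x : V} {n₀ m : M} (hx : x ∈ A m) (hx' : x ∉ A n₀) :
    (∃ n, n₀ < n ∧ n ≤ m ∧ x ∈ innerSep A B Z n) ∨
      ∃ n n', n₀ ≤ n ∧ n ⋖ n' ∧ n' ≤ m ∧ x ∈ (B n ∩ A n') \ Z := by
  have hxZ : x ∉ Z := fun e => hx' (h.base n₀ e).1
  obtain ⟨t, ht, htA⟩ := h.inf {n | x ∈ A n} ⟨m, hx⟩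
  have hxt : x ∈ A t := by
    rw [htA]
    exact mem_iInter₂.2 fun n hn => hn
  have h0t : n₀ < t := by
    by_contra hcon
    exact hx' (h.mono (not_lt.1 hcon) hxt)
  by_cases hxB : x ∈ B t
  · exact Or.inl ⟨t, h0t, ht.1 hx, ⟨hxt, hxB⟩, hxZ⟩
  obtain ⟨s, hs, hsB⟩ := h.sup {n | x ∉ A n} ⟨n₀, hx'⟩
  have hxs : x ∈ B s := by
    rw [hsB]
    exact mem_iInter₂.2 fun n hn => (h.mem_or n x).resolve_left hn
  have hst : s < t := by
    by_contra hcon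
    exact hxB (h.anti (not_lt.1 hcon) hxs)
  refine Or.inr ⟨s, t, hs.1 hx', ⟨hst, fun q hsq hqt => ?_⟩, ht.1 hx, ⟨hxs, hxt⟩, hxZ⟩
  by_cases hxq : x ∈ A q
  · exact (ht.1 hxq).not_gt hqt
  · exact (hs.1 hxq).not_gt hsq

theorem mem_innerSep_or_jump_right {x : V} {n₁ m : M} (hx : x ∈ B m) (hx' : x ∉ B n₁) :
    (∃ n, m ≤ n ∧ n < n₁ ∧ x ∈ innerSep A B Z n) ∨
      ∃ n n', m ≤ n ∧ n ⋖ n' ∧ n' ≤ n₁ ∧ x ∈ (B n ∩ A n') \ Z := by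
  have hxZ : x ∉ Z := fun e => hx' (h.base n₁ e).2
  obtain ⟨s, hs, hsB⟩ := h.sup {n | x ∈ B n} ⟨m, hx⟩
  have hxs : x ∈ B s := by
    rw [hsB]
    exact mem_iInter₂.2 fun n hn => hn
  have h0s : s < n₁ := by
    by_contra hcon
    exact hx' (h.anti (not_lt.1 hcon) hxs)
  by_cases hxA : x ∈ A s
  · exact Or.inl ⟨s, hs.1 hx, h0s, ⟨hxA, hxs⟩, hxZ⟩
  obtain ⟨t, ht, htA⟩ := h.inf {n | x ∉ B n} ⟨n₁, hx'⟩
  have hxt : x ∈ A t := by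
    rw [htA]
    exact mem_iInter₂.2 fun n hn => (h.mem_or n x).resolve_right hn
  have hst : s < t := by
    by_contra hcon
    exact hxA (h.mono (not_lt.1 hcon) hxt)
  refine Or.inr ⟨s, t, hs.1 hx, ⟨hst, fun q hsq hqt => ?_⟩, ht.1 hx', ⟨hxs, hxt⟩, hxZ⟩
  by_cases hxq : x ∈ B q
  · exact (hs.1 hxq).not_gt hsq
  · exact (ht.1 hxq).not_gt hqt

theorem innerSep_subset_jump_left {m m' : M} (hm : m ≤ m') :
    innerSep A B Z m ⊆ (B m ∩ A m') \ Z :=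
  fun _ hx => ⟨⟨hx.1.2, h.mono hm hx.1.1⟩, hx.2⟩

theorem innerSep_subset_jump_right {m m' : M} (hm : m ≤ m') :
    innerSep A B Z m' ⊆ (B m ∩ A m') \ Z :=
  fun _ hx => ⟨⟨h.anti hm hx.1.2, hx.1.1⟩, hx.2⟩

/-- The part between `m` and `m'` contains both inner separators. If it had only their size it would
equal both, nothing would lie strictly between the two separations, and they would coincide. Thus
jump petals never compete with the inserted trivial petals. -/
theorem jump_nontrivial {m m' : M} (hm : m < m')
    (hc : ((B m ∩ A m') \ Z).encard + Z.encard = k) : False := by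
  have hfin : ∀ n, ((B m ∩ A m') \ Z).encard ≤ (innerSep A B Z n).encard := by
    intro n
    have h1 := h.encard_innerSep n
    rw [← hc] at h1
    exact (WithTop.add_right_cancel (h.finite_base m) h1).ge
  have hf : ((B m ∩ A m') \ Z).Finite := by
    rw [← encard_ne_top_iff]
    exact ne_top_of_le_ne_top (encard_ne_top_iff.2 (h.finite_innerSep m)) (hfin m)
  have e1 := hf.eq_of_subset_of_encard_le' (h.innerSep_subset_jump_left hm.le) (hfin m)
  have e2 := hf.eq_of_subset_of_encard_le' (h.innerSep_subset_jump_right hm.le) (hfin m')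
  have hsub : ∀ x, x ∈ B m → x ∈ A m' → x ∈ A m ∧ x ∈ B m' := by
    intro x h1 h2
    by_cases hxZ : x ∈ Z
    · exact ⟨(h.base m hxZ).1, (h.base m' hxZ).2⟩
    · have hx : x ∈ (B m ∩ A m') \ Z := ⟨⟨h1, h2⟩, hxZ⟩
      exact ⟨(e1 ▸ hx : x ∈ innerSep A B Z m).1.1, (e2 ▸ hx : x ∈ innerSep A B Z m').1.2⟩
  refine hm.ne (h.inj m m' ((h.mono hm.le).antisymm fun x hx => ?_)
    (Subset.antisymm (fun x hx => ?_) (h.anti hm.le)))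
  · exact (h.mem_or m x).elim id fun hx' => (hsub x hx' hx).1
  · exact (h.mem_or m' x).elim (fun hx' => (hsub x hx hx').2) id

/-- Without a jump there is some n strictly between. If n is not in `N`, its separator recurs at
another member and is therefore constant from n to there, which gives a jump after all. -/
theorem jump_or_doubled [BoundedOrder M] {N : Set M}
    (hN : ∀ n, n ≠ ⊥ → n ≠ ⊤ → (∀ n', n' ≠ n → innerSep A B Z n' ≠ innerSep A B Z n) → n ∈ N)
    {m m' : M} (hm : m < m') :
    (∃ n n', m ≤ n ∧ n ⋖ n' ∧ n' ≤ m') ∨ ∃ n ∈ N, m < n ∧ n < m' := by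
  by_contra hcon
  rw [not_or] at hcon
  obtain ⟨hj, hd⟩ := hcon
  have hcov : ¬ m ⋖ m' := fun e => hj ⟨m, m', le_rfl, e, le_rfl⟩
  obtain ⟨n, hmn, hnm⟩ := exists_lt_lt_of_not_covBy hm hcov
  have hnN : n ∉ N := fun e => hd ⟨n, e, hmn, hnm⟩
  have : ∃ n', n' ≠ n ∧ innerSep A B Z n' = innerSep A B Z n := by
    by_contra hno
    push Not at hno
    exact hnN (hN n (bot_le.trans_lt hmn).ne' (hnm.trans_le le_top).ne hno)
  obtain ⟨n', hne, he⟩ := this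
  rcases lt_or_gt_of_ne hne with hlt | hlt
  · obtain ⟨a, b, h1, h2, h3⟩ := h.exists_jump_of_const (m := max n' m) (m' := n)
      (max_lt hlt hmn) (Q := innerSep A B Z n) (fun q h1 h2 => by
        refine (h.innerSep_eq_of_subset fun x hx => ?_).symm
        exact h.innerSep_between ((le_max_left _ _).trans h1) h2 ⟨by rw [he]; exact hx, hx⟩)
    exact hj ⟨a, b, (le_max_right _ _).trans h1, h2, h3.trans hnm.le⟩
  · obtain ⟨a, b, h1, h2, h3⟩ := h.exists_jump_of_const (m := n) (m' := min n' m')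
      (lt_min hlt hnm) (Q := innerSep A B Z n) (fun q h1 h2 => by
        refine (h.innerSep_eq_of_subset fun x hx => ?_).symm
        exact h.innerSep_between h1 (h2.trans (min_le_left _ _)) ⟨hx, by rw [he]; exact hx⟩)
    exact hj ⟨a, b, hmn.le.trans h1, h2, h3.trans (min_le_right _ _)⟩

end IsLimitChain

end LimitChain

/-! ### The points inside a petal -/

section Fibre

variable {M : Type u} [LinearOrder M] [BoundedOrder M]

/-- The points over an element that is a petal if `p` holds and a cutpoint otherwise. Each `m : M`
gives a cutpoint `(m, 0)`, or two cutpoints `(m, 0)` and `(m, 2)` with a petal `(m, 1)` between them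
if `m ∈ N`; each jump from `m` to its successor gives a petal `(m, 3)`. The two extreme cutpoints are
removed from a petal. -/
def FibreMem (N : Set M) (p : Prop) (m : M) (t : Fin 4) : Prop :=
  (t = 0 ∧ (p → m ≠ ⊥ ∧ (m ≠ ⊤ ∨ m ∈ N))) ∨ (t = 1 ∧ p ∧ m ∈ N) ∨
    (t = 2 ∧ p ∧ m ∈ N ∧ m ≠ ⊤) ∨ (t = 3 ∧ p ∧ ∃ m', m ⋖ m')

theorem fibreMem_cut {N : Set M} {p : Prop} {m : M} (h : p → m ≠ ⊥ ∧ (m ≠ ⊤ ∨ m ∈ N)) :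
    FibreMem N p m 0 := Or.inl ⟨rfl, h⟩

theorem fibreMem_trivial {N : Set M} {p : Prop} {m : M} (hp : p) (h : m ∈ N) :
    FibreMem N p m 1 := Or.inr (Or.inl ⟨rfl, hp, h⟩)

theorem fibreMem_cut' {N : Set M} {p : Prop} {m : M} (hp : p) (h : m ∈ N) (h' : m ≠ ⊤) :
    FibreMem N p m 2 := Or.inr (Or.inr (Or.inl ⟨rfl, hp, h, h'⟩))

theorem fibreMem_jump {N : Set M} {p : Prop} {m m' : M} (hp : p) (h : m ⋖ m') :
    FibreMem N p m 3 := Or.inr (Or.inr (Or.inr ⟨rfl, hp, m', h⟩))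

/-- The linear order of the points over an element. -/
def Fibre (N : Set M) (p : Prop) : Type u :=
  {e : M ×ₗ Fin 4 // FibreMem N p (ofLex e).1 (ofLex e).2}

noncomputable instance (N : Set M) (p : Prop) : LinearOrder (Fibre N p) :=
  inferInstanceAs (LinearOrder {e : M ×ₗ Fin 4 // FibreMem N p (ofLex e).1 (ofLex e).2})

variable {N : Set M} {p : Prop}

namespace Fibre

def pos (e : Fibre N p) : M := (ofLex e.1).1

def tag (e : Fibre N p) : Fin 4 := (ofLex e.1).2

def mk (m : M) (t : Fin 4) (h : FibreMem N p m t) : Fibre N p := ⟨toLex (m, t), h⟩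

@[simp] theorem pos_mk {m : M} {t : Fin 4} (h : FibreMem N p m t) : (mk m t h).pos = m := rfl

@[simp] theorem tag_mk {m : M} {t : Fin 4} (h : FibreMem N p m t) : (mk m t h).tag = t := rfl

theorem mem (e : Fibre N p) : FibreMem N p e.pos e.tag := e.2

theorem lt_iff {e f : Fibre N p} : e < f ↔ e.pos < f.pos ∨ (e.pos = f.pos ∧ e.tag < f.tag) :=
  Prod.Lex.lt_iff

theorem ext_iff {e f : Fibre N p} : e = f ↔ e.pos = f.pos ∧ e.tag = f.tag := by
  constructor
  · rintro rfl; exact ⟨rfl, rfl⟩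
  · rintro ⟨h1, h2⟩
    exact Subtype.ext (congrArg toLex (Prod.ext h1 h2))

theorem pos_mono {e f : Fibre N p} (h : e ≤ f) : e.pos ≤ f.pos := by
  rcases eq_or_lt_of_le h with rfl | h
  · exact le_rfl
  · rcases lt_iff.1 h with h | h
    · exact h.le
    · exact h.1.le

/-- The petals. -/
def IsPetal (e : Fibre N p) : Prop := e.tag = 1 ∨ e.tag = 3

end Fibre

variable (hp : p) (hN : ∀ m m' : M, m < m' →
    (∃ n n', m ≤ n ∧ n ⋖ n' ∧ n' ≤ m') ∨ ∃ n ∈ N, m < n ∧ n < m')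
include hp hN

namespace Fibre

theorem exists_petal_between {c d : Fibre N p} (hc : ¬ c.IsPetal) (hd : ¬ d.IsPetal)
    (hcd : c < d) : ∃ i : Fibre N p, i.IsPetal ∧ c < i ∧ i < d := by
  have mc := c.mem
  have md := d.mem
  unfold FibreMem at mc md
  unfold IsPetal at hc hd
  rcases lt_iff.1 hcd with h | ⟨h, h'⟩
  · rcases hN _ _ h with ⟨n, n', h1, h2, h3⟩ | ⟨n, hn, h1, h2⟩
    · refine ⟨mk n 3 (fibreMem_jump hp h2), Or.inr rfl, ?_, ?_⟩
      · rw [lt_iff, pos_mk, tag_mk]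
        have : c.tag < 3 := by omega
        grind
      · rw [lt_iff, pos_mk, tag_mk]
        exact Or.inl (h2.1.trans_le h3)
    · refine ⟨mk n 1 (fibreMem_trivial hp hn), Or.inl rfl, ?_, ?_⟩
      · rw [lt_iff, pos_mk]; exact Or.inl h1
      · rw [lt_iff, pos_mk]; exact Or.inl h2
  · have hd2 : d.tag = 2 := by omega
    have hc0 : c.tag = 0 := by omega
    have hdN : d.pos ∈ N := by grind
    refine ⟨mk d.pos 1 (fibreMem_trivial hp hdN), Or.inl rfl, ?_, ?_⟩
    · rw [lt_iff, pos_mk, tag_mk, hc0]; exact Or.inr ⟨h, by decide⟩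
    · rw [lt_iff, pos_mk, tag_mk, hd2]; exact Or.inr ⟨rfl, by decide⟩

theorem exists_petal_lt {c : Fibre N p} (hc : ¬ c.IsPetal) :
    ∃ i : Fibre N p, i.IsPetal ∧ i < c := by
  have mc := c.mem
  unfold FibreMem at mc
  unfold IsPetal at hc
  by_cases hb : c.pos = ⊥
  · have hd2 : c.tag = 2 := by grind
    have hdN : c.pos ∈ N := by grind
    refine ⟨mk c.pos 1 (fibreMem_trivial hp hdN), Or.inl rfl, ?_⟩
    rw [lt_iff, pos_mk, tag_mk, hd2]; exact Or.inr ⟨rfl, by decide⟩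
  · rcases hN _ _ (bot_lt_iff_ne_bot.2 hb) with ⟨n, n', h1, h2, h3⟩ | ⟨n, hn, h1, h2⟩
    · refine ⟨mk n 3 (fibreMem_jump hp h2), Or.inr rfl, ?_⟩
      rw [lt_iff, pos_mk]; exact Or.inl (h2.1.trans_le h3)
    · refine ⟨mk n 1 (fibreMem_trivial hp hn), Or.inl rfl, ?_⟩
      rw [lt_iff, pos_mk]; exact Or.inl h2

theorem exists_petal_gt {c : Fibre N p} (hc : ¬ c.IsPetal) :
    ∃ i : Fibre N p, i.IsPetal ∧ c < i := by
  have mc := c.mem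
  unfold FibreMem at mc
  unfold IsPetal at hc
  by_cases hb : c.pos = ⊤
  · have hd2 : c.tag = 0 := by grind
    have hdN : c.pos ∈ N := by grind
    refine ⟨mk c.pos 1 (fibreMem_trivial hp hdN), Or.inl rfl, ?_⟩
    rw [lt_iff, pos_mk, tag_mk, hd2]; exact Or.inr ⟨rfl, by decide⟩
  · rcases hN _ _ (lt_top_iff_ne_top.2 hb) with ⟨n, n', h1, h2, h3⟩ | ⟨n, hn, h1, h2⟩
    · refine ⟨mk n 3 (fibreMem_jump hp h2), Or.inr rfl, ?_⟩
      rw [lt_iff, pos_mk, tag_mk]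
      have : c.tag < 3 := by omega
      grind
    · refine ⟨mk n 1 (fibreMem_trivial hp hn), Or.inl rfl, ?_⟩
      rw [lt_iff, pos_mk]; exact Or.inl h1

theorem exists_petal (htriv : (⊥ : M) = ⊤ → (⊥ : M) ∈ N) : ∃ i : Fibre N p, i.IsPetal := by
  by_cases hb : (⊥ : M) = ⊤
  · exact ⟨mk ⊥ 1 (fibreMem_trivial hp (htriv hb)), Or.inl rfl⟩
  · rcases hN ⊥ ⊤ (bot_lt_iff_ne_bot.2 (Ne.symm hb)) with ⟨n, n', h1, h2, h3⟩ | ⟨n, hn, h1, h2⟩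
    · exact ⟨mk n 3 (fibreMem_jump hp h2), Or.inr rfl⟩
    · exact ⟨mk n 1 (fibreMem_trivial hp hn), Or.inl rfl⟩

omit hN in
-- The cut is at the supremum of the right ends of the petals in `L`. The right end of a trivial
-- petal is its own level, and that of a jump is the upper member of the jump.
theorem exists_cut (hsup : ∀ S : Set M, S.Nonempty → ∃ s, IsLUB S s) (L : Set (Fibre N p))
    (hL : ∀ i ∈ L, i.IsPetal) (hlow : ∀ i ∈ L, ∀ j : Fibre N p, j.IsPetal → j ≤ i → j ∈ L)
    (hne : L.Nonempty) {j₀ : Fibre N p} (hj₀ : j₀.IsPetal) (hj₀L : j₀ ∉ L) :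
    ∃ c : Fibre N p, ¬ c.IsPetal ∧ ∀ i : Fibre N p, i.IsPetal → (i ∈ L ↔ i < c) := by
  obtain ⟨s, hs⟩ := hsup {r | ∃ i ∈ L, (i.tag = 1 ∧ r = i.pos) ∨ (i.tag = 3 ∧ i.pos ⋖ r)} (by
    obtain ⟨i, hi⟩ := hne
    rcases hL i hi with h | h
    · exact ⟨i.pos, i, hi, Or.inl ⟨h, rfl⟩⟩
    · have := i.mem
      obtain ⟨m', hm'⟩ : ∃ m', i.pos ⋖ m' := by unfold FibreMem at this; grind
      exact ⟨m', i, hi, Or.inr ⟨h, hm'⟩⟩)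
  have cov : ∀ i : Fibre N p, i.tag = 3 → ∃ m', i.pos ⋖ m' := by
    intro i hi
    have := i.mem
    unfold FibreMem at this
    grind
  have dbl : ∀ i : Fibre N p, i.tag = 1 → i.pos ∈ N := by
    intro i hi
    have := i.mem
    unfold FibreMem at this
    grind
  have ub1 : ∀ i ∈ L, i.tag = 1 → i.pos ≤ s := fun i hi ht => hs.1 ⟨i, hi, Or.inl ⟨ht, rfl⟩⟩
  have ub3 : ∀ i ∈ L, i.tag = 3 → i.pos < s := fun i hi ht => by
    obtain ⟨m', hm'⟩ := cov i ht
    exact hm'.1.trans_le (hs.1 ⟨i, hi, Or.inr ⟨ht, hm'⟩⟩)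
  have below : ∀ i : Fibre N p, i.IsPetal → i.pos < s → i ∈ L := by
    intro i hi his
    obtain ⟨r, ⟨i', hi', h'⟩, hir⟩ := (lt_isLUB_iff hs).1 his
    refine hlow i' hi' i hi (not_lt.1 fun hcon => ?_)
    rw [lt_iff] at hcon
    rcases h' with ⟨ht, rfl⟩ | ⟨ht, hcov⟩
    · rcases hcon with h | h
      · exact hir.not_gt h
      · exact hir.ne h.1.symm
    · rcases hcon with h | h
      · exact hcov.2 h hir
      · rw [ht] at h
        have := h.2
        omega
  -- If the trivial petal at level `s` belongs to `L`, the cut lies behind it, at tag 2; otherwise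
  -- it is at tag 0. The required point is one of the removed extreme cutpoints only if `L` contains
  -- no petal or every petal, and `hne` and `j₀` exclude this.
  by_cases hA : ∃ i ∈ L, i.tag = 1 ∧ i.pos = s
  · obtain ⟨i₁, hi₁, ht₁, hp₁⟩ := hA
    have hst : s ≠ ⊤ := by
      rintro rfl
      refine hj₀L (hlow i₁ hi₁ j₀ hj₀ (not_lt.1 fun hcon => ?_))
      rw [lt_iff, hp₁, ht₁] at hcon
      rcases hcon with h | ⟨h, h'⟩
      · exact h.not_ge le_top
      · have : j₀.tag = 3 := hj₀.resolve_left (by omega)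
        obtain ⟨m', hm'⟩ := cov j₀ this
        rw [← h] at hm'
        exact hm'.1.not_ge le_top
    refine ⟨mk s 2 (fibreMem_cut' hp (hp₁ ▸ dbl i₁ ht₁) hst), ?_, ?_⟩
    · rintro (h | h) <;> simp at h
    · intro i hi
      rw [lt_iff, pos_mk, tag_mk]
      constructor
      · intro hiL
        rcases hi with ht | ht
        · rcases eq_or_lt_of_le (ub1 i hiL ht) with h | h
          · exact Or.inr ⟨h, by rw [ht]; decide⟩
          · exact Or.inl h
        · exact Or.inl (ub3 i hiL ht)
      · rintro (h | ⟨h, h'⟩)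
        · exact below i hi h
        · have ht : i.tag = 1 := hi.resolve_right (by omega)
          have : i = i₁ := ext_iff.2 ⟨h.trans hp₁.symm, ht.trans ht₁.symm⟩
          exact this ▸ hi₁
  · push Not at hA
    have up : ∀ i ∈ L, i.pos < s := by
      intro i hi
      rcases hL i hi with ht | ht
      · exact lt_of_le_of_ne (ub1 i hi ht) (hA i hi ht)
      · exact ub3 i hi ht
    refine ⟨mk s 0 (fibreMem_cut fun _ => ⟨?_, ?_⟩), ?_, ?_⟩
    · obtain ⟨i, hi⟩ := hne
      exact (bot_le.trans_lt (up i hi)).ne'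
    · by_contra hcon
      push Not at hcon
      obtain ⟨rfl, hsN⟩ := hcon
      refine hj₀L (below j₀ hj₀ (lt_top_iff_ne_top.2 fun e => ?_))
      rcases hj₀ with ht | ht
      · exact hsN (e ▸ dbl j₀ ht)
      · obtain ⟨m', hm'⟩ := cov j₀ ht
        rw [e] at hm'
        exact hm'.1.not_ge le_top
    · rintro (h | h) <;> simp at h
    · intro i hi
      rw [lt_iff, pos_mk, tag_mk]
      constructor
      · exact fun hiL => Or.inl (up i hiL)
      · rintro (h | ⟨h, h'⟩)
        · exact below i hi h
        · exact absurd h' (by simp)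

end Fibre

end Fibre

/-! ### Replacing every petal by a chain -/

section Refined

/-- The linear order in which every element `z` of `C` is replaced by `Fibre (N z) (z ∈ I)`. -/
def Refined {C : Type u} (I : Set C) {M : C → Type u} [∀ z, LinearOrder (M z)]
    [∀ z, BoundedOrder (M z)] (N : ∀ z, Set (M z)) : Type u :=
  Σₗ z, Fibre (N z) (z ∈ I)

variable {C : Type u} {I : Set C} {M : C → Type u} [∀ z, LinearOrder (M z)]
  [∀ z, BoundedOrder (M z)] {N : ∀ z, Set (M z)}

noncomputable instance [LinearOrder C] : LinearOrder (Refined I N) :=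
  inferInstanceAs (LinearOrder (Σₗ z, Fibre (N z) (z ∈ I)))

noncomputable instance [LinearOrder C] : CircularOrder (Refined I N) :=
  LinearOrder.toCircularOrder _

namespace Refined

def base (a : Refined I N) : C := (ofLex a).1

def fib (a : Refined I N) : Fibre (N a.base) (a.base ∈ I) := (ofLex a).2

def mk (z : C) (e : Fibre (N z) (z ∈ I)) : Refined I N := toLex ⟨z, e⟩

theorem exists_mk (a : Refined I N) : ∃ z e, a = mk z e := ⟨_, _, rfl⟩

theorem exists_mk_of_base_eq {a : Refined I N} {z : C} (h : a.base = z) : ∃ e, a = mk z e := by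
  subst h
  exact ⟨_, rfl⟩

theorem mk_injective {z : C} {e f : Fibre (N z) (z ∈ I)} (h : mk z e = mk z f) : e = f := by
  have := eq_of_heq (Sigma.mk.inj (toLex.injective h)).2
  exact this

/-- The petals. -/
def petals (I : Set C) (N : ∀ z, Set (M z)) : Set (Refined I N) := {a | a.fib.IsPetal}

theorem base_mem_of_mem_petals {a : Refined I N} (ha : a ∈ petals I N) : a.base ∈ I := by
  have h1 := a.fib.mem
  have h2 : a.fib.tag = 1 ∨ a.fib.tag = 3 := ha
  unfold FibreMem at h1
  by_contra hcon
  simp only [hcon, false_and, and_false, or_false] at h1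
  have := h1.1
  omega

/-- The point over a cutpoint. -/
def lift (v : C) (hv : v ∉ I) : Refined I N :=
  mk v (Fibre.mk ⊥ 0 (fibreMem_cut fun h => absurd h hv))

theorem lift_notMem (v : C) (hv : v ∉ I) : (lift v hv : Refined I N) ∉ petals I N :=
  fun h => hv (base_mem_of_mem_petals h)

theorem eq_lift (hM : ∀ z ∉ I, Subsingleton (M z)) {a : Refined I N} {v : C} (hv : v ∉ I)
    (ha : a.base = v) : a = lift v hv := by
  obtain ⟨e, rfl⟩ := exists_mk_of_base_eq ha
  unfold lift
  congr 1
  have := hM v hv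
  have h1 := e.mem
  unfold FibreMem at h1
  simp only [hv, false_and, and_false, or_false] at h1
  exact Fibre.ext_iff.2 ⟨Subsingleton.elim _ _, h1.1⟩

variable [LinearOrder C]

theorem mk_lt_mk {z : C} {e f : Fibre (N z) (z ∈ I)} :
    (mk z e : Refined I N) < mk z f ↔ e < f := by
  constructor
  · intro h
    rcases Sigma.lex_iff.1 (show Sigma.Lex (· < ·) (fun _ => (· < ·))
      (⟨z, e⟩ : Σ z, Fibre (N z) (z ∈ I)) ⟨z, f⟩ from h) with h | ⟨_, h⟩
    · exact absurd h (lt_irrefl _)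
    · exact h
  · exact fun h => Sigma.Lex.right _ _ h

theorem lt_of_base_lt {a b : Refined I N} (h : a.base < b.base) : a < b :=
  Sigma.Lex.left _ _ h

theorem base_le_of_lt {a b : Refined I N} (h : a < b) : a.base ≤ b.base := by
  by_contra hcon
  exact h.not_gt (lt_of_base_lt (not_le.1 hcon))

theorem mk_le_mk {z : C} {e f : Fibre (N z) (z ∈ I)} :
    (mk z e : Refined I N) ≤ mk z f ↔ e ≤ f := by
  rw [← not_lt, ← not_lt, mk_lt_mk]

variable [CircularOrder C] {o : C}

omit [CircularOrder C] in
theorem sbtw_iff' (a b c : Refined I N) :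
    sbtw a b c ↔ (a < b ∧ b < c) ∨ (b < c ∧ c < a) ∨ (c < a ∧ a < b) := Iff.rfl

theorem isCutAt (h : IsCutAt o) (hM : ∀ z ∉ I, Subsingleton (M z)) (ho : o ∉ I) :
    IsCutAt (lift o ho : Refined I N) where
  bot_le x := by
    rcases eq_or_lt_of_le (h.bot_le x.base) with e | e
    · exact (eq_lift hM ho e.symm).ge
    · exact (lt_of_base_lt e).le
  sbtw_iff := sbtw_iff'

theorem cycMonotone_base (h : IsCutAt o) : CycMonotone (base : Refined I N → C) := by
  intro a b c habc
  rw [h.sbtw_iff] at habc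
  rw [sbtw_iff']
  have := @lt_of_base_lt _ I _ _ _ N _ a b
  have := @lt_of_base_lt _ I _ _ _ N _ b c
  have := @lt_of_base_lt _ I _ _ _ N _ c a
  tauto

/-- An initial segment of petals either splits one fibre, and then the cut is found inside this
fibre, or it is a union of full sets of petals over elements of `I`. In that case its projection is
an initial segment of `I`, and the cutpoint of `C` lifts. -/
theorem isLinCompletion (h : IsCutAt o) (hI : IsLinCompletion o I)
    (hM : ∀ z ∉ I, Subsingleton (M z))
    (hN : ∀ z ∈ I, ∀ m m' : M z, m < m' →
      (∃ n n', m ≤ n ∧ n ⋖ n' ∧ n' ≤ m') ∨ ∃ n ∈ N z, m < n ∧ n < m')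
    (htriv : ∀ z ∈ I, (⊥ : M z) = ⊤ → (⊥ : M z) ∈ N z)
    (hsup : ∀ z ∈ I, ∀ S : Set (M z), S.Nonempty → ∃ s, IsLUB S s) :
    IsLinCompletion (lift o hI.bot_notMem : Refined I N) (petals I N) where
  bot_notMem := lift_notMem _ _
  sep := by
    have hpet : ∀ z ∈ I, ∃ i ∈ petals I N, i.base = z := by
      intro z hz
      obtain ⟨e, he⟩ := Fibre.exists_petal hz (hN z hz) (htriv z hz)
      exact ⟨mk z e, he, rfl⟩
    -- This serves the arc that passes through the cut: if d < c, then any petal above `c` lies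
    -- cyclically between `c` and `d`.
    have above : ∀ c ∉ petals I N, c ≠ lift o hI.bot_notMem → ∃ i ∈ petals I N, c < i := by
      intro c hc hco
      obtain ⟨z, e, rfl⟩ := exists_mk c
      by_cases hz : z ∈ I
      · obtain ⟨i, hi, hci⟩ := Fibre.exists_petal_gt hz (hN z hz) hc
        exact ⟨mk z i, hi, mk_lt_mk.2 hci⟩
      · have hzo : z ≠ o := by
          rintro rfl
          exact hco (eq_lift hM hz rfl)
        obtain ⟨i, hi, hzi⟩ := hI.sep z hz o hI.bot_notMem hzo
        have : z < i := by
          have := h.bot_le z; have := h.bot_le i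
          rw [h.sbtw_iff] at hzi; grind
        obtain ⟨j, hj, rfl⟩ := hpet i hi
        exact ⟨j, hj, lt_of_base_lt this⟩
    have between : ∀ c ∉ petals I N, ∀ d ∉ petals I N, c < d →
        ∃ i ∈ petals I N, c < i ∧ i < d := by
      intro c hc d hd hcd
      obtain ⟨z, e, rfl⟩ := exists_mk c
      obtain ⟨w, f, rfl⟩ := exists_mk d
      have hzw : z ≤ w := base_le_of_lt hcd
      rcases eq_or_lt_of_le hzw with rfl | hzw
      · by_cases hz : z ∈ I
        · obtain ⟨i, hi, h1, h2⟩ := Fibre.exists_petal_between hz (hN z hz) hc hd (mk_lt_mk.1 hcd)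
          exact ⟨mk z i, hi, mk_lt_mk.2 h1, mk_lt_mk.2 h2⟩
        · have e1 : mk z e = (lift z hz : Refined I N) := eq_lift hM hz rfl
          have e2 : mk z f = (lift z hz : Refined I N) := eq_lift hM hz rfl
          exact absurd hcd (by rw [e1, e2]; exact lt_irrefl _)
      · by_cases hz : z ∈ I
        · obtain ⟨i, hi, hci⟩ := Fibre.exists_petal_gt hz (hN z hz) hc
          exact ⟨mk z i, hi, mk_lt_mk.2 hci, lt_of_base_lt hzw⟩
        by_cases hw : w ∈ I
        · obtain ⟨i, hi, hci⟩ := Fibre.exists_petal_lt hw (hN w hw) hd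
          exact ⟨mk w i, hi, lt_of_base_lt hzw, mk_lt_mk.2 hci⟩
        obtain ⟨i, hi, hzi⟩ := hI.sep z hz w hw hzw.ne
        obtain ⟨j, hj, rfl⟩ := hpet i hi
        have : z < j.base ∧ j.base < w := by
          rw [h.sbtw_iff] at hzi; grind
        exact ⟨j, hj, lt_of_base_lt this.1, lt_of_base_lt this.2⟩
    intro c hc d hd hcd
    rcases lt_or_gt_of_ne hcd with hlt | hlt
    · obtain ⟨i, hi, h1, h2⟩ := between c hc d hd hlt
      exact ⟨i, hi, Or.inl ⟨h1, h2⟩⟩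
    · obtain ⟨i, hi, h1⟩ := above c hc (by
        rintro rfl
        exact hlt.not_ge ((isCutAt h hM hI.bot_notMem).bot_le d))
      exact ⟨i, hi, Or.inr (Or.inr ⟨hlt, h1⟩)⟩
  cut L hL hlow hne hneL := by
    obtain ⟨j₀, hj₀, hj₀L⟩ : ∃ j ∈ petals I N, j ∉ L := by
      by_contra hx
      push Not at hx
      exact hneL (hL.antisymm hx)
    by_cases hsplit : ∃ i ∈ L, ∃ j ∈ petals I N, j ∉ L ∧ i.base = j.base
    · obtain ⟨i, hi, j, hj, hjL, hij⟩ := hsplit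
      obtain ⟨z, e, rfl⟩ := exists_mk i
      obtain ⟨f, rfl⟩ := exists_mk_of_base_eq hij.symm
      have hz : z ∈ I := base_mem_of_mem_petals hj
      obtain ⟨c, hc, hcL⟩ := Fibre.exists_cut hz (hsup z hz) {e | mk z e ∈ L}
        (fun e he => hL he) (fun a ha b hb hba => hlow _ ha (mk z b) hb (mk_le_mk.2 hba)) ⟨e, hi⟩
        (j₀ := f) hj hjL
      refine ⟨mk z c, hc, fun a ha => ?_⟩
      rcases lt_trichotomy a.base z with haz | haz | haz
      · have h1 : a < mk z c := lt_of_base_lt haz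
        have h2 : a < mk z e := lt_of_base_lt haz
        exact ⟨fun _ => h1, fun _ => hlow _ hi a ha h2.le⟩
      · obtain ⟨b, rfl⟩ := exists_mk_of_base_eq haz
        rw [mk_lt_mk]
        exact hcL b ha
      · have h1 : mk z c < a := lt_of_base_lt haz
        have h2 : mk z f < a := lt_of_base_lt haz
        exact ⟨fun haL => absurd (hlow _ haL _ hj h2.le) hjL, fun h' => absurd h' h1.not_gt⟩
    · push Not at hsplit
      obtain ⟨c, hc, hcL⟩ := hI.cut {z | ∃ i ∈ L, i.base = z}
        (by rintro z ⟨i, hi, rfl⟩; exact base_mem_of_mem_petals (hL hi))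
        (by
          rintro z ⟨i, hi, rfl⟩ w hw hwz
          obtain ⟨e, he⟩ := Fibre.exists_petal hw (hN w hw) (htriv w hw)
          rcases eq_or_lt_of_le hwz with rfl | hwz
          · exact ⟨i, hi, rfl⟩
          · exact ⟨mk w e, hlow i hi _ he (lt_of_base_lt hwz).le, rfl⟩)
        (by obtain ⟨i, hi⟩ := hne; exact ⟨_, i, hi, rfl⟩)
        (by
          intro e
          have : j₀.base ∈ {z | ∃ i ∈ L, i.base = z} := by
            rw [e]; exact base_mem_of_mem_petals hj₀
          obtain ⟨i, hi, hij⟩ := this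
          exact hsplit i hi j₀ hj₀ hj₀L hij)
      refine ⟨lift c hc, lift_notMem _ _, fun a ha => ?_⟩
      have haI := base_mem_of_mem_petals ha
      have h1 := hcL a.base haI
      constructor
      · intro haL
        exact lt_of_base_lt (h1.1 ⟨a, haL, rfl⟩)
      · intro hac
        have h2 : a.base ≤ c := base_le_of_lt hac
        have h3 : a.base ≠ c := fun e => hc (e ▸ haI)
        obtain ⟨i, hi, hia⟩ := h1.2 (lt_of_le_of_ne h2 h3)
        by_contra haL
        exact hsplit i hi a ha haL hia

end Refined

end Refined

/-! ### Sizes, trivial petals and neighbours in a pseudoflower -/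

namespace Pseudoflower

variable {V : Type u} {U : SepUniverse V} {k : ℕ} (Φ : Pseudoflower U k)

theorem exists_cutpoint : ∃ o, o ∉ Φ.I := by
  obtain ⟨i, hi, j, hj, hij⟩ := Φ.nontrivial
  obtain ⟨p, hp, -⟩ := Φ.completion {i} ⟨by simpa using hi, by
    rintro s rfl t rfl
    left
    rw [cycIcc_self]
    exact inter_subset_left⟩ (singleton_ne_empty i)
    (fun e => hij (by rw [← e] at hj; exact hj.symm))
  exact ⟨p.1, hp.1⟩

theorem isLinCompletion [LinearOrder Φ.C] {o : Φ.C} (h : IsCutAt o) (ho : o ∉ Φ.I) :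
    IsLinCompletion o Φ.I :=
  Φ.completion.isLinCompletion h Φ.nontrivial ho

theorem exists_pred {i : Φ.C} (hi : i ∈ Φ.I) : ∃ p ∉ Φ.I, IsCycSucc p i := by
  obtain ⟨o, ho⟩ := Φ.exists_cutpoint
  obtain ⟨_, h⟩ := exists_isCutAt o
  exact (Φ.isLinCompletion h ho).exists_pred h hi

theorem exists_succ {i : Φ.C} (hi : i ∈ Φ.I) : ∃ s ∉ Φ.I, IsCycSucc i s := by
  obtain ⟨o, ho⟩ := Φ.exists_cutpoint
  obtain ⟨_, h⟩ := exists_isCutAt o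
  exact (Φ.isLinCompletion h ho).exists_succ h hi

theorem sep {v w : Φ.C} (hv : v ∉ Φ.I) (hw : w ∉ Φ.I) (hvw : v ≠ w) : ∃ i ∈ Φ.I, sbtw v i w :=
  Φ.completion.sep Φ.nontrivial hv hw hvw

theorem exists_nat_card : ∃ l x : ℕ, (∀ v ∉ Φ.I, (Φ.P v).encard = l) ∧
    (center Φ.P).encard = x ∧ 2 * l + x = k := by
  obtain ⟨o, ho⟩ := Φ.exists_cutpoint
  have hfin : ∀ v ∉ Φ.I, ∃ l x : ℕ, (Φ.P v).encard = l ∧ (center Φ.P).encard = x ∧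
      2 * l + x = k := by
    intro v hv
    have h1 := Φ.card_cut v hv
    have h2 : (center Φ.P).encard ≠ ⊤ := by
      intro e
      rw [e, add_top] at h1
      exact ENat.top_ne_natCast k h1
    have h3 : (Φ.P v).encard ≠ ⊤ := by
      intro e
      rw [e, ENat.mul_top (by norm_num), top_add] at h1
      exact ENat.top_ne_natCast k h1
    obtain ⟨l, hl⟩ := ENat.ne_top_iff_exists.1 h3
    obtain ⟨x, hx⟩ := ENat.ne_top_iff_exists.1 h2
    refine ⟨l, x, hl.symm, hx.symm, ?_⟩
    rw [← hl, ← hx] at h1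
    exact_mod_cast h1
  obtain ⟨l, x, hl, hx, hlx⟩ := hfin o ho
  refine ⟨l, x, fun v hv => ?_, hx, hlx⟩
  obtain ⟨l', x', hl', hx', hlx'⟩ := hfin v hv
  rw [hx] at hx'
  have : x = x' := by exact_mod_cast hx'
  have : l' = l := by omega
  rw [hl', this]

theorem disjoint_center (z : Φ.C) : Disjoint (Φ.P z) (center Φ.P) :=
  disjoint_left.2 fun _ hx => notMem_center hx

theorem finite_cut {v : Φ.C} (hv : v ∉ Φ.I) : (Φ.P v).Finite := by
  obtain ⟨l, x, hl, -, -⟩ := Φ.exists_nat_card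
  exact finite_of_encard_eq_coe (hl v hv)

theorem encard_cut_eq {v w : Φ.C} (hv : v ∉ Φ.I) (hw : w ∉ Φ.I) :
    (Φ.P v).encard = (Φ.P w).encard := by
  obtain ⟨l, x, hl, -, -⟩ := Φ.exists_nat_card
  rw [hl v hv, hl w hw]

theorem separatesAt {v w : Φ.C} (hv : v ∉ Φ.I) (hw : w ∉ Φ.I) (hvw : v ≠ w) :
    SeparatesAt Φ.P v w :=
  separatesAt_iff.2 (Φ.separator_eq v hv w hw hvw)

/-- The separator is `P v ∪ P w ∪ X` with 2|P v| + |X| = k and |P v| = |P w| finite. It reaches size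
k only if the two cutpoint sets are disjoint. -/
theorem disjoint_of_le_order {v w : Φ.C} (hv : v ∉ Φ.I) (hw : w ∉ Φ.I) (hvw : v ≠ w)
    (ho : (k : ℕ∞) ≤ sepOrder (intervalSep Φ.P v w)) : Disjoint (Φ.P v) (Φ.P w) := by
  obtain ⟨l, x, hl, hx, hlx⟩ := Φ.exists_nat_card
  unfold sepOrder intervalSep at ho
  rw [Φ.separator_eq v hv w hw hvw] at ho
  rw [encard_union_eq (by
    rw [disjoint_union_left]
    exact ⟨Φ.disjoint_center v, Φ.disjoint_center w⟩), hx] at ho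
  have h1 := encard_union_add_encard_inter (Φ.P v) (Φ.P w)
  rw [hl v hv, hl w hw] at h1
  obtain ⟨n, hn⟩ := ENat.ne_top_iff_exists.1
    (encard_ne_top_iff.2 ((Φ.finite_cut hv).union (Φ.finite_cut hw)))
  obtain ⟨m, hm⟩ := ENat.ne_top_iff_exists.1
    (encard_ne_top_iff.2 ((Φ.finite_cut hv).subset (inter_subset_left (t := Φ.P w))))
  rw [← hn, ← hm] at h1
  rw [← hn] at ho
  norm_cast at h1 ho
  have : m = 0 := by omega
  rw [disjoint_iff_inter_eq_empty, ← encard_eq_zero, ← hm, this]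
  rfl

/-- A petal inside a set of the size of a cutpoint is equal to this set. -/
theorem petal_eq_of_subset {i v : Φ.C} (hi : i ∈ Φ.I) (hv : v ∉ Φ.I)
    (h : Φ.P i ⊆ Φ.P v ∪ center Φ.P) : Φ.P i = Φ.P v := by
  have h1 : Φ.P i ⊆ Φ.P v := fun x hx => (h hx).resolve_right (notMem_center hx)
  obtain ⟨p, hp, hpi⟩ := Φ.exists_pred hi
  refine (Φ.finite_cut hv).eq_of_subset_of_encard_le' h1 ?_
  rw [Φ.encard_cut_eq hv hp]
  exact encard_le_encard (Φ.pred_subset i hi p hpi)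

/-- Equal interval separations of order `k` enclose a petal that is equal to its two cutpoints. -/
theorem trivial_petal_of_eq {u a b : Φ.C} (hu : u ∉ Φ.I) (ha : a ∉ Φ.I) (hb : b ∉ Φ.I)
    (hub : sbtw u a b) (he : intervalSep Φ.P u a = intervalSep Φ.P u b)
    (ho : (k : ℕ∞) ≤ sepOrder (intervalSep Φ.P u a)) :
    Φ.P a = Φ.P b ∧ ∃ i ∈ Φ.I, sbtw a i b ∧ Φ.P i = Φ.P a := by
  obtain ⟨_, h⟩ := exists_isCutAt u
  have hub' := hub
  rw [h.sbtw_iff] at hub'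
  have := h.bot_le a
  have := h.bot_le b
  have hua : u ≠ a := by grind
  have hub : u ≠ b := by grind
  have hab : a ≠ b := by grind
  have e1 : intervalSet Φ.P u a = intervalSet Φ.P u b := congrArg Prod.fst he
  have e2 : intervalSet Φ.P a u = intervalSet Φ.P b u := congrArg Prod.snd he
  have d1 := Φ.disjoint_of_le_order hu ha hua ho
  have d2 := Φ.disjoint_of_le_order hu hb hub (he ▸ ho)
  have s1 := Φ.separator_eq u hu a ha hua
  have s2 := Φ.separator_eq u hu b hb hub
  have hP : Φ.P a = Φ.P b := by
    have h3 : Φ.P u ∪ Φ.P a ∪ center Φ.P = Φ.P u ∪ Φ.P b ∪ center Φ.P := by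
      rw [← s1, ← s2, e1, e2]
    ext x
    have := Set.ext_iff.1 h3 x
    simp only [mem_union] at this
    constructor
    · intro hx
      rcases this.1 (Or.inl (Or.inr hx)) with (hx' | hx') | hx'
      · exact absurd hx (disjoint_left.1 d1 hx')
      · exact hx'
      · exact absurd hx' (notMem_center hx)
    · intro hx
      rcases this.2 (Or.inl (Or.inr hx)) with (hx' | hx') | hx'
      · exact absurd hx (disjoint_left.1 d2 hx')
      · exact hx'
      · exact absurd hx' (notMem_center hx)
  obtain ⟨i, hi, hai⟩ := Φ.sep ha hb hab
  refine ⟨hP, i, hi, hai, Φ.petal_eq_of_subset hi ha ?_⟩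
  -- Since V(a, b) ⊆ V(u, b) = V(u, a) ⊆ V(b, a), the petal lies in the separator of S(a, b), which
  -- is `P a` together with X.
  have i1 : Φ.P i ⊆ intervalSet Φ.P a b := subset_intervalSet (Or.inr (Or.inr hai))
  have i2 : intervalSet Φ.P a b ⊆ intervalSet Φ.P u b := intervalSet_mono fun x hx => by
    rw [h.mem_cycIcc] at hx ⊢; grind
  have i3 : intervalSet Φ.P u a ⊆ intervalSet Φ.P b a := intervalSet_mono fun x hx => by
    rw [h.mem_cycIcc] at hx ⊢; grind
  have h4 : Φ.P i ⊆ Φ.P a ∪ Φ.P b ∪ center Φ.P := by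
    rw [← Φ.separator_eq a ha b hb hab]
    exact subset_inter i1 (i1.trans (i2.trans (e1 ▸ i3)))
  rwa [← hP, union_self] at h4

theorem pred_ne_succ {p i s : Φ.C} (hp : p ∉ Φ.I) (hpi : IsCycSucc p i) (his : IsCycSucc i s) :
    p ≠ s := by
  rintro rfl
  have all : ∀ z ∈ Φ.I, z = i := by
    intro z hz
    by_contra hne
    rcases sbtw_or_sbtw (a := p) (fun e => hp (e ▸ hz)) hne his.1.symm with h | h
    · exact hpi.2 z h
    · exact his.2 z h
  obtain ⟨a, ha, b, hb, hab⟩ := Φ.nontrivial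
  exact hab ((all a ha).trans (all b hb).symm)

theorem cycIcc_petal {p i s : Φ.C} (hp : p ∉ Φ.I) (hpi : IsCycSucc p i) (his : IsCycSucc i s)
    {z : Φ.C} : z ∈ cycIcc p s ↔ z = p ∨ z = i ∨ z = s := by
  have hps := Φ.pred_ne_succ hp hpi his
  obtain ⟨_, h⟩ := exists_isCutAt p
  have h1 := hpi.2 z
  have h2 := his.2 z
  have h3 := his.2 p
  have h4 := hpi.1
  have h5 := his.1
  have := h.bot_le i
  have := h.bot_le s
  have := h.bot_le z
  rw [h.sbtw_iff] at h1 h2 h3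
  rw [h.mem_cycIcc]
  clear h hpi his hp
  grind

theorem intervalSet_petal {p i s : Φ.C} (hi : i ∈ Φ.I) (hp : p ∉ Φ.I) (hpi : IsCycSucc p i)
    (his : IsCycSucc i s) : intervalSet Φ.P p s = Φ.P i ∪ center Φ.P := by
  ext x
  rw [mem_intervalSet, mem_union]
  refine or_congr_left ⟨?_, fun hx => ⟨i, (Φ.cycIcc_petal hp hpi his).2 (Or.inr (Or.inl rfl)), hx⟩⟩
  rintro ⟨z, hz, hx⟩
  rcases (Φ.cycIcc_petal hp hpi his).1 hz with rfl | rfl | rfl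
  · exact Φ.pred_subset i hi _ hpi hx
  · exact hx
  · exact Φ.succ_subset i hi _ his hx

end Pseudoflower

/-! ### Extensions and a criterion for maximality -/

section Extension

variable {C C' : Type u} [CircularOrder C] [CircularOrder C']

theorem CycMonotone.preimage_cycIcc {F : C' → C} (hF : CycMonotone F) {v' w' : C'}
    (hv : ∀ x, F x = F v' → x = v') (hw : ∀ x, F x = F w' → x = w') (hvw : v' ≠ w') :
    F ⁻¹' cycIcc (F v') (F w') = cycIcc v' w' := by
  ext x
  rw [mem_preimage, mem_cycIcc, mem_cycIcc]
  constructor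
  · rintro (h | h | h)
    · exact Or.inl (hv x h)
    · exact Or.inr (Or.inl (hw x h))
    · exact Or.inr (Or.inr (hF _ _ _ h))
  · rintro (h | h | h)
    · exact Or.inl (congrArg F h)
    · exact Or.inr (Or.inl (congrArg F h))
    · by_cases e1 : F x = F v'
      · exact Or.inl e1
      by_cases e2 : F x = F w'
      · exact Or.inr (Or.inl e2)
      have e3 : F w' ≠ F v' := fun e => hvw (hw _ e.symm)
      rcases sbtw_or_sbtw (Ne.symm e1) e2 e3 with h' | h'
      · exact Or.inr (Or.inr h')
      · exact absurd (hF _ _ _ h') h.not_sbtw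

variable {V : Type u} {U : SepUniverse V} {k : ℕ}

/-- Two points over `v` would bound two arcs. Comparing a petal of one arc with a petal of the
other, monotonicity leaves only the possibility that they have the same image. Then all petals have
the same image, although `Φ` has at least two. -/
theorem CycMonotone.fibre_cutpoint {Φ Φ' : Pseudoflower U k} {F : Φ'.C → Φ.C}
    (hF : CycMonotone F) (hI : F '' Φ'.I = Φ.I) {v : Φ.C} (hv : v ∉ Φ.I) {x y : Φ'.C}
    (hx : F x = v) (hy : F y = v) : x = y := by
  by_contra hxy
  have hmem : ∀ i ∈ Φ'.I, F i ∈ Φ.I := fun i hi => hI ▸ mem_image_of_mem F hi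
  have hxI : x ∉ Φ'.I := fun h => hv (hx ▸ hmem x h)
  have hyI : y ∉ Φ'.I := fun h => hv (hy ▸ hmem y h)
  have same : ∀ b ∈ Φ'.I, ∀ d ∈ Φ'.I, sbtw x b y → sbtw y d x → F b = F d := by
    intro b hb d hd hb' hd'
    by_contra hne
    have n1 : F b ≠ v := fun e => hv (e ▸ hmem b hb)
    have n2 : F d ≠ v := fun e => hv (e ▸ hmem d hd)
    obtain ⟨_, h⟩ := exists_isCutAt y
    rw [h.sbtw_iff] at hb' hd'
    have := h.bot_le x; have := h.bot_le b; have := h.bot_le d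
    rcases sbtw_or_sbtw (Ne.symm n1) hne n2 with h' | h'
    · have h1 := hF y b d (by rw [hy]; exact h')
      rw [h.sbtw_iff] at h1
      grind
    · have h1 := hF d b x (by rw [hx]; exact h')
      rw [h.sbtw_iff] at h1
      grind
  obtain ⟨b, hb, hb'⟩ := Φ'.sep hxI hyI hxy
  obtain ⟨d, hd, hd'⟩ := Φ'.sep hyI hxI (Ne.symm hxy)
  have all : ∀ i ∈ Φ'.I, F i = F d := by
    intro i hi
    rcases sbtw_or_sbtw (a := x) (b := i) (c := y) (fun e => hxI (e ▸ hi)) (fun e => hyI (e ▸ hi))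
      (Ne.symm hxy) with h | h
    · exact same i hi d hd h hd'
    · exact (same b hb i hi hb' h).symm.trans (same b hb d hd hb' hd')
  obtain ⟨i, hi, j, hj, hij⟩ := Φ.nontrivial
  rw [← hI] at hi hj
  obtain ⟨i', hi', rfl⟩ := hi
  obtain ⟨j', hj', rfl⟩ := hj
  exact hij ((all i' hi').trans (all j' hj').symm)

/-- A monotone bijection of cyclic orders also preserves the relation, because three distinct points
have exactly one of the two orientations. So the inverse map is again monotone. -/
theorem Pseudoflower.extends_of_injective {Φ Φ' : Pseudoflower U k}
    (hX : center Φ.P = center Φ'.P) {F : Φ'.C → Φ.C} (hs : Function.Surjective F)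
    (hF : CycMonotone F) (hI : F '' Φ'.I = Φ.I)
    (hV : ∀ v ∉ Φ.I, ∀ w ∉ Φ.I,
      intervalSet Φ.P v w = center Φ.P ∪ ⋃ z ∈ F ⁻¹' cycIcc v w, Φ'.P z)
    (hinj : Function.Injective F) : Φ'.Extends Φ := by
  have hmem : ∀ i, F i ∈ Φ.I ↔ i ∈ Φ'.I := by
    intro i
    rw [← hI]
    exact hinj.mem_set_image
  obtain ⟨G, hGF, hFG⟩ : ∃ G : Φ.C → Φ'.C, (∀ x, G (F x) = x) ∧ ∀ x, F (G x) = x :=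
    ⟨Function.surjInv hs, Function.leftInverse_surjInv ⟨hinj, hs⟩, Function.surjInv_eq hs⟩
  have hGinj : Function.Injective G := fun a b e => by rw [← hFG a, ← hFG b, e]
  have hiff : ∀ a b c, sbtw (F a) (F b) (F c) ↔ sbtw a b c := by
    refine fun a b c => ⟨hF a b c, fun h => ?_⟩
    have n1 : a ≠ b := by rintro rfl; exact sbtw_irrefl_left h
    have n2 : b ≠ c := by rintro rfl; exact sbtw_irrefl_right h
    have n3 : c ≠ a := by rintro rfl; exact sbtw_irrefl_left_right h
    exact (sbtw_or_sbtw (hinj.ne n1) (hinj.ne n2) (hinj.ne n3)).resolve_right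
      fun h' => (hF _ _ _ h').not_sbtw h
  have hcyc : ∀ a b x, F x ∈ cycIcc (F a) (F b) ↔ x ∈ cycIcc a b := by
    intro a b x
    rw [mem_cycIcc, mem_cycIcc, hiff, hinj.eq_iff, hinj.eq_iff]
  refine ⟨hX.symm, G, fun x => ⟨F x, hGF x⟩, fun a b c h => ?_, ?_, fun v hv w hw => ?_⟩
  · rw [← hiff, hFG, hFG, hFG] at h
    exact h
  · ext x
    constructor
    · rintro ⟨i, hi, rfl⟩
      rw [← hmem, hFG]
      exact hi
    · intro hx
      exact ⟨F x, (hmem x).2 hx, hGF x⟩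
  · have h1 := hV (F v) (fun h => hv ((hmem v).1 h)) (F w) (fun h => hw ((hmem w).1 h))
    have h2 : intervalSet Φ'.P v w = intervalSet Φ.P (F v) (F w) := by
      rw [h1, intervalSet, hX, union_comm]
      congr 1
      ext x
      simp only [mem_iUnion, mem_preimage, hcyc]
    rw [h2, intervalSet, hX, union_comm]
    congr 1
    ext x
    simp only [mem_iUnion, mem_preimage]
    constructor
    · rintro ⟨z, hz, hx⟩
      refine ⟨z, ?_, hx⟩
      rw [← hcyc, hFG]
      exact hz
    · rintro ⟨z, hz, hx⟩
      refine ⟨z, ?_, hx⟩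
      rw [← hcyc, hFG] at hz
      exact hz

/-- A pseudoflower is maximal if no separation of order at most `k` subdivides a petal, and if
trivial petals have been added wherever possible. -/
theorem Pseudoflower.isLeMaximal_of_saturated (Φ : Pseudoflower U k)
    (h : ∀ j ∈ Φ.I, ∀ p ∉ Φ.I, ∀ s ∉ Φ.I, IsCycSucc p j → IsCycSucc j s →
      (∃ u ∉ Φ.I, u ≠ p ∧ u ≠ s ∧ (k : ℕ∞) ≤ sepOrder (intervalSep Φ.P u p) ∧
        (k : ℕ∞) ≤ sepOrder (intervalSep Φ.P u s) ∧
        ∀ t ∈ U.seps, sepOrder t ≤ k → SepLE (intervalSep Φ.P u p) t →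
          SepLE t (intervalSep Φ.P u s) → t = intervalSep Φ.P u p ∨ t = intervalSep Φ.P u s) ∧
      (∃ i ∈ Φ.I, Φ.P i = Φ.P p) ∧ ∃ i ∈ Φ.I, Φ.P i = Φ.P s) :
    Φ.IsLeMaximal := by
  rintro Φ' ⟨hX, F, hs, hF, hI, hV⟩
  refine Pseudoflower.extends_of_injective hX hs hF hI hV fun x y hxy => ?_
  have hmem : ∀ i ∈ Φ'.I, F i ∈ Φ.I := fun i hi => hI ▸ mem_image_of_mem F hi
  have hmem' : ∀ i, F i ∉ Φ.I → i ∉ Φ'.I := fun i hi h => hi (hmem i h)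
  have hfib : ∀ a, F a ∉ Φ.I → ∀ x, F x = F a → x = a := fun a ha x hx =>
    hF.fibre_cutpoint hI ha hx rfl
  by_contra hne
  by_cases hj : F x ∈ Φ.I
  swap
  · exact hne (hfib x hj y hxy.symm).symm
  obtain ⟨p, hp, hpj⟩ := Φ.exists_pred hj
  obtain ⟨s, hs', hjs⟩ := Φ.exists_succ hj
  obtain ⟨⟨u, hu, hup, hus, o1, o2, hmid⟩, ⟨j₁, hj₁, hPj₁⟩, j₂, hj₂, hPj₂⟩ :=
    h _ hj p hp s hs' hpj hjs
  obtain ⟨p, rfl⟩ := hs p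
  obtain ⟨s, rfl⟩ := hs s
  obtain ⟨u, rfl⟩ := hs u
  have hp' := hmem' p hp
  have hsI := hmem' s hs'
  have hu' := hmem' u hu
  have huj : F u ≠ F x := fun e => hu (e ▸ hj)
  have hpj' : F p ≠ F x := hpj.1.symm
  obtain ⟨_, h0⟩ := exists_isCutAt (F u)
  have l1 : F u < F p ∧ F p < F x ∧ F x < F s ∧ ∀ z, F p < z → z < F s → z = F x := by
    have b1 := h0.bot_le (F p)
    have b2 := h0.bot_le (F x)
    have b3 := h0.bot_le (F s)
    have q1 := hpj.2
    have q2 := hjs.2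
    simp only [h0.sbtw_iff] at q1 q2
    have q3 := q1 (F u)
    have q4 := q2 (F u)
    have n3 := hjs.1
    refine ⟨?_, ?_, ?_, fun z hz1 hz2 => ?_⟩
    · grind
    · grind
    · grind
    · have q5 := q1 z
      have q6 := q2 z
      grind
  obtain ⟨l1, l2, l3, l4⟩ := l1
  have harc : ∀ a, sbtw p a s → F a = F x := by
    intro a ha
    have n1 : F a ≠ F p := fun e => by
      have := hfib p hp a e; subst this; exact sbtw_irrefl_left ha
    have n2 : F a ≠ F s := fun e => by
      have := hfib s hs' a e; subst this; exact sbtw_irrefl_right ha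
    have n3 := fun h' => (hF s a p h').not_sbtw ha
    rw [h0.sbtw_iff] at n3
    have b1 := h0.bot_le (F a)
    apply l4 <;> grind
  have harc' : ∀ a, F a = F x → sbtw p a s ∧ sbtw u p a ∧ sbtw a s u := by
    intro a ha
    refine ⟨hF _ _ _ ?_, hF _ _ _ ?_, hF _ _ _ ?_⟩ <;> rw [ha, h0.sbtw_iff] <;> grind
  have hsets : ∀ a b, F a ∉ Φ.I → F b ∉ Φ.I → a ≠ b →
      intervalSet Φ.P (F a) (F b) = intervalSet Φ'.P a b := by
    intro a b ha hb hab
    rw [hV _ ha _ hb, hF.preimage_cycIcc (hfib a ha) (hfib b hb) hab, hX, union_comm]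
    rfl
  have hcut : ∀ a, F a ∉ Φ.I → Φ.P (F a) = Φ'.P a := by
    intro a ha
    have h1 := hV _ ha _ ha
    have h2 : F ⁻¹' {F a} = {a} := by
      ext z
      exact ⟨fun hz => hfib a ha z hz, fun hz => congrArg F hz⟩
    rw [intervalSet, cycIcc_self, h2, biUnion_singleton, biUnion_singleton] at h1
    have h3 : ∀ z, z ∈ Φ.P (F a) ∨ z ∈ center Φ.P ↔ z ∈ center Φ.P ∨ z ∈ Φ'.P a :=
      fun z => Set.ext_iff.1 h1 z
    ext z
    have h4 : z ∈ Φ.P (F a) → z ∉ center Φ.P := notMem_center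
    have h5 : z ∈ Φ'.P a → z ∉ center Φ.P := hX ▸ notMem_center
    have := h3 z
    tauto
  have hup' : u ≠ p := fun e => hup (congrArg F e)
  have hus' : u ≠ s := fun e => hus (congrArg F e)
  have esep : ∀ a b, F a ∉ Φ.I → F b ∉ Φ.I → a ≠ b →
      intervalSep Φ.P (F a) (F b) = intervalSep Φ'.P a b := fun a b ha hb hab =>
    Prod.ext (hsets a b ha hb hab) (hsets b a hb ha hab.symm)
  rw [esep u p hu hp hup'] at o1 hmid
  rw [esep u s hu hs' hus'] at o2 hmid
  -- Suppose that the set of `v` is a petal `j₁` of `Φ` and a trivial petal i' of `Φ'` inside the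
  -- arc from p to s. By the uniqueness axiom in `Φ'`, every petal over `j₁` is i'. So `j₁` is the
  -- petal `F x`, and this arc contains only one petal of `Φ'`.
  have nested : ∀ v ∉ Φ'.I, ∀ j₁ ∈ Φ.I, Φ.P j₁ = Φ'.P v →
      (∃ i ∈ Φ'.I, sbtw p i s ∧ Φ'.P i = Φ'.P v) →
      (∀ i ∈ Φ'.I, sbtw p i s → ∀ i' ∈ Φ'.I, sbtw p i' s → i = i') := by
    rintro v hv j₁ hj₁ hPv ⟨i', hi', hpi', hQ⟩
    have huniq : ∀ i ∈ Φ'.I, Φ'.P i ⊆ Φ'.P v ∪ center Φ'.P → i = i' := by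
      intro i hi hsub
      have e := Φ'.petal_eq_of_subset hi hv hsub
      exact Φ'.star i hi i' hi' (by rw [e]; exact Φ'.card_cut v hv) (e.trans hQ.symm)
    have hinside : ∀ j ∈ Φ.I, Φ.P j = Φ'.P v → ∀ i ∈ Φ'.I, F i = j → i = i' := by
      rintro j hj hPj i hi rfl
      obtain ⟨p₁, hp₁, hpp⟩ := Φ.exists_pred hj
      obtain ⟨s₁, hs₁, hss⟩ := Φ.exists_succ hj
      have hn := Φ.pred_ne_succ hp₁ hpp hss
      have hpet := Φ.intervalSet_petal hj hp₁ hpp hss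
      rw [hV _ hp₁ _ hs₁, hPj, hX] at hpet
      refine huniq i hi ?_
      rw [← hpet]
      refine fun z hz => Or.inr (mem_iUnion₂.2 ⟨i, ?_, hz⟩)
      exact (Φ.cycIcc_petal hp₁ hpp hss).2 (Or.inr (Or.inl rfl))
    have hj₁' : j₁ = F x := by
      obtain ⟨i₁, hi₁, rfl⟩ : j₁ ∈ F '' Φ'.I := hI ▸ hj₁
      rw [hinside _ hj₁ hPv i₁ hi₁ rfl]
      exact harc i' hpi'
    subst hj₁'
    intro i hi hpi i₂ hi₂ hpi₂
    rw [hinside _ hj hPv i hi (harc i hpi), hinside _ hj hPv i₂ hi₂ (harc i₂ hpi₂)]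
  have key : ∀ c', c' ∉ Φ'.I → F c' = F x → False := by
    intro c' hc' hcx
    obtain ⟨g1, g2, g3⟩ := harc' c' hcx
    obtain ⟨_, h⟩ := exists_isCutAt u
    have b1 := h.bot_le p
    have b2 := h.bot_le c'
    have b3 := h.bot_le s
    rw [h.sbtw_iff] at g1 g2 g3
    have k1 : u < p ∧ p < c' ∧ c' < s := by grind
    obtain ⟨k1, k2, k3⟩ := k1
    clear g1 g2 g3
    have huc : u ≠ c' := (k1.trans k2).ne
    have mono : ∀ a b, u < a → a < b → SepLE (intervalSep Φ'.P u a) (intervalSep Φ'.P u b) := by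
      intro a b ha hab
      constructor
      · refine intervalSet_mono fun z hz => ?_
        rw [h.mem_cycIcc] at hz ⊢
        have := h.bot_le z
        grind
      · refine intervalSet_mono fun z hz => ?_
        rw [h.mem_cycIcc] at hz ⊢
        have := h.bot_le z
        grind
    obtain ⟨a, ha, ha1⟩ := Φ'.sep hp' hc' k2.ne
    obtain ⟨b, hb, hb1⟩ := Φ'.sep hc' hsI k3.ne
    rw [h.sbtw_iff] at ha1 hb1
    have hab : a ≠ b := by grind
    have between : ∀ z, p < z → z < s → sbtw p z s := fun z h1 h2 =>
      (h.sbtw_iff _ _ _).2 (Or.inl ⟨h1, h2⟩)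
    have haps : sbtw p a s := by apply between <;> grind
    have hbps : sbtw p b s := by apply between <;> grind
    -- By saturation the separation at the new cutpoint equals one of the two bounding ones.
    -- Equality encloses a trivial petal on that side, and `nested` then identifies the petals `a`
    -- and `b` on the two sides of `c'`.
    rcases hmid _ (Φ'.sep_mem u hu' c' hc' huc) (Φ'.sep_order u hu' c' hc' huc)
      (mono _ _ k1 k2) (mono _ _ (k1.trans k2) k3) with e | e
    · obtain ⟨-, i, hi, hi1, hi2⟩ := Φ'.trivial_petal_of_eq hu' hp' hc'
        ((h.sbtw_iff _ _ _).2 (Or.inl ⟨k1, k2⟩)) e.symm o1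
      rw [h.sbtw_iff] at hi1
      exact hab (nested p hp' j₁ hj₁ (hPj₁.trans (hcut p hp))
        ⟨i, hi, by apply between <;> grind, hi2⟩ a ha haps b hb hbps)
    · obtain ⟨e1, i, hi, hi1, hi2⟩ := Φ'.trivial_petal_of_eq hu' hc' hsI
        ((h.sbtw_iff _ _ _).2 (Or.inl ⟨k1.trans k2, k3⟩)) e (e ▸ o2)
      rw [h.sbtw_iff] at hi1
      exact hab (nested s hsI j₂ hj₂ (hPj₂.trans (hcut s hs'))
        ⟨i, hi, by apply between <;> grind, hi2.trans e1⟩ a ha haps b hb hbps)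
  by_cases hxI : x ∈ Φ'.I
  swap
  · exact key x hxI rfl
  by_cases hyI : y ∈ Φ'.I
  swap
  · exact key y hyI hxy.symm
  obtain ⟨_, h⟩ := exists_isCutAt p
  have hx1 := (harc' x rfl).1
  have hy1 := (harc' y hxy.symm).1
  -- Two petals over the same element also lead to a new cutpoint, namely the successor of the first
  -- one.
  have hmain : ∀ a b, a ∈ Φ'.I → b ∈ Φ'.I → sbtw p a s → sbtw p b s → a < b → False := by
    intro a b ha hb ha1 hb1 hab
    obtain ⟨t, ht, hat⟩ := Φ'.exists_succ ha
    have htb : t ≠ b := fun e => ht (e ▸ hb)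
    have n1 := hat.1
    have n2 := hat.2 b
    have n3 := hat.2 p
    have h1 := h.bot_le a
    have h2 := h.bot_le t
    have h3 := h.bot_le s
    have h4 := h.bot_le b
    rw [h.sbtw_iff] at n2 n3 ha1 hb1
    refine key t ht (harc t ?_)
    rw [h.sbtw_iff]
    clear key nested harc harc' hsets hcut esep hmid
    grind
  rcases lt_or_gt_of_ne hne with hlt | hlt
  · exact hmain x y hxI hyI hx1 hy1 hlt
  · exact hmain y x hyI hxI hy1 hx1 hlt

end Extension

/-! ### Tangles give three base points -/

section Tangles

variable {V : Type u} {U : SepUniverse V} {k : ℕ} {T T' : Set (Set V × Set V)}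

theorem SepUniverse.IsTangle.not_cover_two {m : ℕ} (hT : U.IsTangle m T) {r s : Set V × Set V}
    (hr : r ∈ T) (hs : s ∈ T) : r.1 ∪ s.1 ≠ univ := by
  have := hT.not_cover r hr s hs s hs
  rwa [union_assoc, union_self] at this

/-- Separations between `r` and `t` that are distinguished by two tangles with the same
`k`-tangle have order at least `k`. -/
theorem SepUniverse.IsTangle.le_order (hT : U.IsTangle (k + 1) T) (hT' : U.IsTangle (k + 1) T')
    (hTT : T ∩ U.sepsLT k = T' ∩ U.sepsLT k) {r s t : Set V × Set V} (hr : sepInv r ∈ T')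
    (ht : t ∈ T) (hr1 : r.1 ∪ r.2 = univ) (ht1 : t.1 ∪ t.2 = univ) (hs : s ∈ U.seps)
    (hrs : SepLE r s) (hst : SepLE s t) : (k : ℕ∞) ≤ sepOrder s := by
  by_contra hcon
  rw [not_le] at hcon
  have hs' : sepOrder s < ((k + 1 : ℕ) : ℕ∞) := hcon.trans_le (by exact_mod_cast Nat.le_succ k)
  -- Below order k both tangles orient s alike. From `t ∈ T` it follows that s is in `T` and hence
  -- in `T'`, where s and the inverse of `r` have left sides that cover V.
  have hsT : s ∈ T := by
    refine (hT.mem_or s ⟨hs, hs'⟩).resolve_right fun h => hT.not_cover_two ht h ?_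
    refine eq_univ_of_univ_subset (ht1 ▸ ?_)
    exact union_subset_union_right _ hst.2
  have hsT' : s ∈ T' := by
    have : s ∈ T ∩ U.sepsLT k := ⟨hsT, hs, hcon⟩
    rw [hTT] at this
    exact this.1
  refine hT'.not_cover_two hsT' hr ?_
  refine eq_univ_of_univ_subset (hr1 ▸ ?_)
  exact union_subset_union_left _ hrs.1

namespace Pseudoflower

variable (Φ : Pseudoflower U k)

theorem union_eq_univ {a b c d : Φ.C} (h : ∀ z, z ∈ cycIcc a b ∨ z ∈ cycIcc c d) :
    intervalSet Φ.P a b ∪ intervalSet Φ.P c d = univ := by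
  refine eq_univ_of_forall fun x => ?_
  rcases mem_or_mem_center Φ.P x with ⟨z, hz⟩ | hx
  · exact (h z).imp (fun h => subset_intervalSet h hz) (fun h => subset_intervalSet h hz)
  · exact Or.inl (center_subset_intervalSet _ _ hx)

theorem union_eq_univ₃ {a b c d e f : Φ.C}
    (h : ∀ z, z ∈ cycIcc a b ∨ z ∈ cycIcc c d ∨ z ∈ cycIcc e f) :
    intervalSet Φ.P a b ∪ intervalSet Φ.P c d ∪ intervalSet Φ.P e f = univ := by
  refine eq_univ_of_forall fun x => ?_
  rcases mem_or_mem_center Φ.P x with ⟨z, hz⟩ | hx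
  · rcases h z with h | h | h
    · exact Or.inl (Or.inl (subset_intervalSet h hz))
    · exact Or.inl (Or.inr (subset_intervalSet h hz))
    · exact Or.inr (subset_intervalSet h hz)
  · exact Or.inr (center_subset_intervalSet _ _ hx)

theorem mem_tangle_or (hT : U.IsTangle (k + 1) T) {c d : Φ.C} (hc : c ∉ Φ.I) (hd : d ∉ Φ.I)
    (hcd : c ≠ d) : intervalSep Φ.P c d ∈ T ∨ intervalSep Φ.P d c ∈ T :=
  hT.mem_or _ ⟨Φ.sep_mem c hc d hd hcd, (Φ.sep_order c hc d hd hcd).trans_lt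
    (by exact_mod_cast Nat.lt_succ_self k)⟩

/-- Any separation between `S(u, v)` and `S(u, w)` has order at least `k`. -/
def IsRigid (u v w : Φ.C) : Prop :=
  ∀ s ∈ U.seps, SepLE (intervalSep Φ.P u v) s → SepLE s (intervalSep Φ.P u w) →
    (k : ℕ∞) ≤ sepOrder s

theorem isRigid_of_tangles (hT : U.IsTangle (k + 1) T) (hT' : U.IsTangle (k + 1) T')
    (hTT : T ∩ U.sepsLT k = T' ∩ U.sepsLT k) {u v w : Φ.C} (huv : u ≠ v) (huw : u ≠ w)
    (h : intervalSep Φ.P u w ∈ T) (h' : intervalSep Φ.P v u ∈ T') : Φ.IsRigid u v w :=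
  fun _ hs h1 h2 => hT.le_order hT' hTT (r := intervalSep Φ.P u v) h' h
    (intervalSet_union huv) (intervalSet_union huw) hs h1 h2

variable [LinearOrder Φ.C] {o : Φ.C} (h : IsCutAt o)
include h

theorem lt_of_mem_tangle (hT : U.IsTangle (k + 1) T) {a b : Φ.C} (hbo : b ≠ o)
    (h1 : intervalSep Φ.P o a ∈ T) (h2 : intervalSep Φ.P b o ∈ T) : a < b := by
  by_contra hcon
  refine hT.not_cover_two h1 h2 (Φ.union_eq_univ fun z => ?_)
  have := h.bot_le z
  have := h.bot_le a
  have := h.bot_le b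
  rw [h.mem_cycIcc, h.mem_cycIcc]
  grind

theorem mem_tangle_between (hT : U.IsTangle (k + 1) T) {a b : Φ.C} (ha : a ∉ Φ.I) (hb : b ∉ Φ.I)
    (hbo : b ≠ o)
    (h1 : intervalSep Φ.P o a ∈ T) (h2 : intervalSep Φ.P b o ∈ T) :
    intervalSep Φ.P b a ∈ T := by
  have hab := Φ.lt_of_mem_tangle h hT hbo h1 h2
  refine (Φ.mem_tangle_or hT ha hb hab.ne).resolve_left fun h3 => ?_
  refine hT.not_cover _ h1 _ h2 _ h3 (Φ.union_eq_univ₃ fun z => ?_)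
  have := h.bot_le z
  have := h.bot_le a
  have := h.bot_le b
  rw [h.mem_cycIcc, h.mem_cycIcc, h.mem_cycIcc]
  grind

/-- Moves one end of a distinguishing pair x < y to `o`. The tangle that contains S(y, x) also
contains S(o, x) and S(y, o). If the other tangle agreed on both, it would contain S(o, x), S(x, y)
and S(y, o), whose left sides cover V. -/
theorem exists_distinguishing (hT : U.IsTangle (k + 1) T) (hT' : U.IsTangle (k + 1) T')
    (ho : o ∉ Φ.I) (hΦ : Φ.Distinguishes T T') : ∃ z ∉ Φ.I, z ≠ o ∧
      ((intervalSep Φ.P o z ∈ T ∧ intervalSep Φ.P z o ∈ T') ∨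
        (intervalSep Φ.P o z ∈ T' ∧ intervalSep Φ.P z o ∈ T)) := by
  have key : ∀ S S' : Set (Set V × Set V), U.IsTangle (k + 1) S → U.IsTangle (k + 1) S' →
      ∀ x ∉ Φ.I, ∀ y ∉ Φ.I, x ≠ o → y ≠ o → x < y → intervalSep Φ.P x y ∈ S →
      intervalSep Φ.P y x ∈ S' → ∃ z ∉ Φ.I, z ≠ o ∧
      ((intervalSep Φ.P o z ∈ S ∧ intervalSep Φ.P z o ∈ S') ∨
        (intervalSep Φ.P o z ∈ S' ∧ intervalSep Φ.P z o ∈ S)) := by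
    intro S S' hS hS' x hx y hy hxo hyo hxy h1 h2
    have a1 : intervalSep Φ.P o x ∈ S' := by
      refine (Φ.mem_tangle_or hS' ho hx hxo.symm).resolve_right fun h3 => ?_
      refine hS'.not_cover_two h2 h3 (Φ.union_eq_univ fun z => ?_)
      have := h.bot_le z; have := h.bot_le x
      rw [h.mem_cycIcc, h.mem_cycIcc]
      grind
    have a2 : intervalSep Φ.P y o ∈ S' := by
      refine (Φ.mem_tangle_or hS' ho hy hyo.symm).resolve_left fun h3 => ?_
      refine hS'.not_cover_two h2 h3 (Φ.union_eq_univ fun z => ?_)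
      have := h.bot_le z; have := h.bot_le x
      rw [h.mem_cycIcc, h.mem_cycIcc]
      grind
    rcases Φ.mem_tangle_or hS ho hx hxo.symm with b1 | b1
    · rcases Φ.mem_tangle_or hS ho hy hyo.symm with b2 | b2
      · exact ⟨y, hy, hyo, Or.inl ⟨b2, a2⟩⟩
      · exfalso
        refine hS.not_cover _ b1 _ h1 _ b2 (Φ.union_eq_univ₃ fun z => ?_)
        have := h.bot_le z; have := h.bot_le x
        rw [h.mem_cycIcc, h.mem_cycIcc, h.mem_cycIcc]
        grind
    · exact ⟨x, hx, hxo, Or.inr ⟨a1, b1⟩⟩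
  obtain ⟨x, hx, y, hy, hxy, h1, h2⟩ := hΦ
  have h2 : intervalSep Φ.P y x ∈ T' := h2
  by_cases hxo : x = o
  · subst hxo
    exact ⟨y, hy, hxy.symm, Or.inl ⟨h1, h2⟩⟩
  by_cases hyo : y = o
  · subst hyo
    exact ⟨x, hx, hxy, Or.inr ⟨h2, h1⟩⟩
  rcases lt_or_gt_of_ne hxy with hlt | hlt
  · exact key T T' hT hT' x hx y hy hxo hyo hlt h1 h2
  · obtain ⟨z, hz, hzo, h3⟩ := key T' T hT' hT y hy x hx hyo hxo hlt h2 h1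
    exact ⟨z, hz, hzo, h3.symm⟩

omit h in
omit [LinearOrder Φ.C] in
-- Start with a pair of cutpoints that distinguishes two of the tangles. The third tangle agrees
-- with one of them on it, and a second pair through the same point `o` tells these two apart. The
-- result is three cutpoints with one tangle pointing into each arc, and neighbouring arcs give the
-- rigidity.
theorem exists_rigid_bases (T : Fin 3 → Set (Set V × Set V))
    (hT : ∀ a, U.IsTangle (k + 1) (T a)) (hΦ : ∀ a b, a ≠ b → Φ.Distinguishes (T a) (T b))
    (hk : ∀ a b, T a ∩ U.sepsLT k = T b ∩ U.sepsLT k) :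
    ∃ u₁ ∉ Φ.I, ∃ u₂ ∉ Φ.I, ∃ u₃ ∉ Φ.I, sbtw u₁ u₂ u₃ ∧ Φ.IsRigid u₃ u₁ u₂ ∧
      Φ.IsRigid u₁ u₂ u₃ ∧ Φ.IsRigid u₂ u₃ u₁ := by
  obtain ⟨o, ho, w, hw, how, h0, h1⟩ := hΦ 0 1 (by decide)
  have h1 : intervalSep Φ.P w o ∈ T 1 := h1
  obtain ⟨_, h⟩ := exists_isCutAt o
  -- The tangles `a`, `b`, `c` point into the arcs from `o` to v, from v to w, and from w to `o`.
  have main : ∀ a b c : Fin 3, ∀ v ∉ Φ.I, ∀ w ∉ Φ.I, v ≠ o → w ≠ o → intervalSep Φ.P v o ∈ T a →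
      intervalSep Φ.P o v ∈ T b → intervalSep Φ.P w o ∈ T b → intervalSep Φ.P o w ∈ T c →
      ∃ u₁ ∉ Φ.I, ∃ u₂ ∉ Φ.I, ∃ u₃ ∉ Φ.I, sbtw u₁ u₂ u₃ ∧ Φ.IsRigid u₃ u₁ u₂ ∧
      Φ.IsRigid u₁ u₂ u₃ ∧ Φ.IsRigid u₂ u₃ u₁ := by
    intro a b c v hv w hw hvo hwo ha hb hb' hc
    have hvw := Φ.lt_of_mem_tangle h (hT b) hwo hb hb'
    have hov := lt_of_le_of_ne (h.bot_le v) hvo.symm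
    have hb2 := Φ.mem_tangle_between h (hT b) hv hw hwo hb hb'
    exact ⟨o, ho, v, hv, w, hw, (h.sbtw_iff _ _ _).2 (Or.inl ⟨hov, hvw⟩),
      Φ.isRigid_of_tangles (hT b) (hT c) (hk b c) (hov.trans hvw).ne' hvw.ne' hb2 hc,
      Φ.isRigid_of_tangles (hT c) (hT a) (hk c a) hov.ne (hov.trans hvw).ne hc ha,
      Φ.isRigid_of_tangles (hT a) (hT b) (hk a b) hvw.ne hov.ne' ha hb2⟩
  rcases Φ.mem_tangle_or (hT 2) ho hw how with h2 | h2
  · obtain ⟨z, hz, hzo, h3⟩ := Φ.exists_distinguishing h (hT 0) (hT 2) ho (hΦ 0 2 (by decide))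
    rcases h3 with ⟨h3, h4⟩ | ⟨h3, h4⟩
    · exact main 1 2 0 w hw z hz how.symm hzo h1 h2 h4 h3
    · exact main 1 0 2 w hw z hz how.symm hzo h1 h0 h4 h3
  · obtain ⟨z, hz, hzo, h3⟩ := Φ.exists_distinguishing h (hT 1) (hT 2) ho (hΦ 1 2 (by decide))
    rcases h3 with ⟨h3, h4⟩ | ⟨h3, h4⟩
    · exact main 2 1 0 z hz w hw hzo how.symm h4 h3 h1 h0
    · exact main 1 2 0 z hz w hw hzo how.symm h4 h3 h2 h0

end Pseudoflower

end Tangles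

/-! ### Maximal chains of separations -/

section SepChain

variable {V : Type u}

theorem SepLE.refl (s : Set V × Set V) : SepLE s s := ⟨Subset.rfl, Subset.rfl⟩

theorem SepLE.trans {r s t : Set V × Set V} (h : SepLE r s) (h' : SepLE s t) : SepLE r t :=
  ⟨h.1.trans h'.1, h'.2.trans h.2⟩

theorem SepLE.antisymm {s t : Set V × Set V} (h : SepLE s t) (h' : SepLE t s) : s = t :=
  Prod.ext (h.1.antisymm h'.1) (h'.2.antisymm h.2)

theorem SepLE.inv {s t : Set V × Set V} (h : SepLE s t) : SepLE (sepInv t) (sepInv s) :=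
  ⟨h.2, h.1⟩

theorem sepOrder_sepInv (s : Set V × Set V) : sepOrder (sepInv s) = sepOrder s :=
  congrArg encard (inter_comm _ _)

/-- A maximal chain of separations of order `k` between `r` and `t`. -/
structure SepChain (U : SepUniverse V) (k : ℕ) (r t : Set V × Set V) (Z : Set V) where
  M : Type u
  [linearOrder : LinearOrder M]
  [boundedOrder : BoundedOrder M]
  A : M → Set V
  B : M → Set V
  mem : ∀ m, (A m, B m) ∈ U.seps
  isLimitChain : IsLimitChain A B Z k
  bot_eq : (A ⊥, B ⊥) = r
  top_eq : (A ⊤, B ⊤) = t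
  maximal : ∀ s ∈ U.seps, sepOrder s ≤ k → SepLE r s → SepLE s t →
    (∀ m, SepLE s (A m, B m) ∨ SepLE (A m, B m) s) → ∃ m, s = (A m, B m)

attribute [instance] SepChain.linearOrder SepChain.boundedOrder

/-- The limit of a chain of separations in a maximal chain. -/
theorem SepUniverse.LimitClosed.exists_sup {U : SepUniverse V} (hU : U.LimitClosed) {k : ℕ}
    {c : Set (Set V × Set V)} (hc : c ⊆ U.seps) (hne : c.Nonempty) (hch : IsChain SepLE c)
    (ho : ∀ s ∈ c, sepOrder s ≤ k) : ∃ σ ∈ U.seps, sepOrder σ ≤ k ∧ (∀ s ∈ c, SepLE s σ) ∧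
      (∀ t ∈ U.seps, (∀ s ∈ c, SepLE s t) → SepLE σ t) ∧ σ.2 = ⋂ s ∈ c, s.2 := by
  obtain ⟨Y, h1, h2, h3, h4⟩ := hU k c hc hne hch ho
  exact ⟨_, h1, h2, h3, h4, rfl⟩

theorem SepUniverse.LimitClosed.exists_inf {U : SepUniverse V} (hU : U.LimitClosed) {k : ℕ}
    {c : Set (Set V × Set V)} (hc : c ⊆ U.seps) (hne : c.Nonempty) (hch : IsChain SepLE c)
    (ho : ∀ s ∈ c, sepOrder s ≤ k) : ∃ σ ∈ U.seps, sepOrder σ ≤ k ∧ (∀ s ∈ c, SepLE σ s) ∧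
      (∀ t ∈ U.seps, (∀ s ∈ c, SepLE t s) → SepLE t σ) ∧ σ.1 = ⋂ s ∈ c, s.1 := by
  obtain ⟨σ, h1, h2, h3, h4, h5⟩ := hU.exists_sup (c := sepInv '' c) (k := k)
    (by rintro _ ⟨s, hs, rfl⟩; exact U.inv_mem s (hc hs)) (hne.image _)
    (by
      rintro _ ⟨s, hs, rfl⟩ _ ⟨t, ht, rfl⟩ hst
      have := hch hs ht (fun e => hst (congrArg sepInv e))
      exact this.symm.imp SepLE.inv SepLE.inv)
    (by rintro _ ⟨s, hs, rfl⟩; rw [sepOrder_sepInv]; exact ho s hs)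
  refine ⟨sepInv σ, U.inv_mem σ h1, by rwa [sepOrder_sepInv], fun s hs => ?_,
    fun t ht hts => ?_, ?_⟩
  · exact (h3 _ (mem_image_of_mem _ hs)).inv
  · refine (h4 (sepInv t) (U.inv_mem t ht) ?_).inv
    rintro _ ⟨s, hs, rfl⟩
    exact (hts s hs).inv
  · change σ.2 = _
    rw [h5, biInter_image]
    rfl

/-- A maximal chain exists by Zorn's lemma, in the form of a `Flag`. Limits of subchains stay
between `r` and `t` and are comparable with every member, so maximality places them in the chain. -/
theorem exists_sepChain {U : SepUniverse V} (hU : U.LimitClosed) {k : ℕ} {r t : Set V × Set V}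
    {Z : Set V} (hr : r ∈ U.seps) (ht : t ∈ U.seps) (hrt : SepLE r t) (hro : sepOrder r ≤ k)
    (hto : sepOrder t ≤ k)
    (hrigid : ∀ s ∈ U.seps, SepLE r s → SepLE s t → (k : ℕ∞) ≤ sepOrder s)
    (hZr : Z ⊆ r.1) (hZt : Z ⊆ t.2) : Nonempty (SepChain U k r t Z) := by
  classical
  let p : Set V × Set V → Prop := fun s => s ∈ U.seps ∧ sepOrder s ≤ k ∧ SepLE r s ∧ SepLE s t
  -- Dualizing the second factor turns the product order into the order of separations.
  let α := {s : Set V × (Set V)ᵒᵈ // p (s.1, OrderDual.ofDual s.2)}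
  let i : α → Set V × Set V := fun s => (s.1.1, OrderDual.ofDual s.1.2)
  have hp : ∀ s, p (i s) := fun s => s.2
  have hle : ∀ s s' : α, s ≤ s' ↔ SepLE (i s) (i s') := fun s s' => Iff.rfl
  have hi : ∀ s, p s → ∃ a, i a = s := fun s hs => ⟨⟨(s.1, OrderDual.toDual s.2), hs⟩, rfl⟩
  let _ : BoundedOrder α :=
    { bot := ⟨(r.1, OrderDual.toDual r.2), hr, hro, SepLE.refl r, hrt⟩
      bot_le := fun s => (hp s).2.2.1
      top := ⟨(t.1, OrderDual.toDual t.2), ht, hto, hrt, SepLE.refl t⟩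
      le_top := fun s => (hp s).2.2.2 }
  obtain ⟨F⟩ : Nonempty (Flag α) := inferInstance
  have hmax : ∀ s, p s → (∀ m : F, SepLE s (i m) ∨ SepLE (i m) s) → ∃ m : F, i m = s := by
    intro s hs hcomp
    obtain ⟨a, rfl⟩ := hi s hs
    exact ⟨⟨a, Flag.mem_iff_forall_le_or_ge.2 fun b hb => hcomp ⟨b, hb⟩⟩, rfl⟩
  have hchain : ∀ m m' : F, SepLE (i m) (i m') ∨ SepLE (i m') (i m) := fun m m' =>
    F.le_or_le m.2 m'.2
  have hS : ∀ S : Set F, IsChain SepLE ((fun m : F => i m) '' S) := by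
    rintro S _ ⟨m, -, rfl⟩ _ ⟨m', -, rfl⟩ -
    exact hchain m m'
  refine ⟨⟨F, fun m => (i m).1, fun m => (i m).2, fun m => (hp m).1,
    ⟨?_, ?_, ?_, ?_, ?_, ?_, ?_, ?_⟩, rfl, rfl, ?_⟩⟩
  · exact fun m m' hm => ((hle _ _).1 hm).1
  · exact fun m m' hm => ((hle _ _).1 hm).2
  · exact fun m => U.union_eq _ (hp m).1
  -- The upper bound holds by choice of the members, and the lower bound is rigidity.
  · exact fun m => ((hp m).2.1).antisymm (hrigid _ (hp m).1 (hp m).2.2.1 (hp m).2.2.2)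
  · exact fun m => subset_inter (hZr.trans (hp m).2.2.1.1) (hZt.trans (hp m).2.2.2.2)
  · intro m n h1 h2
    exact Subtype.ext (Subtype.ext (Prod.ext h1 h2))
  · intro S hne
    obtain ⟨σ, h1, h2, h3, h4, h5⟩ := hU.exists_sup (c := (fun m : F => i m) '' S) (k := k)
      (by rintro _ ⟨m, -, rfl⟩; exact (hp m).1) (hne.image _) (hS S)
      (by rintro _ ⟨m, -, rfl⟩; exact (hp m).2.1)
    have hσ : p σ := by
      obtain ⟨m, hm⟩ := hne
      refine ⟨h1, h2, (hp m).2.2.1.trans (h3 _ (mem_image_of_mem _ hm)), h4 t ht ?_⟩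
      rintro _ ⟨m, -, rfl⟩
      exact (hp m).2.2.2
    -- A member below some element of `S` is below the supremum. Any other member is above all of
    -- `S`, hence above the supremum by the universal property.
    obtain ⟨s, rfl⟩ := hmax σ hσ fun m => by
      by_cases hm : ∃ n ∈ S, SepLE (i m) (i n)
      · obtain ⟨n, hn, hmn⟩ := hm
        exact Or.inr (hmn.trans (h3 _ (mem_image_of_mem _ hn)))
      · push Not at hm
        refine Or.inl (h4 _ (hp m).1 ?_)
        rintro _ ⟨n, hn, rfl⟩
        exact (hchain n m).resolve_right (hm n hn)
    refine ⟨s, ⟨fun m hm => h3 _ (mem_image_of_mem _ hm), fun m hm => h4 _ (hp m).1 ?_⟩, ?_⟩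
    · rintro _ ⟨n, hn, rfl⟩
      exact hm hn
    · rw [h5, biInter_image]
  · intro S hne
    obtain ⟨σ, h1, h2, h3, h4, h5⟩ := hU.exists_inf (c := (fun m : F => i m) '' S) (k := k)
      (by rintro _ ⟨m, -, rfl⟩; exact (hp m).1) (hne.image _) (hS S)
      (by rintro _ ⟨m, -, rfl⟩; exact (hp m).2.1)
    have hσ : p σ := by
      obtain ⟨m, hm⟩ := hne
      refine ⟨h1, h2, h4 r hr ?_, (h3 _ (mem_image_of_mem _ hm)).trans (hp m).2.2.2⟩
      rintro _ ⟨m, -, rfl⟩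
      exact (hp m).2.2.1
    obtain ⟨s, rfl⟩ := hmax σ hσ fun m => by
      by_cases hm : ∃ n ∈ S, SepLE (i n) (i m)
      · obtain ⟨n, hn, hmn⟩ := hm
        exact Or.inl ((h3 _ (mem_image_of_mem _ hn)).trans hmn)
      · push Not at hm
        refine Or.inr (h4 _ (hp m).1 ?_)
        rintro _ ⟨n, hn, rfl⟩
        exact (hchain n m).resolve_left (hm n hn)
    refine ⟨s, ⟨fun m hm => h3 _ (mem_image_of_mem _ hm), fun m hm => h4 _ (hp m).1 ?_⟩, ?_⟩
    · rintro _ ⟨n, hn, rfl⟩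
      exact hm hn
    · rw [h5, biInter_image]
  · intro s hs hso hrs hst hcomp
    obtain ⟨m, hm⟩ := hmax s ⟨hs, hso, hrs, hst⟩ hcomp
    exact ⟨m, hm.symm⟩

end SepChain

/-! ### Refining a pseudoflower -/

section Refinement

variable {V : Type u} {U : SepUniverse V} {k : ℕ}

/-- Data for refining a pseudoflower: for every petal a base point and a maximal chain of
separations that subdivide the petal; `N` is the set of separators that become trivial petals. -/
structure Refinement (Φ : Pseudoflower U k) where
  lo : Φ.C → Φ.C
  hi : Φ.C → Φ.C
  base : Φ.C → Φ.C
  lo_notMem : ∀ z, lo z ∉ Φ.I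
  hi_notMem : ∀ z, hi z ∉ Φ.I
  base_notMem : ∀ z, base z ∉ Φ.I
  lo_eq : ∀ z ∉ Φ.I, lo z = z
  hi_eq : ∀ z ∉ Φ.I, hi z = z
  succ_lo : ∀ z ∈ Φ.I, IsCycSucc (lo z) z
  succ_hi : ∀ z ∈ Φ.I, IsCycSucc z (hi z)
  base_ne_lo : ∀ z, base z ≠ lo z
  base_ne_hi : ∀ z, base z ≠ hi z
  chain : ∀ z, SepChain U k (intervalSep Φ.P (base z) (lo z)) (intervalSep Φ.P (base z) (hi z))
    (Φ.P (base z) ∪ center Φ.P)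
  N : ∀ z, Set (chain z).M

namespace Refinement

variable {Φ : Pseudoflower U k} (R : Refinement Φ)

abbrev A (z : Φ.C) : (R.chain z).M → Set V := (R.chain z).A

abbrev B (z : Φ.C) : (R.chain z).M → Set V := (R.chain z).B

abbrev Z (z : Φ.C) : Set V := Φ.P (R.base z) ∪ center Φ.P

abbrev inner (z : Φ.C) (m : (R.chain z).M) : Set V := innerSep (R.A z) (R.B z) (R.Z z) m

theorem isLimitChain (z : Φ.C) : IsLimitChain (R.A z) (R.B z) (R.Z z) k :=
  (R.chain z).isLimitChain

theorem A_bot (z : Φ.C) : R.A z ⊥ = intervalSet Φ.P (R.base z) (R.lo z) :=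
  congrArg Prod.fst (R.chain z).bot_eq

theorem B_bot (z : Φ.C) : R.B z ⊥ = intervalSet Φ.P (R.lo z) (R.base z) :=
  congrArg Prod.snd (R.chain z).bot_eq

theorem A_top (z : Φ.C) : R.A z ⊤ = intervalSet Φ.P (R.base z) (R.hi z) :=
  congrArg Prod.fst (R.chain z).top_eq

theorem B_top (z : Φ.C) : R.B z ⊤ = intervalSet Φ.P (R.hi z) (R.base z) :=
  congrArg Prod.snd (R.chain z).top_eq

theorem base_ne (z : Φ.C) : R.base z ≠ z := by
  by_cases hz : z ∈ Φ.I
  · exact fun e => R.base_notMem z (e.symm ▸ hz)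
  · have := R.base_ne_lo z
    rwa [R.lo_eq z hz] at this

/-- At a cutpoint the two ends of the chain are the same separation, so cutpoints are not
subdivided. Treating all elements of `Φ.C` uniformly thus costs nothing. -/
theorem subsingleton {z : Φ.C} (hz : z ∉ Φ.I) : Subsingleton (R.chain z).M := by
  have h := R.isLimitChain z
  have e1 : R.A z ⊥ = R.A z ⊤ := by rw [A_bot, A_top, R.lo_eq z hz, R.hi_eq z hz]
  have e2 : R.B z ⊥ = R.B z ⊤ := by rw [B_bot, B_top, R.lo_eq z hz, R.hi_eq z hz]
  have e : (⊥ : (R.chain z).M) = ⊤ := h.inj _ _ e1 e2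
  exact subsingleton_of_bot_eq_top e

/-- The position of an element relative to its base point. -/
theorem exists_order (z : Φ.C) : ∃ _ : LinearOrder Φ.C, IsCutAt (R.base z) ∧
    R.base z < R.lo z ∧ R.lo z ≤ z ∧ z ≤ R.hi z ∧ (z ∈ Φ.I → R.lo z < z ∧ z < R.hi z) ∧
      ∀ w, R.lo z < w → w < R.hi z → w = z := by
  obtain ⟨_, h⟩ := exists_isCutAt (R.base z)
  have b1 := h.bot_le (R.lo z)
  have b2 := h.bot_le (R.hi z)
  have b3 := h.bot_le z
  have n1 := R.base_ne_lo z
  have n2 := R.base_ne_hi z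
  have n3 := R.base_ne z
  refine ⟨_, h, lt_of_le_of_ne b1 n1, ?_⟩
  by_cases hz : z ∈ Φ.I
  · have s1 := R.succ_lo z hz
    have s2 := R.succ_hi z hz
    have q1 := s1.2
    have q2 := s2.2
    simp only [h.sbtw_iff] at q1 q2
    have q3 := q1 (R.base z)
    have q4 := q2 (R.base z)
    have q5 := s1.1
    have q6 := s2.1
    refine ⟨by grind, by grind, fun _ => by grind, fun w h1 h2 => ?_⟩
    have := q1 w
    have := q2 w
    grind
  · refine ⟨(R.lo_eq z hz).le, (R.hi_eq z hz).ge, fun h => absurd h hz, fun w h1 h2 => ?_⟩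
    rw [R.lo_eq z hz] at h1
    rw [R.hi_eq z hz] at h2
    exact absurd h1 h2.not_gt

theorem mem_cycIcc_cover (z w : Φ.C) :
    w ∈ cycIcc (R.base z) (R.lo z) ∨ w = z ∨ w ∈ cycIcc (R.hi z) (R.base z) := by
  obtain ⟨_, h, h1, h2, h3, -, h5⟩ := R.exists_order z
  have := h.bot_le w
  have h6 := h5 w
  rw [h.mem_cycIcc, h.mem_cycIcc]
  clear h h5
  rcases lt_trichotomy w (R.lo z) with h' | h' | h'
  · grind
  · grind
  rcases lt_trichotomy w (R.hi z) with h'' | h'' | h'' <;> grind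

theorem mem_Icc_base_hi {z w : Φ.C} (hw : w ∈ cycIcc (R.base z) (R.hi z)) :
    w ∈ cycIcc (R.base z) (R.lo z) ∨ w = z ∨ w = R.hi z := by
  obtain ⟨_, h, h1, h2, h3, -, h5⟩ := R.exists_order z
  have := h.bot_le w
  have := h5 w
  rw [h.mem_cycIcc] at *
  grind

theorem mem_A_top (z : Φ.C) : z ∈ cycIcc (R.base z) (R.hi z) := by
  obtain ⟨_, h, h1, h2, h3, -, h5⟩ := R.exists_order z
  rw [h.mem_cycIcc]
  grind

theorem mem_B_bot (z : Φ.C) : z ∈ cycIcc (R.lo z) (R.base z) := by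
  obtain ⟨_, h, h1, h2, h3, -, h5⟩ := R.exists_order z
  rw [h.mem_cycIcc]
  grind

theorem order_bot (z : Φ.C) : (k : ℕ∞) ≤ sepOrder (intervalSep Φ.P (R.base z) (R.lo z)) := by
  rw [← (R.chain z).bot_eq]
  exact ((R.isLimitChain z).card ⊥).ge

theorem order_top (z : Φ.C) : (k : ℕ∞) ≤ sepOrder (intervalSep Φ.P (R.base z) (R.hi z)) := by
  rw [← (R.chain z).top_eq]
  exact ((R.isLimitChain z).card ⊤).ge

theorem disjoint_lo (z : Φ.C) : Disjoint (Φ.P (R.base z)) (Φ.P (R.lo z)) :=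
  Φ.disjoint_of_le_order (R.base_notMem z) (R.lo_notMem z) (R.base_ne_lo z) (R.order_bot z)

theorem disjoint_hi (z : Φ.C) : Disjoint (Φ.P (R.base z)) (Φ.P (R.hi z)) :=
  Φ.disjoint_of_le_order (R.base_notMem z) (R.hi_notMem z) (R.base_ne_hi z) (R.order_top z)

theorem inner_eq_of_disjoint {S T X : Set V} {Y : Set V} (hY : Y = S ∪ T ∪ X) (h1 : Disjoint S T)
    (h2 : Disjoint T X) : Y \ (S ∪ X) = T := by
  subst hY
  ext x
  have h3 : x ∈ S → x ∉ T := fun hx => disjoint_left.1 h1 hx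
  have h4 : x ∈ T → x ∉ X := fun hx => disjoint_left.1 h2 hx
  simp only [mem_sdiff, mem_union]
  tauto

theorem inner_bot (z : Φ.C) : R.inner z ⊥ = Φ.P (R.lo z) := by
  refine inner_eq_of_disjoint ?_ (R.disjoint_lo z) (Φ.disjoint_center _)
  rw [A_bot, B_bot]
  exact Φ.separator_eq _ (R.base_notMem z) _ (R.lo_notMem z) (R.base_ne_lo z)

theorem inner_top (z : Φ.C) : R.inner z ⊤ = Φ.P (R.hi z) := by
  refine inner_eq_of_disjoint ?_ (R.disjoint_hi z) (Φ.disjoint_center _)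
  rw [A_top, B_top]
  exact Φ.separator_eq _ (R.base_notMem z) _ (R.hi_notMem z) (R.base_ne_hi z)

theorem lo_subset (z : Φ.C) : Φ.P (R.lo z) ⊆ Φ.P z := by
  by_cases hz : z ∈ Φ.I
  · exact Φ.pred_subset z hz _ (R.succ_lo z hz)
  · rw [R.lo_eq z hz]

theorem hi_subset (z : Φ.C) : Φ.P (R.hi z) ⊆ Φ.P z := by
  by_cases hz : z ∈ Φ.I
  · exact Φ.succ_subset z hz _ (R.succ_hi z hz)
  · rw [R.hi_eq z hz]

/-- Such a vertex lies in V(lo, base) and in V(base, hi). Either it comes from the petal or from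
`hi`, or it crosses the separator of S(base, lo). As it is not in `Z`, it is then in the set at
`lo`, and both neighbouring sets are contained in the petal. -/
theorem diff_subset_petal (z : Φ.C) (m m' : (R.chain z).M) :
    (R.B z m ∩ R.A z m') \ R.Z z ⊆ Φ.P z := by
  rintro x ⟨⟨hB, hA⟩, hx⟩
  have hB' := (R.isLimitChain z).anti (bot_le : ⊥ ≤ m) hB
  have hA' := (R.isLimitChain z).mono (le_top : m' ≤ ⊤) hA
  rw [B_bot, mem_intervalSet] at hB'
  rw [A_top, mem_intervalSet] at hA'
  have hx1 : x ∉ Φ.P (R.base z) := fun e => hx (Or.inl e)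
  have hx2 : x ∉ center Φ.P := fun e => hx (Or.inr e)
  obtain ⟨b, hb, hxb⟩ := hB'.resolve_right hx2
  obtain ⟨a, ha, hxa⟩ := hA'.resolve_right hx2
  rcases R.mem_Icc_base_hi ha with ha' | rfl | rfl
  · exact R.lo_subset z ((Φ.separatesAt (R.base_notMem z) (R.lo_notMem z) (R.base_ne_lo z)
      x a b ha' hb hxa hxb).resolve_left hx1)
  · exact hxa
  · exact R.hi_subset z hxa

theorem inner_subset_petal (z : Φ.C) (m : (R.chain z).M) : R.inner z m ⊆ Φ.P z := by
  have := R.diff_subset_petal z m m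
  rwa [inter_comm] at this

theorem disjoint_base (z : Φ.C) : Disjoint (Φ.P (R.base z)) (Φ.P z) := by
  by_cases hz : z ∈ Φ.I
  · refine disjoint_left.2 fun x hu hx => ?_
    have hp := R.succ_lo z hz
    have hs := R.succ_hi z hz
    have hne := Φ.pred_ne_succ (R.lo_notMem z) hp hs
    have hbase : R.base z ∈ cycIcc (R.hi z) (R.lo z) := by
      obtain ⟨_, h, h1, h2, h3, -, h5⟩ := R.exists_order z
      rw [h.mem_cycIcc]
      grind
    rcases Φ.separatesAt (R.lo_notMem z) (R.hi_notMem z) hne x z (R.base z)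
      ((Φ.cycIcc_petal (R.lo_notMem z) hp hs).2 (Or.inr (Or.inl rfl))) hbase hx hu with h | h
    · exact disjoint_left.1 (R.disjoint_lo z) hu h
    · exact disjoint_left.1 (R.disjoint_hi z) hu h
  · have := R.disjoint_lo z
    rwa [R.lo_eq z hz] at this

theorem petal_subset (z : Φ.C) {x : V} (hx : x ∈ Φ.P z) :
    (∃ m, x ∈ R.inner z m) ∨ ∃ n n', n ⋖ n' ∧ x ∈ (R.B z n ∩ R.A z n') \ R.Z z := by
  have h := R.isLimitChain z
  have hxX : x ∉ center Φ.P := notMem_center hx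
  by_cases hxA : x ∈ R.A z ⊥
  · left
    have hxB : x ∈ R.B z ⊥ := by
      rw [B_bot]
      exact subset_intervalSet (R.mem_B_bot z) hx
    exact ⟨⊥, ⟨hxA, hxB⟩, fun e => e.elim (fun e => disjoint_left.1 (R.disjoint_base z) e hx) hxX⟩
  · have hxA' : x ∈ R.A z ⊤ := by
      rw [A_top]
      exact subset_intervalSet (R.mem_A_top z) hx
    rcases h.mem_innerSep_or_jump_left hxA' hxA with ⟨n, -, -, hn⟩ | ⟨n, n', -, hn, -, hx'⟩
    · exact Or.inl ⟨n, hn⟩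
    · exact Or.inr ⟨n, n', hn, hx'⟩

end Refinement

end Refinement

/-! ### The sets of the refined family cover the same vertices -/

section RefinedFamily

variable {V : Type u} {U : SepUniverse V} {k : ℕ}

namespace Refinement

variable {Φ : Pseudoflower U k} (R : Refinement Φ)

/-- The underlying cycle of the refined pseudoflower. -/
abbrev C : Type u := Refined Φ.I R.N

/-- The sets of the refined pseudoflower. -/
def P (a : R.C) : Set V :=
  {x | (a.fib.tag = 3 ∧ ∃ m', a.fib.pos ⋖ m' ∧
    x ∈ (R.B a.base a.fib.pos ∩ R.A a.base m') \ R.Z a.base) ∨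
    (a.fib.tag ≠ 3 ∧ x ∈ R.inner a.base a.fib.pos)}

theorem P_of_ne {z : Φ.C} {e : Fibre (R.N z) (z ∈ Φ.I)} (he : e.tag ≠ 3) :
    R.P (Refined.mk z e) = R.inner z e.pos := by
  ext x
  exact ⟨fun h => (h.resolve_left fun h' => he h'.1).2, fun h => Or.inr ⟨he, h⟩⟩

theorem P_of_covBy {z : Φ.C} {e : Fibre (R.N z) (z ∈ Φ.I)} (he : e.tag = 3)
    {m' : (R.chain z).M} (hm : e.pos ⋖ m') :
    R.P (Refined.mk z e) = (R.B z e.pos ∩ R.A z m') \ R.Z z := by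
  ext x
  constructor
  · rintro (⟨-, m'', h, hx⟩ | ⟨h, -⟩)
    · have : m' = m'' := hm.unique_right h
      subst this
      exact hx
    · exact absurd he h
  · exact fun hx => Or.inl ⟨he, m', hm, hx⟩

theorem exists_covBy {z : Φ.C} {e : Fibre (R.N z) (z ∈ Φ.I)} (he : e.tag = 3) :
    ∃ m', e.pos ⋖ m' := by
  have := e.mem
  unfold FibreMem at this
  rcases this with h | h | h | h
  · rw [he] at h; exact absurd h.1 (by decide)
  · rw [he] at h; exact absurd h.1 (by decide)
  · rw [he] at h; exact absurd h.1 (by decide)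
  · exact h.2.2

theorem P_jump {z : Φ.C} (hz : z ∈ Φ.I) {n n' : (R.chain z).M} (h : n ⋖ n') :
    R.P (Refined.mk z (Fibre.mk n 3 (fibreMem_jump hz h))) = (R.B z n ∩ R.A z n') \ R.Z z :=
  R.P_of_covBy (e := Fibre.mk n 3 (fibreMem_jump hz h)) rfl h

theorem P_subset (a : R.C) : R.P a ⊆ Φ.P a.base := by
  obtain ⟨z, e, rfl⟩ := Refined.exists_mk a
  by_cases he : e.tag = 3
  · obtain ⟨m', hm⟩ := R.exists_covBy he
    rw [R.P_of_covBy he hm]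
    exact R.diff_subset_petal z _ _
  · rw [R.P_of_ne he]
    exact R.inner_subset_petal z _

theorem P_lift {v : Φ.C} (hv : v ∉ Φ.I) : R.P (Refined.lift v hv) = Φ.P v := by
  rw [Refined.lift, R.P_of_ne (by rw [Fibre.tag_mk]; decide), Fibre.pos_mk, R.inner_bot,
    R.lo_eq v hv]

/-- The extreme separators of the chain may have no cutpoint in the fibre of `z`. They are the sets
at `lo z` and `hi z`, which survive as lifted cutpoints. -/
theorem petal_cover (z : Φ.C) {x : V} (hx : x ∈ Φ.P z) :
    x ∈ Φ.P (R.lo z) ∨ x ∈ Φ.P (R.hi z) ∨ ∃ a : R.C, a.base = z ∧ x ∈ R.P a := by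
  by_cases hz : z ∈ Φ.I
  · rcases R.petal_subset z hx with ⟨m, hm⟩ | ⟨n, n', hn, hm⟩
    · by_cases h1 : m = ⊥
      · subst h1
        rw [inner_bot] at hm
        exact Or.inl hm
      by_cases h2 : m = ⊤
      · subst h2
        rw [inner_top] at hm
        exact Or.inr (Or.inl hm)
      refine Or.inr (Or.inr ⟨Refined.mk z (Fibre.mk m 0 (fibreMem_cut fun _ => ⟨h1, Or.inl h2⟩)),
        rfl, ?_⟩)
      rwa [R.P_of_ne (by rw [Fibre.tag_mk]; decide)]
    · refine Or.inr (Or.inr ⟨Refined.mk z (Fibre.mk n 3 (fibreMem_jump hz hn)), rfl, ?_⟩)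
      rwa [R.P_jump hz hn]
  · rw [R.lo_eq z hz]
    exact Or.inl hx

theorem center_eq : center R.P = center Φ.P := by
  ext x
  constructor
  · intro hx
    rcases mem_or_mem_center Φ.P x with ⟨z, hz⟩ | h
    · rcases R.petal_cover z hz with h | h | ⟨a, -, h⟩
      · exact absurd hx (notMem_center
          (by rw [P_lift]; exact h : x ∈ R.P (Refined.lift _ (R.lo_notMem z))))
      · exact absurd hx (notMem_center
          (by rw [P_lift]; exact h : x ∈ R.P (Refined.lift _ (R.hi_notMem z))))
      · exact absurd hx (notMem_center h)
    · exact h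
  · intro hx
    rcases mem_or_mem_center R.P x with ⟨a, ha⟩ | h
    · exact absurd hx (notMem_center (R.P_subset a ha))
    · exact h

theorem lo_hi_mem_cycIcc {v w z : Φ.C} (hv : v ∉ Φ.I) (hw : w ∉ Φ.I) (hz : z ∈ cycIcc v w) :
    R.lo z ∈ cycIcc v w ∧ R.hi z ∈ cycIcc v w := by
  by_cases hzI : z ∈ Φ.I
  · obtain ⟨_, h⟩ := exists_isCutAt v
    have q1 := (R.succ_lo z hzI).2 v
    have q2 := (R.succ_hi z hzI).2 w
    have n1 : z ≠ v := fun e => hv (e ▸ hzI)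
    have n2 : z ≠ w := fun e => hw (e ▸ hzI)
    have b1 := h.bot_le (R.lo z)
    have b2 := h.bot_le (R.hi z)
    have b3 := h.bot_le z
    have b4 := h.bot_le w
    rw [h.sbtw_iff] at q1 q2
    rw [h.mem_cycIcc] at hz
    rw [h.mem_cycIcc, h.mem_cycIcc]
    clear h hv hw hzI
    have : v < z ∧ z < w := by grind
    constructor
    · have : R.lo z ≤ z := by grind
      grind
    · grind
  · rw [R.lo_eq z hzI, R.hi_eq z hzI]
    exact ⟨hz, hz⟩

theorem intervalSet_eq {v w : Φ.C} (hv : v ∉ Φ.I) (hw : w ∉ Φ.I) {x : V} :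
    x ∈ intervalSet Φ.P v w ↔ x ∈ center Φ.P ∨ ∃ a : R.C, a.base ∈ cycIcc v w ∧ x ∈ R.P a := by
  rw [mem_intervalSet, or_comm]
  refine or_congr_right ⟨?_, ?_⟩
  · rintro ⟨z, hz, hx⟩
    rcases R.petal_cover z hx with h | h | ⟨a, rfl, h⟩
    · exact ⟨Refined.lift _ (R.lo_notMem z), (R.lo_hi_mem_cycIcc hv hw hz).1, by rwa [P_lift]⟩
    · exact ⟨Refined.lift _ (R.hi_notMem z), (R.lo_hi_mem_cycIcc hv hw hz).2, by rwa [P_lift]⟩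
    · exact ⟨a, hz, h⟩
  · rintro ⟨a, ha, hx⟩
    exact ⟨a.base, ha, R.P_subset a hx⟩

/-- The left side at level `c` grows from its value at the bottom exactly by the refined sets up to
`c`, because every vertex that enters does so in a separator or at a jump. -/
theorem mem_A_iff {z : Φ.C} {c : Fibre (R.N z) (z ∈ Φ.I)} (hc : ¬ c.IsPetal) {x : V} :
    x ∈ R.A z c.pos ↔ x ∈ intervalSet Φ.P (R.base z) (R.lo z) ∨
      ∃ e : Fibre (R.N z) (z ∈ Φ.I), e ≤ c ∧ x ∈ R.P (Refined.mk z e) := by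
  have h := R.isLimitChain z
  have mc := c.mem
  unfold FibreMem at mc
  unfold Fibre.IsPetal at hc
  constructor
  · intro hx
    by_cases hx' : x ∈ R.A z ⊥
    · rw [A_bot] at hx'
      exact Or.inl hx'
    right
    rcases h.mem_innerSep_or_jump_left hx hx' with ⟨n, h1, h2, h3⟩ | ⟨n, n', h1, h2, h3, h4⟩
    -- The point of tag 0 could be missing only at the top level outside `N`. Then `c` would also be
    -- at the top level, where a non-petal exists only if the level is in `N`.
    · have hn : FibreMem (R.N z) (z ∈ Φ.I) n 0 := fibreMem_cut fun hz => ⟨h1.ne', by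
        by_cases hnt : n = ⊤
        · have : c.pos = ⊤ := top_le_iff.1 (hnt ▸ h2)
          rw [hnt, ← this]
          rw [this] at mc
          grind
        · exact Or.inl hnt⟩
      refine ⟨Fibre.mk n 0 hn, ?_, ?_⟩
      · rcases eq_or_lt_of_le h2 with rfl | h2
        · by_cases ht : c.tag = 0
          · exact (Fibre.ext_iff (e := Fibre.mk c.pos 0 hn) (f := c).2 ⟨rfl, ht.symm⟩).le
          · exact (Fibre.lt_iff (e := Fibre.mk c.pos 0 hn) (f := c).2
              (Or.inr ⟨rfl, Fin.pos_iff_ne_zero.2 ht⟩)).le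
        · exact (Fibre.lt_iff.2 (Or.inl h2)).le
      · rw [R.P_of_ne (by rw [Fibre.tag_mk]; decide)]
        exact h3
    · have hz : z ∈ Φ.I := by
        by_contra hz
        have := R.subsingleton hz
        exact h2.lt.ne (Subsingleton.elim _ _)
      refine ⟨Fibre.mk n 3 (fibreMem_jump hz h2), ?_, ?_⟩
      · exact (Fibre.lt_iff.2 (Or.inl (h2.lt.trans_le h3))).le
      · rwa [R.P_jump hz h2]
  · rintro (hx | ⟨e, hec, hx⟩)
    · rw [← A_bot] at hx
      exact h.mono bot_le hx
    · by_cases he : e.tag = 3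
      · obtain ⟨m', hm⟩ := R.exists_covBy he
        rw [R.P_of_covBy he hm] at hx
        refine h.mono (hm.ge_of_gt ?_) hx.1.2
        rcases eq_or_lt_of_le hec with rfl | hec
        · exact absurd (Or.inr he) hc
        · rcases Fibre.lt_iff.1 hec with h' | ⟨-, h'⟩
          · exact h'
          · rw [he] at h'
            have := c.tag.le_last
            exact absurd h' (not_lt.2 this)
      · rw [R.P_of_ne he] at hx
        exact h.mono (Fibre.pos_mono hec) hx.1.1

theorem mem_B_iff {z : Φ.C} {c : Fibre (R.N z) (z ∈ Φ.I)} (hc : ¬ c.IsPetal) {x : V} :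
    x ∈ R.B z c.pos ↔ x ∈ intervalSet Φ.P (R.hi z) (R.base z) ∨
      ∃ e : Fibre (R.N z) (z ∈ Φ.I), c ≤ e ∧ x ∈ R.P (Refined.mk z e) := by
  have h := R.isLimitChain z
  unfold Fibre.IsPetal at hc
  have hc3 : c.tag ≠ 3 := fun e => hc (Or.inr e)
  constructor
  · intro hx
    by_cases hx' : x ∈ R.B z ⊤
    · rw [B_top] at hx'
      exact Or.inl hx'
    right
    rcases h.mem_innerSep_or_jump_right hx hx' with ⟨n, h1, h2, h3⟩ | ⟨n, n', h1, h2, h3, h4⟩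
    · rcases eq_or_lt_of_le h1 with rfl | h1
      · exact ⟨c, le_rfl, by rwa [R.P_of_ne hc3]⟩
      · refine ⟨Fibre.mk n 0 (fibreMem_cut fun _ => ⟨((bot_le).trans_lt h1).ne', Or.inl h2.ne⟩),
          (Fibre.lt_iff.2 (Or.inl h1)).le, ?_⟩
        rwa [R.P_of_ne (by rw [Fibre.tag_mk]; decide)]
    · have hz : z ∈ Φ.I := by
        by_contra hz
        have := R.subsingleton hz
        exact h2.lt.ne (Subsingleton.elim _ _)
      refine ⟨Fibre.mk n 3 (fibreMem_jump hz h2), ?_, ?_⟩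
      · rcases eq_or_lt_of_le h1 with rfl | h1
        · exact (Fibre.lt_iff (e := c) (f := Fibre.mk c.pos 3 (fibreMem_jump hz h2)).2
          (Or.inr ⟨rfl, lt_of_le_of_ne c.tag.le_last hc3⟩)).le
        · exact (Fibre.lt_iff.2 (Or.inl h1)).le
      · rwa [R.P_jump hz h2]
  · rintro (hx | ⟨e, hec, hx⟩)
    · rw [← B_top] at hx
      exact h.anti le_top hx
    · refine h.anti (Fibre.pos_mono hec) ?_
      by_cases he : e.tag = 3
      · obtain ⟨m', hm⟩ := R.exists_covBy he
        rw [R.P_of_covBy he hm] at hx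
        exact hx.1.1
      · rw [R.P_of_ne he] at hx
        exact hx.1.2

end Refinement

end RefinedFamily

/-! ### Interval separations of the refined cycle -/

section RefinedCycle

namespace Refined

variable {C : Type u} {I : Set C} {M : C → Type u} [∀ z, LinearOrder (M z)]
  [∀ z, BoundedOrder (M z)] {N : ∀ z, Set (M z)} [LinearOrder C] [CircularOrder C] {o : C}

/-- Over three distinct elements, monotonicity applied to both orientations determines the cyclic
order. -/
theorem sbtw_iff_of_ne (h : IsCutAt o) {a b c : Refined I N} (hab : a.base ≠ b.base)
    (hbc : b.base ≠ c.base) (hca : c.base ≠ a.base) :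
    sbtw a b c ↔ sbtw a.base b.base c.base := by
  refine ⟨fun h' => ?_, cycMonotone_base h a b c⟩
  exact (sbtw_or_sbtw hab hbc hca).resolve_right fun h'' =>
    (cycMonotone_base h c b a h'').not_sbtw h'

omit [CircularOrder C] in
theorem sbtw_mk_mk {x : Refined I N} {z : C} (hx : x.base ≠ z) {e c : Fibre (N z) (z ∈ I)} :
    sbtw x (mk z e) (mk z c) ↔ e < c := by
  rw [sbtw_iff', mk_lt_mk]
  rcases lt_or_gt_of_ne hx with h | h
  · have h1 : x < mk z e := lt_of_base_lt h
    have h2 : x < mk z c := lt_of_base_lt h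
    have h3 := h2.not_gt
    tauto
  · have h1 : mk z e < x := lt_of_base_lt h
    have h2 : mk z c < x := lt_of_base_lt h
    have h3 := h1.not_gt
    tauto

end Refined

variable {V : Type u} {U : SepUniverse V} {k : ℕ}

namespace Refinement

variable {Φ : Pseudoflower U k} (R : Refinement Φ)

theorem subsingleton_chain : ∀ z ∉ Φ.I, Subsingleton (R.chain z).M := fun _ hz => R.subsingleton hz

/-- The point of the refined cycle over a cutpoint. -/
abbrev lift (v : Φ.C) (hv : v ∉ Φ.I) : R.C := Refined.lift v hv

abbrev baseLift (z : Φ.C) : R.C := R.lift (R.base z) (R.base_notMem z)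

theorem mem_Icc_base_lo_iff {z w : Φ.C} (hw : w ≠ z) :
    w ∈ cycIcc (R.base z) (R.lo z) ↔ w = R.base z ∨ sbtw (R.base z) w z := by
  obtain ⟨_, h, h1, h2, h3, -, h5⟩ := R.exists_order z
  have := h.bot_le w
  have := h5 w
  rw [h.mem_cycIcc, h.sbtw_iff]
  grind

theorem mem_Icc_hi_base_iff {z w : Φ.C} (hw : w ≠ z) :
    w ∈ cycIcc (R.hi z) (R.base z) ↔ w = R.base z ∨ sbtw z w (R.base z) := by
  obtain ⟨_, h, h1, h2, h3, -, h5⟩ := R.exists_order z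
  have := h.bot_le w
  have := h5 w
  rw [h.mem_cycIcc, h.sbtw_iff]
  grind

theorem notMem_Icc_base_lo {z : Φ.C} (hz : z ∈ Φ.I) : z ∉ cycIcc (R.base z) (R.lo z) := by
  obtain ⟨_, h, h1, h2, h3, h4, h5⟩ := R.exists_order z
  have := h4 hz
  rw [h.mem_cycIcc]
  grind

theorem notMem_Icc_hi_base {z : Φ.C} (hz : z ∈ Φ.I) : z ∉ cycIcc (R.hi z) (R.base z) := by
  obtain ⟨_, h, h1, h2, h3, h4, h5⟩ := R.exists_order z
  have := h4 hz
  rw [h.mem_cycIcc]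
  grind

theorem eq_of_notMem {z : Φ.C} (hz : z ∉ Φ.I) (e c : Fibre (R.N z) (z ∈ Φ.I)) : e = c :=
  Refined.mk_injective ((Refined.eq_lift R.subsingleton_chain hz rfl).trans
    (Refined.eq_lift R.subsingleton_chain hz rfl).symm :
    (Refined.mk z e : R.C) = Refined.mk z c)

variable [LinearOrder Φ.C] {o : Φ.C} (h : IsCutAt o)
include h

theorem mem_cycIcc_baseLift {z : Φ.C} {c : Fibre (R.N z) (z ∈ Φ.I)} {a : R.C} :
    a ∈ cycIcc (R.baseLift z) (Refined.mk z c) ↔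
      a.base ∈ cycIcc (R.base z) (R.lo z) ∨ ∃ e, e ≤ c ∧ a = Refined.mk z e := by
  have hbz := R.base_ne z
  have hne : (R.baseLift z).base ≠ z := hbz
  rw [mem_cycIcc]
  by_cases ha : a.base = z
  · obtain ⟨e, rfl⟩ := Refined.exists_mk_of_base_eq ha
    rw [Refined.sbtw_mk_mk hne]
    have n1 : (Refined.mk z e : R.C) ≠ R.baseLift z := fun e' => hbz (congrArg Refined.base e').symm
    by_cases hz : z ∈ Φ.I
    · have n2 := R.notMem_Icc_base_lo hz
      constructor
      · rintro (h' | h' | h')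
        · exact absurd h' n1
        · exact Or.inr ⟨e, (Refined.mk_injective h').le, rfl⟩
        · exact Or.inr ⟨e, h'.le, rfl⟩
      · rintro (h' | ⟨e', h', h''⟩)
        · exact absurd h' n2
        · rw [Refined.mk_injective h'']
          rcases eq_or_lt_of_le h' with rfl | h'
          · exact Or.inr (Or.inl rfl)
          · exact Or.inr (Or.inr h')
    · have := R.eq_of_notMem hz e c
      subst this
      exact ⟨fun _ => Or.inr ⟨e, le_rfl, rfl⟩, fun _ => Or.inr (Or.inl rfl)⟩
  · rw [R.mem_Icc_base_lo_iff ha]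
    have n1 : a ≠ Refined.mk z c := fun e => ha (congrArg Refined.base e)
    have n2 : ¬ ∃ e, e ≤ c ∧ a = Refined.mk z e := by
      rintro ⟨e, -, rfl⟩
      exact ha rfl
    by_cases hu : a.base = R.base z
    · have : a = R.baseLift z := Refined.eq_lift R.subsingleton_chain _ hu
      exact ⟨fun _ => Or.inl (Or.inl hu), fun _ => Or.inl this⟩
    · have n3 : a ≠ R.baseLift z := fun e => hu (congrArg Refined.base e)
      rw [Refined.sbtw_iff_of_ne h (a := R.baseLift z) (c := Refined.mk z c) (Ne.symm hu)
        ha hne.symm]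
      simp only [n1, n2, n3, hu, false_or, or_false]
      exact Iff.rfl

theorem mem_cycIcc_baseLift' {z : Φ.C} {c : Fibre (R.N z) (z ∈ Φ.I)} {a : R.C} :
    a ∈ cycIcc (Refined.mk z c) (R.baseLift z) ↔
      a.base ∈ cycIcc (R.hi z) (R.base z) ∨ ∃ e, c ≤ e ∧ a = Refined.mk z e := by
  have hbz := R.base_ne z
  have hne : (R.baseLift z).base ≠ z := hbz
  rw [mem_cycIcc]
  have hcyc : ∀ x y w : R.C, sbtw x y w ↔ sbtw w x y := fun x y w => sbtw_cyclic
  by_cases ha : a.base = z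
  · obtain ⟨e, rfl⟩ := Refined.exists_mk_of_base_eq ha
    rw [hcyc, Refined.sbtw_mk_mk hne]
    have n1 : (Refined.mk z e : R.C) ≠ R.baseLift z := fun e' => hbz (congrArg Refined.base e').symm
    by_cases hz : z ∈ Φ.I
    · have n2 := R.notMem_Icc_hi_base hz
      constructor
      · rintro (h' | h' | h')
        · exact Or.inr ⟨e, (Refined.mk_injective h').ge, rfl⟩
        · exact absurd h' n1
        · exact Or.inr ⟨e, h'.le, rfl⟩
      · rintro (h' | ⟨e', h', h''⟩)
        · exact absurd h' n2
        · rw [Refined.mk_injective h'']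
          rcases eq_or_lt_of_le h' with rfl | h'
          · exact Or.inl rfl
          · exact Or.inr (Or.inr h')
    · have := R.eq_of_notMem hz e c
      subst this
      exact ⟨fun _ => Or.inr ⟨e, le_rfl, rfl⟩, fun _ => Or.inl rfl⟩
  · rw [R.mem_Icc_hi_base_iff ha]
    have n1 : a ≠ Refined.mk z c := fun e => ha (congrArg Refined.base e)
    have n2 : ¬ ∃ e, c ≤ e ∧ a = Refined.mk z e := by
      rintro ⟨e, -, rfl⟩
      exact ha rfl
    by_cases hu : a.base = R.base z
    · have : a = R.baseLift z := Refined.eq_lift R.subsingleton_chain _ hu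
      exact ⟨fun _ => Or.inl (Or.inl hu), fun _ => Or.inr (Or.inl this)⟩
    · have n3 : a ≠ R.baseLift z := fun e => hu (congrArg Refined.base e)
      rw [Refined.sbtw_iff_of_ne h (a := Refined.mk z c) (c := R.baseLift z) (Ne.symm ha) hu hne]
      simp only [n1, n2, n3, hu, false_or, or_false]
      exact Iff.rfl

/-- Together with `intervalSet_baseLift'`, this identifies the interval separation from the base to
`c` with the member of the chain at the level of `c`. It is therefore in U by construction. -/
theorem intervalSet_baseLift {z : Φ.C} {c : Fibre (R.N z) (z ∈ Φ.I)} (hc : ¬ c.IsPetal) :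
    intervalSet R.P (R.baseLift z) (Refined.mk z c) = R.A z c.pos := by
  ext x
  rw [R.mem_A_iff hc, mem_intervalSet, R.intervalSet_eq (R.base_notMem z) (R.lo_notMem z),
    R.center_eq]
  constructor
  · rintro (⟨a, ha, hx⟩ | hx)
    · rcases (R.mem_cycIcc_baseLift h).1 ha with h1 | ⟨e, h1, rfl⟩
      · exact Or.inl (Or.inr ⟨a, h1, hx⟩)
      · exact Or.inr ⟨e, h1, hx⟩
    · exact Or.inl (Or.inl hx)
  · rintro ((hx | ⟨a, ha, hx⟩) | ⟨e, he, hx⟩)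
    · exact Or.inr hx
    · exact Or.inl ⟨a, (R.mem_cycIcc_baseLift h).2 (Or.inl ha), hx⟩
    · exact Or.inl ⟨_, (R.mem_cycIcc_baseLift h).2 (Or.inr ⟨e, he, rfl⟩), hx⟩

theorem intervalSet_baseLift' {z : Φ.C} {c : Fibre (R.N z) (z ∈ Φ.I)} (hc : ¬ c.IsPetal) :
    intervalSet R.P (Refined.mk z c) (R.baseLift z) = R.B z c.pos := by
  ext x
  rw [R.mem_B_iff hc, mem_intervalSet, R.intervalSet_eq (R.hi_notMem z) (R.base_notMem z),
    R.center_eq]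
  constructor
  · rintro (⟨a, ha, hx⟩ | hx)
    · rcases (R.mem_cycIcc_baseLift' h).1 ha with h1 | ⟨e, h1, rfl⟩
      · exact Or.inl (Or.inr ⟨a, h1, hx⟩)
      · exact Or.inr ⟨e, h1, hx⟩
    · exact Or.inl (Or.inl hx)
  · rintro ((hx | ⟨a, ha, hx⟩) | ⟨e, he, hx⟩)
    · exact Or.inr hx
    · exact Or.inl ⟨a, (R.mem_cycIcc_baseLift' h).2 (Or.inl ha), hx⟩
    · exact Or.inl ⟨_, (R.mem_cycIcc_baseLift' h).2 (Or.inr ⟨e, he, rfl⟩), hx⟩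

theorem mem_cycIcc_lift {v w : Φ.C} (hv : v ∉ Φ.I) (hw : w ∉ Φ.I) (hvw : v ≠ w) {a : R.C} :
    a ∈ cycIcc (R.lift v hv) (R.lift w hw) ↔ a.base ∈ cycIcc v w := by
  have h1 := (Refined.cycMonotone_base (N := R.N) (I := Φ.I) h).preimage_cycIcc (v' := R.lift v hv)
    (w' := R.lift w hw) (fun x hx => Refined.eq_lift R.subsingleton_chain hv hx)
    (fun x hx => Refined.eq_lift R.subsingleton_chain hw hx) (fun e => hvw (congrArg Refined.base e))
  rw [← h1]
  exact Iff.rfl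

theorem intervalSet_lift {v w : Φ.C} (hv : v ∉ Φ.I) (hw : w ∉ Φ.I) (hvw : v ≠ w) :
    intervalSet R.P (R.lift v hv) (R.lift w hw) = intervalSet Φ.P v w := by
  ext x
  rw [R.intervalSet_eq hv hw, mem_intervalSet, or_comm, R.center_eq]
  refine or_congr_right (exists_congr fun a => and_congr_left' ?_)
  exact R.mem_cycIcc_lift h hv hw hvw

/-- The cutpoint `p` of the refinement is at the separation `m` of the chain of `z`. -/
structure AtLevel (p : R.C) (z : Φ.C) (m : (R.chain z).M) : Prop where
  notMem : p ∉ Refined.petals Φ.I R.N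
  ne : R.baseLift z ≠ p
  left : intervalSet R.P (R.baseLift z) p = R.A z m
  right : intervalSet R.P p (R.baseLift z) = R.B z m
  eq_inner : R.P p = R.inner z m

theorem atLevel_mk {z : Φ.C} {c : Fibre (R.N z) (z ∈ Φ.I)} (hc : ¬ c.IsPetal) :
    R.AtLevel (Refined.mk z c) z c.pos :=
  ⟨hc, fun e => R.base_ne z (congrArg Refined.base e), R.intervalSet_baseLift h hc,
    R.intervalSet_baseLift' h hc, R.P_of_ne fun e => hc (Or.inr e)⟩

theorem atLevel_lo (z : Φ.C) : R.AtLevel (R.lift _ (R.lo_notMem z)) z ⊥ := by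
  refine ⟨Refined.lift_notMem _ _, fun e => R.base_ne_lo z (congrArg Refined.base e), ?_, ?_, ?_⟩
  · rw [A_bot, R.intervalSet_lift h _ _ (R.base_ne_lo z)]
  · rw [B_bot, R.intervalSet_lift h _ _ (R.base_ne_lo z).symm]
  · rw [inner_bot]
    exact R.P_lift _

theorem atLevel_hi (z : Φ.C) : R.AtLevel (R.lift _ (R.hi_notMem z)) z ⊤ := by
  refine ⟨Refined.lift_notMem _ _, fun e => R.base_ne_hi z (congrArg Refined.base e), ?_, ?_, ?_⟩
  · rw [A_top, R.intervalSet_lift h _ _ (R.base_ne_hi z)]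
  · rw [B_top, R.intervalSet_lift h _ _ (R.base_ne_hi z).symm]
  · rw [inner_top]
    exact R.P_lift _

omit h in
theorem AtLevel.isGoodPair {R : Refinement Φ} {p : R.C} {z : Φ.C} {m : (R.chain z).M}
    (hp : R.AtLevel p z m) : IsGoodPair U R.P (R.baseLift z) p := by
  constructor
  · rw [separatesAt_iff, hp.left, hp.right, hp.eq_inner, R.P_lift, R.center_eq]
    have h1 := (R.isLimitChain z).base m
    rw [union_right_comm]
    exact (union_sdiff_cancel h1).symm
  · have := (R.chain z).mem m
    unfold intervalSep
    rw [hp.left, hp.right]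
    exact this

theorem isGoodPair_lift {v w : Φ.C} (hv : v ∉ Φ.I) (hw : w ∉ Φ.I) (hvw : v ≠ w) :
    IsGoodPair U R.P (R.lift v hv) (R.lift w hw) := by
  constructor
  · rw [separatesAt_iff, R.intervalSet_lift h hv hw hvw, R.intervalSet_lift h hw hv hvw.symm,
      R.P_lift, R.P_lift, R.center_eq]
    exact Φ.separator_eq v hv w hw hvw
  · unfold intervalSep
    rw [R.intervalSet_lift h hv hw hvw, R.intervalSet_lift h hw hv hvw.symm]
    exact Φ.sep_mem v hv w hw hvw

end Refinement

end RefinedCycle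

/-! ### Neighbours and trivial petals of the refinement -/

section RefinedPseudoflower

variable {V : Type u} {U : SepUniverse V} {k : ℕ}

namespace Refinement

variable {Φ : Pseudoflower U k} (R : Refinement Φ)

section Neighbours

variable [LinearOrder Φ.C] {o : Φ.C} (h : IsCutAt o)

theorem isCycSucc_mk {z : Φ.C} {c e : Fibre (R.N z) (z ∈ Φ.I)} (hce : c < e)
    (hne : ∀ f, c < f → f < e → False) :
    IsCycSucc (Refined.mk z c : R.C) (Refined.mk z e) := by
  have hlt : (Refined.mk z c : R.C) < Refined.mk z e := Refined.mk_lt_mk.2 hce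
  refine ⟨hlt.ne', fun b hb => ?_⟩
  rw [Refined.sbtw_iff'] at hb
  have h1 : Refined.mk z c < b ∧ b < Refined.mk z e := by
    rcases hb with hb | hb | hb
    · exact hb
    · exact absurd hb.2 hlt.not_gt
    · exact absurd hb.1 hlt.not_gt
  have h2 : b.base = z := le_antisymm (Refined.base_le_of_lt h1.2) (Refined.base_le_of_lt h1.1)
  obtain ⟨f, rfl⟩ := Refined.exists_mk_of_base_eq h2
  exact hne f (Refined.mk_lt_mk.1 h1.1) (Refined.mk_lt_mk.1 h1.2)

include h

theorem isCycSucc_lo {z : Φ.C} (hz : z ∈ Φ.I) {e : Fibre (R.N z) (z ∈ Φ.I)} (he : ∀ f, e ≤ f) :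
    IsCycSucc (R.lift _ (R.lo_notMem z)) (Refined.mk z e) := by
  have hne : R.lo z ≠ z := (R.succ_lo z hz).1.symm
  refine ⟨fun e' => hne (congrArg Refined.base e').symm, fun b hb => ?_⟩
  by_cases h1 : b.base = z
  · obtain ⟨f, rfl⟩ := Refined.exists_mk_of_base_eq h1
    rw [Refined.sbtw_mk_mk (by exact hne)] at hb
    exact hb.not_ge (he f)
  by_cases h2 : b.base = R.lo z
  · have : b = R.lift _ (R.lo_notMem z) := Refined.eq_lift R.subsingleton_chain _ h2
    rw [this] at hb
    exact sbtw_irrefl_left hb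
  rw [Refined.sbtw_iff_of_ne h (a := R.lift _ (R.lo_notMem z)) (c := Refined.mk z e) (Ne.symm h2)
    h1 hne.symm] at hb
  exact (R.succ_lo z hz).2 _ hb

theorem isCycSucc_hi {z : Φ.C} (hz : z ∈ Φ.I) {e : Fibre (R.N z) (z ∈ Φ.I)} (he : ∀ f, f ≤ e) :
    IsCycSucc (Refined.mk z e) (R.lift _ (R.hi_notMem z)) := by
  have hne : R.hi z ≠ z := (R.succ_hi z hz).1
  refine ⟨fun e' => hne (congrArg Refined.base e'), fun b hb => ?_⟩
  by_cases h1 : b.base = z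
  · obtain ⟨f, rfl⟩ := Refined.exists_mk_of_base_eq h1
    have hb := hb.cyclic_right
    rw [Refined.sbtw_mk_mk (by exact hne)] at hb
    exact hb.not_ge (he f)
  by_cases h2 : b.base = R.hi z
  · have : b = R.lift _ (R.hi_notMem z) := Refined.eq_lift R.subsingleton_chain _ h2
    rw [this] at hb
    exact sbtw_irrefl_right hb
  rw [Refined.sbtw_iff_of_ne h (a := Refined.mk z e) (c := R.lift _ (R.hi_notMem z)) (Ne.symm h1)
    h2 hne] at hb
  exact (R.succ_hi z hz).2 _ hb

/-- The predecessor is a cutpoint at the level of `e` itself. It lies in the same fibre unless `e`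
is the first point there, in which case it is the lift of `lo z`. `AtLevel` covers both
possibilities. -/
theorem exists_pred {z : Φ.C} (hz : z ∈ Φ.I) {e : Fibre (R.N z) (z ∈ Φ.I)} (he : e.IsPetal) :
    ∃ p, IsCycSucc p (Refined.mk z e) ∧ R.AtLevel p z e.pos := by
  have me := e.mem
  have h31 : (3 : Fin 4) ≠ 1 := by decide
  unfold FibreMem at me
  unfold Fibre.IsPetal at he
  have first : (∀ t : Fin 4, t < e.tag → ¬ FibreMem (R.N z) (z ∈ Φ.I) ⊥ t) → e.pos = ⊥ →
      ∃ p, IsCycSucc p (Refined.mk z e) ∧ R.AtLevel p z e.pos := by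
    intro ht hb
    refine ⟨_, R.isCycSucc_lo h hz fun f => not_lt.1 fun hf => ?_, hb ▸ R.atLevel_lo h z⟩
    rcases Fibre.lt_iff.1 hf with h1 | ⟨h1, h2⟩
    · rw [hb] at h1
      exact not_lt_bot h1
    · have := f.mem
      rw [h1, hb] at this
      exact ht _ h2 this
  have inner : ∀ t : Fin 4, t < e.tag → t ≠ 1 → t ≠ 3 → FibreMem (R.N z) (z ∈ Φ.I) e.pos t →
      (∀ t', t < t' → t' < e.tag → ¬ FibreMem (R.N z) (z ∈ Φ.I) e.pos t') →
      ∃ p, IsCycSucc p (Refined.mk z e) ∧ R.AtLevel p z e.pos := by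
    intro t ht h1 h3 hm hno
    refine ⟨Refined.mk z (Fibre.mk e.pos t hm), R.isCycSucc_mk (Fibre.lt_iff.2 (Or.inr ⟨rfl, ht⟩))
      fun f hf hf' => ?_, R.atLevel_mk h (c := Fibre.mk e.pos t hm) (by
        unfold Fibre.IsPetal; simp [h1, h3])⟩
    have hpos : f.pos = e.pos := le_antisymm (Fibre.pos_mono hf'.le)
      (Fibre.pos_mono (e := Fibre.mk e.pos t hm) hf.le)
    rw [Fibre.lt_iff] at hf hf'
    refine hno f.tag ?_ ?_ (hpos ▸ f.mem)
    · exact (hf.resolve_left (by rw [hpos]; exact lt_irrefl e.pos)).2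
    · exact (hf'.resolve_left (by rw [hpos]; exact lt_irrefl e.pos)).2
  unfold FibreMem at first inner
  by_cases hN : e.pos ∈ R.N z
  · by_cases h1 : e.tag = 1
    · by_cases hb : e.pos = ⊥
      · refine first (fun t ht hm => ?_) hb
        rw [h1] at ht
        grind
      · refine inner 0 (by rw [h1]; decide) (by decide) (by decide)
          (Or.inl ⟨rfl, fun _ => ⟨hb, Or.inr hN⟩⟩) (fun t' h2 h3 => ?_)
        rw [h1] at h3
        omega
    · have h3 : e.tag = 3 := he.resolve_left h1
      refine inner 2 (by rw [h3]; decide) (by decide) (by decide)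
          (Or.inr (Or.inr (Or.inl ⟨rfl, hz, hN, ?_⟩))) (fun t' h2 h3 => ?_)
      · rcases me with h' | h' | h' | h'
        · rw [h3] at h'; exact absurd h'.1 (by decide)
        · rw [h3] at h'; exact absurd h'.1 (by decide)
        · rw [h3] at h'; exact absurd h'.1 (by decide)
        · obtain ⟨m', hm'⟩ := h'.2.2
          exact (hm'.lt.trans_le le_top).ne
      · omega
  · have h3 : e.tag = 3 := by
      rcases he with h' | h'
      · rw [h'] at me
        grind
      · exact h'
    have hnt : e.pos ≠ ⊤ := by
      obtain ⟨m', hm'⟩ := R.exists_covBy h3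
      exact (hm'.lt.trans_le le_top).ne
    by_cases hb : e.pos = ⊥
    · refine first (fun t ht hm => ?_) hb
      rw [h3] at ht
      rw [hb] at hN
      grind
    · refine inner 0 (by rw [h3]; decide) (by decide) (by decide)
          (Or.inl ⟨rfl, fun _ => ⟨hb, Or.inl hnt⟩⟩) (fun t' h2 h4 h5 => ?_)
      rw [h3] at h4
      grind

/-- A trivial petal has its successor at its own level, and a jump has it at the upper member of the
jump. At the top of the fibre the removed cutpoint is replaced by the lift of `hi z`. -/
theorem exists_succ {z : Φ.C} (hz : z ∈ Φ.I) {e : Fibre (R.N z) (z ∈ Φ.I)} (he : e.IsPetal) :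
    ∃ s r, IsCycSucc (Refined.mk z e) s ∧ R.AtLevel s z r ∧
      ((e.tag = 1 ∧ r = e.pos) ∨ (e.tag = 3 ∧ e.pos ⋖ r)) := by
  have me := e.mem
  unfold FibreMem at me
  rcases he with h1 | h3
  · have hN : e.pos ∈ R.N z := by
      rw [h1] at me
      grind
    by_cases ht : e.pos = ⊤
    · refine ⟨_, ⊤, R.isCycSucc_hi h hz fun f => not_lt.1 fun hf => ?_, R.atLevel_hi h z,
        Or.inl ⟨h1, ht.symm⟩⟩
      rcases Fibre.lt_iff.1 hf with h' | ⟨h', h2⟩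
      · rw [ht] at h'
        exact not_top_lt h'
      · have mf := f.mem
        unfold FibreMem at mf
        rw [← h', ht] at mf
        rw [h1] at h2
        have : ¬ ∃ m' : (R.chain z).M, ⊤ ⋖ m' := fun ⟨m', hm'⟩ => not_top_lt hm'.lt
        grind
    · have hm : FibreMem (R.N z) (z ∈ Φ.I) e.pos 2 := fibreMem_cut' hz hN ht
      refine ⟨Refined.mk z (Fibre.mk e.pos 2 hm), e.pos, R.isCycSucc_mk (Fibre.lt_iff.2
        (Or.inr ⟨rfl, by rw [h1, Fibre.tag_mk]; decide⟩)) fun f hf hf' => ?_,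
        R.atLevel_mk h (c := Fibre.mk e.pos 2 hm) (by unfold Fibre.IsPetal; simp),
        Or.inl ⟨h1, rfl⟩⟩
      have hpos : f.pos = e.pos := le_antisymm
        (Fibre.pos_mono (f := Fibre.mk e.pos 2 hm) hf'.le) (Fibre.pos_mono hf.le)
      rw [Fibre.lt_iff] at hf hf'
      have h2 := (hf.resolve_left (by rw [hpos]; exact lt_irrefl e.pos)).2
      have h3 : f.tag < 2 := (hf'.resolve_left (by rw [hpos]; exact lt_irrefl e.pos)).2
      rw [h1] at h2
      omega
  · obtain ⟨m', hm'⟩ := R.exists_covBy h3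
    have after : ∀ f, e < f → m' ≤ f.pos := by
      intro f hf
      rcases Fibre.lt_iff.1 hf with h' | ⟨h', h2⟩
      · exact hm'.ge_of_gt h'
      · rw [h3] at h2
        have := f.tag.le_last
        exact absurd h2 (not_lt.2 this)
    by_cases ht : m' = ⊤ ∧ m' ∉ R.N z
    · obtain ⟨rfl, hN⟩ := ht
      refine ⟨_, ⊤, R.isCycSucc_hi h hz fun f => not_lt.1 fun hf => ?_, R.atLevel_hi h z,
        Or.inr ⟨h3, hm'⟩⟩
      have hf' := top_le_iff.1 (after f hf)
      have mf := f.mem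
      unfold FibreMem at mf
      rw [hf'] at mf
      have : ¬ ∃ m' : (R.chain z).M, ⊤ ⋖ m' := fun ⟨m', hm'⟩ => not_top_lt hm'.lt
      grind
    · have hm : FibreMem (R.N z) (z ∈ Φ.I) m' 0 := fibreMem_cut fun _ =>
        ⟨(bot_le.trans_lt hm'.lt).ne', by tauto⟩
      refine ⟨Refined.mk z (Fibre.mk m' 0 hm), m', R.isCycSucc_mk (Fibre.lt_iff.2
        (Or.inl hm'.lt)) fun f hf hf' => ?_,
        R.atLevel_mk h (c := Fibre.mk m' 0 hm) (by unfold Fibre.IsPetal; simp),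
        Or.inr ⟨h3, hm'⟩⟩
      rcases Fibre.lt_iff.1 hf' with h' | ⟨-, h'⟩
      · exact (after f hf).not_gt h'
      · exact Fin.not_lt_zero _ h'

end Neighbours

/-- The doubled points contain every separator exactly once, and the old trivial petals. -/
structure IsSelective : Prop where
  unique : ∀ z ∈ Φ.I, ∀ z' ∈ Φ.I, ∀ m ∈ R.N z, ∀ m' ∈ R.N z', R.inner z m = R.inner z' m' →
    (⟨z, m⟩ : Σ z, (R.chain z).M) = ⟨z', m'⟩
  exists_eq : ∀ z ∈ Φ.I, ∀ m, ∃ z' ∈ Φ.I, ∃ m' ∈ R.N z', R.inner z' m' = R.inner z m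
  bot_mem : ∀ z ∈ Φ.I, (⊥ : (R.chain z).M) = ⊤ → ⊥ ∈ R.N z

/-- The selected level with the same separator lies over some z', so the separator is contained in
`P z'`. If z' ≠ z, then `P z'` lies in `A ⊥` or in `B ⊤`, so the separator is contained in the
bottom or top one and equals it by size. This contradicts that it occurs only once in the chain. -/
theorem IsSelective.mem_N {R : Refinement Φ} (hR : R.IsSelective) {z : Φ.C} (hz : z ∈ Φ.I)
    {n : (R.chain z).M} (hb : n ≠ ⊥) (ht : n ≠ ⊤)
    (hn : ∀ n', n' ≠ n → R.inner z n' ≠ R.inner z n) : n ∈ R.N z := by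
  obtain ⟨z', hz', m', hm', e⟩ := hR.exists_eq z hz n
  have hch := R.isLimitChain z
  have hsub : R.inner z n ⊆ Φ.P z' := e ▸ R.inner_subset_petal z' m'
  rcases R.mem_cycIcc_cover z z' with h | rfl | h
  · refine absurd (hch.innerSep_eq_of_subset (m := n) (n := ⊥) fun x hx => ?_).symm (hn ⊥ hb.symm)
    refine ⟨⟨?_, hch.anti bot_le hx.1.2⟩, hx.2⟩
    rw [A_bot]
    exact subset_intervalSet h (hsub hx)
  · by_cases hmn : m' = n
    · exact hmn ▸ hm'
    · exact absurd e (hn m' hmn)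
  · refine absurd (hch.innerSep_eq_of_subset (m := n) (n := ⊤) fun x hx => ?_).symm (hn ⊤ ht.symm)
    refine ⟨⟨hch.mono le_top hx.1.1, ?_⟩, hx.2⟩
    rw [B_top]
    exact subset_intervalSet h (hsub hx)

theorem encard_inner (z : Φ.C) (m : (R.chain z).M) :
    2 * (R.inner z m).encard + (center Φ.P).encard = k := by
  obtain ⟨l, x, hl, hx, hlx⟩ := Φ.exists_nat_card
  have h1 := (R.isLimitChain z).encard_innerSep m
  have h2 : (R.Z z).encard = (l + x : ℕ) := by
    rw [encard_union_eq (Φ.disjoint_center _), hl _ (R.base_notMem z), hx]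
    rfl
  have h3 := encard_ne_top_iff.2 ((R.isLimitChain z).finite_innerSep m)
  obtain ⟨n, hn⟩ := ENat.ne_top_iff_exists.1 h3
  rw [h2, ← hn] at h1
  rw [← hn, hx]
  norm_cast at h1 ⊢
  omega

theorem encard_Z_add {z : Φ.C} {S : Set V} (hS : 2 * S.encard + (center Φ.P).encard = k) :
    S.encard + (R.Z z).encard = k := by
  obtain ⟨l, x, hl, hx, hlx⟩ := Φ.exists_nat_card
  have h2 : (R.Z z).encard = (l + x : ℕ) := by
    rw [encard_union_eq (Φ.disjoint_center _), hl _ (R.base_notMem z), hx]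
    rfl
  have h3 : S.encard ≠ ⊤ := by
    intro e
    rw [e, ENat.mul_top (by norm_num), top_add] at hS
    exact ENat.top_ne_natCast k hS
  obtain ⟨n, hn⟩ := ENat.ne_top_iff_exists.1 h3
  rw [hx, ← hn] at hS
  rw [h2, ← hn]
  norm_cast at hS ⊢
  omega

end Refinement

end RefinedPseudoflower

/-! ### The refined pseudoflower and its maximality -/

section Main

variable {V : Type u} {U : SepUniverse V} {k : ℕ}

namespace Refinement

variable {Φ : Pseudoflower U k} (R : Refinement Φ)

theorem exists_petal_over (hR : R.IsSelective) {z : Φ.C} (hz : z ∈ Φ.I) :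
    ∃ i ∈ Refined.petals Φ.I R.N, i.base = z := by
  obtain ⟨e, he⟩ := Fibre.exists_petal hz (fun m m' hm => (R.isLimitChain z).jump_or_doubled
    (fun n hb ht hn => hR.mem_N hz hb ht hn) hm) (hR.bot_mem z hz)
  exact ⟨Refined.mk z e, he, rfl⟩

theorem card_cut {c : R.C} (hc : c ∉ Refined.petals Φ.I R.N) :
    2 * (R.P c).encard + (center R.P).encard = k := by
  obtain ⟨z, e, rfl⟩ := Refined.exists_mk c
  rw [R.P_of_ne (e := e) (fun h => hc (Or.inr h)), R.center_eq]
  exact R.encard_inner z _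

/-- A jump petal is strictly larger than a cutpoint set, by `jump_nontrivial`. So both petals are
inserted trivial petals, and the selection uses each set once. -/
theorem star (hR : R.IsSelective) {i j : R.C} (hi : i ∈ Refined.petals Φ.I R.N)
    (hj : j ∈ Refined.petals Φ.I R.N) (hcard : 2 * (R.P i).encard + (center R.P).encard = k)
    (hij : R.P i = R.P j) : i = j := by
  have key : ∀ i ∈ Refined.petals Φ.I R.N, 2 * (R.P i).encard + (center R.P).encard = k →
      ∃ z ∈ Φ.I, ∃ e : Fibre (R.N z) (z ∈ Φ.I), i = Refined.mk z e ∧ e.tag = 1 ∧ e.pos ∈ R.N z := by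
    intro i hi hcard
    obtain ⟨z, e, rfl⟩ := Refined.exists_mk i
    have hz : z ∈ Φ.I := Refined.base_mem_of_mem_petals hi
    have h1 : e.tag = 1 := by
      refine (show e.tag = 1 ∨ e.tag = 3 from hi).resolve_right fun h3 => ?_
      obtain ⟨m', hm⟩ := R.exists_covBy h3
      rw [R.P_of_covBy h3 hm, R.center_eq] at hcard
      exact (R.isLimitChain z).jump_nontrivial hm.lt (R.encard_Z_add hcard)
    have me := e.mem
    unfold FibreMem at me
    rw [h1] at me
    refine ⟨z, hz, e, rfl, h1, ?_⟩
    grind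
  obtain ⟨z, hz, e, rfl, he, heN⟩ := key i hi hcard
  obtain ⟨w, hw, f, rfl, hf, hfN⟩ := key j hj (hij ▸ hcard)
  rw [R.P_of_ne (by rw [he]; decide), R.P_of_ne (by rw [hf]; decide)] at hij
  have := hR.unique z hz w hw _ heN _ hfN hij
  obtain rfl : z = w := congrArg Sigma.fst this
  have h2 : e.pos = f.pos := eq_of_heq (Sigma.mk.inj this).2
  rw [Fibre.ext_iff.2 ⟨h2, he.trans hf.symm⟩]

variable [LinearOrder Φ.C] {o : Φ.C} (h : IsCutAt o)
include h

theorem isCycleCompletion_petals (hR : R.IsSelective) (ho : o ∉ Φ.I) :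
    IsCycleCompletion (Refined.petals Φ.I R.N) := by
  have hI := Φ.isLinCompletion h ho
  exact (Refined.isLinCompletion h hI R.subsingleton_chain
    (fun z hz m m' hm => (R.isLimitChain z).jump_or_doubled
      (fun n hb ht hn => hR.mem_N hz hb ht hn) hm) hR.bot_mem
    (fun z _ S hS => by
      obtain ⟨s, hs, -⟩ := (R.isLimitChain z).sup S hS
      exact ⟨s, hs⟩)).isCycleCompletion (Refined.isCutAt h R.subsingleton_chain ho)

theorem pred_subset {i : R.C} (hi : i ∈ Refined.petals Φ.I R.N) {p : R.C} (hp : IsCycSucc p i) :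
    R.P p ⊆ R.P i := by
  obtain ⟨z, e, rfl⟩ := Refined.exists_mk i
  have hz : z ∈ Φ.I := Refined.base_mem_of_mem_petals hi
  obtain ⟨q, hq, hqz⟩ := R.exists_pred h hz (e := e) hi
  rw [hp.pred_unique hq, hqz.eq_inner]
  by_cases h3 : e.tag = 3
  · obtain ⟨m', hm⟩ := R.exists_covBy h3
    rw [R.P_of_covBy h3 hm]
    exact (R.isLimitChain z).innerSep_subset_jump_left hm.lt.le
  · rw [R.P_of_ne h3]

theorem succ_subset {i : R.C} (hi : i ∈ Refined.petals Φ.I R.N) {s : R.C} (hs : IsCycSucc i s) :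
    R.P s ⊆ R.P i := by
  obtain ⟨z, e, rfl⟩ := Refined.exists_mk i
  have hz : z ∈ Φ.I := Refined.base_mem_of_mem_petals hi
  obtain ⟨q, r, hq, hqz, hr⟩ := R.exists_succ h hz (e := e) hi
  rw [hs.succ_unique hq, hqz.eq_inner]
  rcases hr with ⟨h1, rfl⟩ | ⟨h3, hr⟩
  · rw [R.P_of_ne (by rw [h1]; decide)]
  · rw [R.P_of_covBy h3 hr]
    exact (R.isLimitChain z).innerSep_subset_jump_right hr.lt.le

/-- The refined pseudoflower. -/
noncomputable def toPseudoflower (hR : R.IsSelective) (ho : o ∉ Φ.I)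
    (hgood : ∀ c ∉ Refined.petals Φ.I R.N, ∀ d ∉ Refined.petals Φ.I R.N, c ≠ d →
      IsGoodPair U R.P c d) : Pseudoflower U k where
  C := R.C
  I := Refined.petals Φ.I R.N
  nontrivial := by
    obtain ⟨i, hi, j, hj, hij⟩ := Φ.nontrivial
    obtain ⟨a, ha, rfl⟩ := R.exists_petal_over hR hi
    obtain ⟨b, hb, rfl⟩ := R.exists_petal_over hR hj
    exact ⟨a, ha, b, hb, fun e => hij (congrArg Refined.base e)⟩
  completion := R.isCycleCompletion_petals h hR ho
  P := R.P
  card_cut _ hv := R.card_cut hv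
  sep_mem v hv w hw hvw := (hgood v hv w hw hvw).2
  sep_order v hv w hw hvw := by
    unfold sepOrder intervalSep
    rw [separatesAt_iff.1 (hgood v hv w hw hvw).1, ← R.card_cut hv, two_mul]
    have h2 : (R.P v).encard = (R.P w).encard := by
      have e1 := R.card_cut hv
      have e2 := R.card_cut hw
      rw [R.center_eq] at e1 e2
      have e1 := R.encard_Z_add (z := v.base) e1
      rw [← R.encard_Z_add (z := v.base) e2] at e1
      exact WithTop.add_right_cancel ((R.isLimitChain v.base).finite_base v.fib.pos) e1
    refine (encard_union_le _ _).trans ?_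
    gcongr
    refine (encard_union_le _ _).trans ?_
    rw [h2]
  separator_eq v hv w hw hvw := separatesAt_iff.1 (hgood v hv w hw hvw).1
  pred_subset _ hi _ hp := R.pred_subset h hi hp
  succ_subset _ hi _ hs := R.succ_subset h hi hs
  star _ hi _ hj hc hij := R.star hR hi hj hc hij

theorem extends_toPseudoflower (hR : R.IsSelective) (ho : o ∉ Φ.I)
    (hgood : ∀ c ∉ Refined.petals Φ.I R.N, ∀ d ∉ Refined.petals Φ.I R.N, c ≠ d →
      IsGoodPair U R.P c d) : Φ.Extends (R.toPseudoflower h hR ho hgood) := by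
  refine ⟨R.center_eq.symm, (Refined.base : R.C → Φ.C), fun z => ?_,
    Refined.cycMonotone_base h, ?_, fun v hv w hw => ?_⟩
  · by_cases hz : z ∈ Φ.I
    · obtain ⟨i, -, hi⟩ := R.exists_petal_over hR hz
      exact ⟨i, hi⟩
    · exact ⟨R.lift z hz, rfl⟩
  · ext z
    constructor
    · rintro ⟨i, hi, rfl⟩
      exact Refined.base_mem_of_mem_petals hi
    · intro hz
      obtain ⟨i, hi, hiz⟩ := R.exists_petal_over hR hz
      exact ⟨i, hi, hiz⟩
  · ext x
    rw [R.intervalSet_eq hv hw, mem_union, mem_iUnion₂]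
    simp only [exists_prop]
    exact Iff.rfl

theorem isLeMaximal_toPseudoflower (hR : R.IsSelective) (ho : o ∉ Φ.I)
    (hgood : ∀ c ∉ Refined.petals Φ.I R.N, ∀ d ∉ Refined.petals Φ.I R.N, c ≠ d →
      IsGoodPair U R.P c d) : (R.toPseudoflower h hR ho hgood).IsLeMaximal := by
  refine Pseudoflower.isLeMaximal_of_saturated _ fun (j : R.C) hj (p : R.C) hp (s : R.C) hs hpj hjs
    => ?_
  change j ∈ Refined.petals Φ.I R.N at hj
  obtain ⟨z, e, rfl⟩ := Refined.exists_mk j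
  have hz : z ∈ Φ.I := Refined.base_mem_of_mem_petals hj
  obtain ⟨q, hq, lq⟩ := R.exists_pred h hz (e := e) hj
  obtain rfl : p = q := IsCycSucc.pred_unique (C := R.C) hpj hq
  obtain ⟨t, r, ht, lr, hr⟩ := R.exists_succ h hz (e := e) hj
  obtain rfl : s = t := IsCycSucc.succ_unique (C := R.C) hjs ht
  have trivialPetal : ∀ m, ∃ i ∈ Refined.petals Φ.I R.N, R.P i = R.inner z m := by
    intro m
    obtain ⟨z', hz', m', hm', e⟩ := hR.exists_eq z hz m
    refine ⟨Refined.mk z' (Fibre.mk m' 1 (fibreMem_trivial hz' hm')), Or.inl rfl, ?_⟩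
    rw [R.P_of_ne (by rw [Fibre.tag_mk]; decide)]
    exact e
  have e1 : intervalSep R.P (R.baseLift z) p = (R.A z e.pos, R.B z e.pos) :=
    Prod.ext lq.left lq.right
  have e2 : intervalSep R.P (R.baseLift z) s = (R.A z r, R.B z r) := Prod.ext lr.left lr.right
  have hch := R.isLimitChain z
  refine ⟨⟨R.baseLift z, Refined.lift_notMem _ _, lq.ne, lr.ne, ?_, ?_, ?_⟩, ?_, ?_⟩
  · change _ ≤ sepOrder (intervalSep R.P (R.baseLift z) p)
    rw [e1]
    exact (hch.card _).ge
  · change _ ≤ sepOrder (intervalSep R.P (R.baseLift z) s)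
    rw [e2]
    exact (hch.card _).ge
  · change ∀ t ∈ U.seps, sepOrder t ≤ k → SepLE (intervalSep R.P (R.baseLift z) p) t →
      SepLE t (intervalSep R.P (R.baseLift z) s) → t = intervalSep R.P (R.baseLift z) p ∨
        t = intervalSep R.P (R.baseLift z) s
    rw [e1, e2]
    intro t htU hto h1 h2
    have mono : ∀ m m', m ≤ m' → SepLE (R.A z m, R.B z m) (R.A z m', R.B z m') := fun m m' hm =>
      ⟨hch.mono hm, hch.anti hm⟩
    -- No member of the chain lies strictly between the two levels that bound a petal. So a
    -- separation between these two is comparable with the whole chain and belongs to it.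
    have hcases : ∀ m, m ≤ e.pos ∨ r ≤ m := by
      intro m
      rcases hr with ⟨-, rfl⟩ | ⟨-, hr⟩
      · exact le_total m _
      · exact (le_or_gt m e.pos).imp_right hr.ge_of_gt
    obtain ⟨m, rfl⟩ := (R.chain z).maximal t htU hto
      (by rw [← (R.chain z).bot_eq]; exact (mono _ _ bot_le).trans h1)
      (by rw [← (R.chain z).top_eq]; exact h2.trans (mono _ _ le_top))
      (fun m => (hcases m).symm.imp (fun hm => h2.trans (mono _ _ hm))
        (fun hm => (mono _ _ hm).trans h1))
    rcases hcases m with hm | hm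
    · exact Or.inl ((mono _ _ hm).antisymm h1)
    · exact Or.inr (h2.antisymm (mono _ _ hm))
  · obtain ⟨i, hi, hP⟩ := trivialPetal e.pos
    exact ⟨i, hi, hP.trans lq.eq_inner.symm⟩
  · obtain ⟨i, hi, hP⟩ := trivialPetal r
    exact ⟨i, hi, hP.trans lr.eq_inner.symm⟩

theorem isGoodPair_of_base {u : Φ.C} (hu : u ∉ Φ.I) {c : R.C}
    (hc : c ∉ Refined.petals Φ.I R.N) (hcu : R.base c.base = u) :
    IsGoodPair U R.P (R.lift u hu) c := by
  subst hcu
  obtain ⟨z, e, rfl⟩ := Refined.exists_mk c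
  exact (R.atLevel_mk h hc).isGoodPair

/-- Bases are assigned on half-open arcs, so the right end of each closed arc has a different base.
That end is an old cutpoint, and its separation from the required base is inherited from `Φ`. -/
theorem isGoodPair (ho : o ∉ Φ.I) {u₂ u₃ : Φ.C} (hu₂ : u₂ ∉ Φ.I) (hu₃ : u₃ ∉ Φ.I) (h12 : o < u₂)
    (h23 : u₂ < u₃) (d12 : Disjoint (Φ.P o) (Φ.P u₂)) (d23 : Disjoint (Φ.P u₂) (Φ.P u₃))
    (d31 : Disjoint (Φ.P u₃) (Φ.P o)) (b1 : ∀ z, z < u₂ → R.base z = u₃)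
    (b2 : ∀ z, u₂ ≤ z → z < u₃ → R.base z = o) (b3 : ∀ z, u₃ ≤ z → R.base z = u₂)
    {c d : R.C} (hc : c ∉ Refined.petals Φ.I R.N) (hd : d ∉ Refined.petals Φ.I R.N)
    (hcd : c ≠ d) : IsGoodPair U R.P c d := by
  have h13 := h12.trans h23
  refine isGoodPair_of_three_bases (u₁ := R.lift o ho) (u₂ := R.lift u₂ hu₂)
    (u₃ := R.lift u₃ hu₃) (Refined.petals Φ.I R.N)ᶜ
    (Refined.cycMonotone_base h _ _ _ ((h.sbtw_iff _ _ _).2 (Or.inl ⟨h12, h23⟩)))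
    (Refined.lift_notMem _ _) (Refined.lift_notMem _ _) (Refined.lift_notMem _ _)
    (by rwa [P_lift, P_lift]) (by rwa [P_lift, P_lift]) (by rwa [P_lift, P_lift])
    (fun c hc hcI => ?_) (fun c hc hcI => ?_) (fun c hc hcI => ?_) hc hd hcd
  · rw [R.mem_cycIcc_lift h ho hu₂ h12.ne, h.mem_cycIcc] at hcI
    by_cases hcu : c.base = u₂
    · rw [Refined.eq_lift R.subsingleton_chain hu₂ hcu]
      exact R.isGoodPair_lift h _ _ h23.ne'
    · refine R.isGoodPair_of_base h _ hc (b1 _ ?_)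
      grind
  · rw [R.mem_cycIcc_lift h hu₂ hu₃ h23.ne, h.mem_cycIcc] at hcI
    by_cases hcu : c.base = u₃
    · rw [Refined.eq_lift R.subsingleton_chain hu₃ hcu]
      exact R.isGoodPair_lift h _ _ h13.ne
    · refine R.isGoodPair_of_base h _ hc (b2 _ ?_ ?_) <;> grind
  · rw [R.mem_cycIcc_lift h hu₃ ho h13.ne', h.mem_cycIcc] at hcI
    by_cases hcu : c.base = o
    · rw [Refined.eq_lift R.subsingleton_chain ho hcu]
      exact R.isGoodPair_lift h _ _ h12.ne'
    · refine R.isGoodPair_of_base h _ hc (b3 _ ?_)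
      have := h.bot_le c.base
      grind

end Refinement

/-- Chooses one level for each set that occurs. Petals whose chain is a single member have priority,
as a trivial petal is the only petal that their fibre can contain. -/
theorem Refinement.exists_isSelective {Φ : Pseudoflower U k} (R : Refinement Φ) :
    ∃ N, ({ R with N := N } : Refinement Φ).IsSelective := by
  classical
  let p : (Σ z, (R.chain z).M) → Set V → Prop := fun a Q => a.1 ∈ Φ.I ∧ R.inner a.1 a.2 = Q
  have hch : ∀ Q, ∃ a, (∃ b, p b Q) → p a Q ∧
      ∀ z, z ∈ Φ.I → (⊥ : (R.chain z).M) = ⊤ → R.inner z ⊥ = Q → a = ⟨z, ⊥⟩ := by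
    intro Q
    by_cases ht : ∃ z, z ∈ Φ.I ∧ (⊥ : (R.chain z).M) = ⊤ ∧ R.inner z ⊥ = Q
    · obtain ⟨z, hz, hbt, hQ⟩ := ht
      refine ⟨⟨z, ⊥⟩, fun _ => ⟨⟨hz, hQ⟩, fun w hw hbt' hQ' => ?_⟩⟩
      -- The priorities cannot conflict: a petal with a one-member chain is equal to its separator,
      -- so `Φ.star` allows only one such petal for each set.
      have petal : ∀ z ∈ Φ.I, (⊥ : (R.chain z).M) = ⊤ → R.inner z ⊥ = Q → Φ.P z = Q := by
        intro z hz hbt hQ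
        have := subsingleton_of_bot_eq_top hbt
        refine Subset.antisymm (fun x hx => ?_) (hQ ▸ R.inner_subset_petal z ⊥)
        rcases R.petal_subset z hx with ⟨m, hm⟩ | ⟨n, n', hn, -⟩
        · rw [Subsingleton.elim m ⊥, hQ] at hm
          exact hm
        · exact absurd (Subsingleton.elim n n') hn.lt.ne
      have e1 := petal z hz hbt hQ
      have e2 := petal w hw hbt' hQ'
      obtain rfl : z = w := Φ.star z hz w hw (by rw [e1, ← hQ]; exact R.encard_inner z ⊥)
        (e1.trans e2.symm)
      rfl
    · obtain ⟨i, hi, -⟩ := Φ.nontrivial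
      by_cases hb : ∃ b, p b Q
      · obtain ⟨b, hb⟩ := hb
        exact ⟨b, fun _ => ⟨hb, fun z hz h1 h2 => absurd ⟨z, hz, h1, h2⟩ ht⟩⟩
      · exact ⟨⟨i, ⊥⟩, fun h => absurd h hb⟩
  choose f hf using hch
  refine ⟨fun z => {m | f (R.inner z m) = ⟨z, m⟩}, ⟨?_, ?_, ?_⟩⟩
  · intro z hz z' hz' m hm m' hm' e
    have h1 : f (R.inner z m) = ⟨z, m⟩ := hm
    have h2 : f (R.inner z' m') = ⟨z', m'⟩ := hm'
    have e' : R.inner z m = R.inner z' m' := e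
    rw [← h1, ← h2, e']
  · intro z hz m
    obtain ⟨⟨h1, h2⟩, -⟩ := hf (R.inner z m) ⟨⟨z, m⟩, hz, rfl⟩
    refine ⟨(f (R.inner z m)).1, h1, (f (R.inner z m)).2, ?_, h2⟩
    change f (R.inner (f (R.inner z m)).1 (f (R.inner z m)).2) = _
    rw [h2]
  · intro z hz hbt
    exact (hf (R.inner z ⊥) ⟨⟨z, ⊥⟩, hz, rfl⟩).2 z hz hbt rfl

/-- Every element gets the base opposite to its arc. The chain of a petal then runs between two
separations inside a rigid range, which is what `exists_sepChain` needs. -/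
theorem Pseudoflower.exists_refinement {Φ : Pseudoflower U k} (hU : U.LimitClosed)
    [LinearOrder Φ.C] {o : Φ.C} (h : IsCutAt o) (ho : o ∉ Φ.I) {u₂ u₃ : Φ.C} (hu₂ : u₂ ∉ Φ.I)
    (hu₃ : u₃ ∉ Φ.I) (h12 : o < u₂) (h23 : u₂ < u₃) (r12 : Φ.IsRigid u₃ o u₂)
    (r23 : Φ.IsRigid o u₂ u₃) (r31 : Φ.IsRigid u₂ u₃ o) :
    ∃ R : Refinement Φ, (∀ z, z < u₂ → R.base z = u₃) ∧
      (∀ z, u₂ ≤ z → z < u₃ → R.base z = o) ∧ ∀ z, u₃ ≤ z → R.base z = u₂ := by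
  have hlo : ∀ z, ∃ p ∉ Φ.I, (z ∉ Φ.I → p = z) ∧ (z ∈ Φ.I → IsCycSucc p z) := by
    intro z
    by_cases hz : z ∈ Φ.I
    · obtain ⟨p, hp, hpz⟩ := Φ.exists_pred hz
      exact ⟨p, hp, fun h => absurd hz h, fun _ => hpz⟩
    · exact ⟨z, hz, fun _ => rfl, fun h => absurd h hz⟩
  have hhi : ∀ z, ∃ p ∉ Φ.I, (z ∉ Φ.I → p = z) ∧ (z ∈ Φ.I → IsCycSucc z p) := by
    intro z
    by_cases hz : z ∈ Φ.I
    · obtain ⟨p, hp, hpz⟩ := Φ.exists_succ hz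
      exact ⟨p, hp, fun h => absurd hz h, fun _ => hpz⟩
    · exact ⟨z, hz, fun _ => rfl, fun h => absurd h hz⟩
  choose lo lo1 lo2 lo3 using hlo
  choose hi hi1 hi2 hi3 using hhi
  have sub : ∀ a b c d : Φ.C, (∀ w, w ∈ cycIcc a b → w ∈ cycIcc c d) →
      (∀ w, w ∈ cycIcc d c → w ∈ cycIcc b a) →
      SepLE (intervalSep Φ.P a b) (intervalSep Φ.P c d) := fun a b c d h1 h2 =>
    ⟨intervalSet_mono h1, intervalSet_mono h2⟩
  have arc : ∀ u v w : Φ.C, u ∉ Φ.I → v ∉ Φ.I → w ∉ Φ.I → sbtw u v w → Φ.IsRigid u v w →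
      ∀ z ∈ cycIcc v w, z ≠ w → u ≠ lo z ∧ u ≠ hi z ∧
        Nonempty (SepChain U k (intervalSep Φ.P u (lo z)) (intervalSep Φ.P u (hi z))
          (Φ.P u ∪ center Φ.P)) := by
    intro u v w hu hv hw huvw hr z hz hzw
    obtain ⟨_, h⟩ := exists_isCutAt u
    have hp : u < v ∧ v < w ∧ v ≤ lo z ∧ lo z ≤ hi z ∧ hi z ≤ w := by
      have b1 := h.bot_le v
      have b2 := h.bot_le w
      have b3 := h.bot_le z
      have b4 := h.bot_le (lo z)
      have b5 := h.bot_le (hi z)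
      rw [h.sbtw_iff] at huvw
      rw [h.mem_cycIcc] at hz
      by_cases hzI : z ∈ Φ.I
      · have q1 := (lo3 z hzI).2 v
        have q2 := (hi3 z hzI).2 w
        have q3 := (hi3 z hzI).1
        have q4 := (lo3 z hzI).1
        have n1 : z ≠ v := fun e => hv (e ▸ hzI)
        rw [h.sbtw_iff] at q1 q2
        clear lo3 hi3 lo2 hi2 hr sub
        have : u < v ∧ v < z ∧ z < w := by grind
        have : lo z < z := by grind
        have : z < hi z := by grind
        grind
      · rw [lo2 z hzI, hi2 z hzI]
        grind
    obtain ⟨p1, p2, p3, p4, p5⟩ := hp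
    have n1 : u < lo z := p1.trans_le p3
    have n2 : u < hi z := n1.trans_le p4
    have mono : ∀ a b, u < a → a ≤ b →
        SepLE (intervalSep Φ.P u a) (intervalSep Φ.P u b) := by
      intro a b ha hab
      refine sub _ _ _ _ (fun y hy => ?_) (fun y hy => ?_)
      · have := h.bot_le y
        rw [h.mem_cycIcc] at *
        grind
      · have := h.bot_le y
        rw [h.mem_cycIcc] at *
        grind
    refine ⟨n1.ne, n2.ne, exists_sepChain hU (Φ.sep_mem u hu _ (lo1 z) n1.ne)
      (Φ.sep_mem u hu _ (hi1 z) n2.ne) (mono _ _ n1 p4) (Φ.sep_order u hu _ (lo1 z) n1.ne)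
      (Φ.sep_order u hu _ (hi1 z) n2.ne) (fun s hs h1 h2 => ?_) ?_ ?_⟩
    · exact hr s hs ((mono _ _ p1 p3).trans h1) (h2.trans (mono _ _ n2 p5))
    · exact union_subset (subset_intervalSet (left_mem_cycIcc _ _)) (center_subset_intervalSet _ _)
    · exact union_subset (subset_intervalSet (right_mem_cycIcc _ _)) (center_subset_intervalSet _ _)
  have h13 := h12.trans h23
  have a12 := arc u₃ o u₂ hu₃ ho hu₂ ((h.sbtw_iff _ _ _).2 (by grind)) r12
  have a23 := arc o u₂ u₃ ho hu₂ hu₃ ((h.sbtw_iff _ _ _).2 (by grind)) r23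
  have a31 := arc u₂ u₃ o hu₂ hu₃ ho ((h.sbtw_iff _ _ _).2 (by grind)) r31
  have hbase : ∀ z, ∃ u ∉ Φ.I, (z < u₂ → u = u₃) ∧ (u₂ ≤ z → z < u₃ → u = o) ∧
      (u₃ ≤ z → u = u₂) ∧ u ≠ lo z ∧ u ≠ hi z ∧
        Nonempty (SepChain U k (intervalSep Φ.P u (lo z)) (intervalSep Φ.P u (hi z))
          (Φ.P u ∪ center Φ.P)) := by
    intro z
    have hoz := h.bot_le z
    rcases lt_or_ge z u₂ with h1 | h1
    · exact ⟨u₃, hu₃, fun _ => rfl, fun h => absurd h1 h.not_gt,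
        fun h => absurd (h1.trans h23) h.not_gt, a12 z (by rw [h.mem_cycIcc]; grind) h1.ne⟩
    rcases lt_or_ge z u₃ with h2 | h2
    · exact ⟨o, ho, fun h => absurd h h1.not_gt, fun _ _ => rfl, fun h => absurd h2 h.not_gt,
        a23 z (by rw [h.mem_cycIcc]; grind) h2.ne⟩
    · exact ⟨u₂, hu₂, fun h => absurd h h1.not_gt, fun _ h => absurd h h2.not_gt, fun _ => rfl,
        a31 z (by rw [h.mem_cycIcc]; grind) (h13.trans_le h2).ne'⟩
  choose base base1 b1 b2 b3 base2 base3 ch using hbase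
  exact ⟨{ lo := lo, hi := hi, base := base, lo_notMem := lo1, hi_notMem := hi1,
           base_notMem := base1, lo_eq := lo2, hi_eq := hi2, succ_lo := lo3, succ_hi := hi3,
           base_ne_lo := base2, base_ne_hi := base3, chain := fun z => (ch z).some,
           N := fun _ => ∅ }, b1, b2, b3⟩

end Main

end PseudoFlower

open PseudoFlower in
theorem mainTheorem2 {V : Type u} (U : PseudoFlower.SepUniverse V) (hU : U.LimitClosed) (k : ℕ)
    (Φ : PseudoFlower.Pseudoflower U k) (T : Fin 3 → Set (Set V × Set V))
    (hT : ∀ a, U.IsTangle (k + 1) (T a))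
    (hΦ : ∀ a b, a ≠ b → Φ.Distinguishes (T a) (T b))
    (hk : ∀ a b, T a ∩ U.sepsLT k = T b ∩ U.sepsLT k) :
    ∃ Ψ : PseudoFlower.Pseudoflower U k, Ψ.IsLeMaximal ∧ Φ.Extends Ψ := by
  obtain ⟨o, ho, u₂, hu₂, u₃, hu₃, hcyc, r12, r23, r31⟩ := Φ.exists_rigid_bases T hT hΦ hk
  obtain ⟨_, h⟩ := exists_isCutAt o
  have hlt : o < u₂ ∧ u₂ < u₃ := by
    rw [h.sbtw_iff] at hcyc
    have := h.bot_le u₂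
    have := h.bot_le u₃
    grind
  obtain ⟨h12, h23⟩ := hlt
  have h13 := h12.trans h23
  -- Rigidity is applied to S(u, v) itself, the lower end of its range.
  have rigid : ∀ u v w : Φ.C, u ∉ Φ.I → v ∉ Φ.I → u ≠ v → sbtw u v w → Φ.IsRigid u v w →
      Disjoint (Φ.P u) (Φ.P v) := by
    intro u v w hu hv huv huvw hr
    refine Φ.disjoint_of_le_order hu hv huv (hr _ (Φ.sep_mem u hu v hv huv) (SepLE.refl _) ?_)
    obtain ⟨_, h⟩ := exists_isCutAt u
    rw [h.sbtw_iff] at huvw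
    constructor <;> refine intervalSet_mono fun y hy => ?_ <;>
      rw [h.mem_cycIcc] at * <;> have := h.bot_le y <;> have := h.bot_le v <;> grind
  obtain ⟨R, b1, b2, b3⟩ := Φ.exists_refinement hU h ho hu₂ hu₃ h12 h23 r12 r23 r31
  obtain ⟨N, hN⟩ := R.exists_isSelective
  have hgood := fun c hc d hd hcd => Refinement.isGoodPair { R with N := N } h ho hu₂ hu₃ h12 h23
    (rigid o u₂ u₃ ho hu₂ h12.ne hcyc r23) (rigid u₂ u₃ o hu₂ hu₃ h23.ne hcyc.cyclic_left r31)
    (rigid u₃ o u₂ hu₃ ho h13.ne' hcyc.cyclic_right r12) b1 b2 b3 (c := c) (d := d) hc hd hcd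
  exact ⟨_, Refinement.isLeMaximal_toPseudoflower { R with N := N } h hN ho hgood,
    Refinement.extends_toPseudoflower { R with N := N } h hN ho hgood⟩
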